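/- Let $(M^n,g)$ be a closed (compact, without boundary) smooth Riemannian manifold with Riemannian volume measure $d\nu$, let $f:M\to\mathbb{R}$ be of class $C^2$ and put $d\mu=e^{-f}d\nu$ and $\mathrm{div}_f X=e^{f}\,\mathrm{div}(e^{-f}X)$. Let $p>1$, $a<b$, let $\eta:[a,b]\to\mathbb{R}$ be smooth, and let $u:M\times[a,b]\to\mathbb{R}^m$ be smooth and not identically zero. Put $|\nabla u|^2=\sum_k|\nabla u_k|^2$ and let $\Delta_{f,p}u=\mathrm{div}_f(|\nabla u|^{p-2}\nabla u)$ (componentwise); if $1<p<2$, assume that for every $t\in[a,b]$ the fields $|\nabla u|^{p-2}\nabla u_k$ (understood as $0$ where $\nabla u=0$) are of class $C^1$ on $M$, so that $\Delta_{f,p}u$ is defined (for $p\ge2$ this is automatic). Suppose that $$|u|^{p-2}u_t-\Delta_{f,p}u=\eta(t)\,|u|^{p-2}u$$ on $M\times[a,b]$ (if $1<p<2$, at all points where $u\neq0$). Define $$D_p(t)=-\int_M|\nabla u|^p\,d\mu,\qquad I_p(t)=\int_M|u|^p\,d\mu,\qquad U_p(t)=\frac{D_p(t)}{I_p(t)}.$$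 Then $I_p(t)>0$ and $D_p(t)=\int_M\langle u,\Delta_{f,p}u\rangle\,d\mu$ for all $t\in[a,b]$, and $U_p$ is nondecreasing on $[a,b]$. Moreover, if $U_p$ is constant on $[a,b]$, then $u(\cdot,t)$ is for every $t\in[a,b]$ an eigenfunction of $\Delta_{f,p}$, namely $\Delta_{f,p}u=U_p(t)\,|u|^{p-2}u$ on $M$, and for all $x\in M$, $t\in[a,b]$ $$|u(x,t)|^{p-2}u(x,t)=e^{(p-1)(U_p(t)t-U_p(a)a)}\exp\Big\{(p-1)\int_a^t\eta(s)\,ds\Big\}\,|u(x,a)|^{p-2}u(x,a)$$ (with $|v|^{p-2}v=0$ for $v=0$). Also, if $\eta$ is nondecreasing on $[a,b]$, then $\log I_p$ is convex on $[a,b]$. -/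

import Mathlib

open Set MeasureTheory Bundle Manifold
open scoped ContDiff

noncomputable section

namespace PFreq

section Geometry

variable {n : ℕ} {M : Type*} [TopologicalSpace M] [ChartedSpace (EuclideanSpace ℝ (Fin n)) M]
  [IsManifold (𝓡 n) ∞ M]
  [RiemannianBundle (fun x : M => TangentSpace (𝓡 n) x)]

/-- The coordinate vector field `∂_i` of the chart at `x₀`, at the point with coordinates `z`. -/
def coordVec (x₀ : M) (z : EuclideanSpace ℝ (Fin n)) (i : Fin n) :
    TangentSpace (𝓡 n) ((extChartAt (𝓡 n) x₀).symm z) :=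
  mfderiv 𝓘(ℝ, EuclideanSpace ℝ (Fin n)) (𝓡 n) (extChartAt (𝓡 n) x₀).symm z
    (EuclideanSpace.single i (1 : ℝ))

/-- The matrix `g_{ij}` of the Riemannian metric in the chart at `x₀`. -/
def gram (x₀ : M) (z : EuclideanSpace ℝ (Fin n)) : Matrix (Fin n) (Fin n) ℝ :=
  Matrix.of fun i j => inner ℝ (coordVec x₀ z i) (coordVec x₀ z j)

/-- The Riemannian volume density `√(det g_{ij})` in the chart at `x₀`. -/
def volDensity (x₀ : M) (z : EuclideanSpace ℝ (Fin n)) : ℝ :=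
  Real.sqrt (gram x₀ z).det

/-- The Riemannian volume of the domain of the chart at `x₀`: the image of
`√(det g_{ij}) dz` under the inverse of the chart. -/
def chartVolume [MeasurableSpace M] (x₀ : M) : Measure M :=
  ((volume.restrict (extChartAt (𝓡 n) x₀).target).withDensity
    (fun z => ENNReal.ofReal (volDensity x₀ z))).map (extChartAt (𝓡 n) x₀).symm

open Classical in
/-- The Riemannian volume measure `dν`: a sequence of charts whose domains cover `M` is chosen, the
domains are made disjoint, and the chart volumes are added up. By the change of variables formula
the result does not depend on the sequence. (The value `0` is only taken on manifolds without such
a sequence, in particular never on a non-empty compact manifold.) -/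
def riemannianVolume (n : ℕ) (M : Type*) [TopologicalSpace M]
    [ChartedSpace (EuclideanSpace ℝ (Fin n)) M] [IsManifold (𝓡 n) ∞ M]
    [RiemannianBundle (fun x : M => TangentSpace (𝓡 n) x)] [MeasurableSpace M] : Measure M :=
  if h : ∃ c : ℕ → M, ⋃ k, (chartAt (EuclideanSpace ℝ (Fin n)) (c k)).source = univ then
    Measure.sum fun k => (chartVolume (n := n) (h.choose k)).restrict
      ((chartAt (EuclideanSpace ℝ (Fin n)) (h.choose k)).source \
        ⋃ j < k, (chartAt (EuclideanSpace ℝ (Fin n)) (h.choose j)).source)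
  else 0

/-- The weighted measure `dμ = e^{-f} dν`. -/
def weightedVolume (n : ℕ) {M : Type*} [TopologicalSpace M]
    [ChartedSpace (EuclideanSpace ℝ (Fin n)) M] [IsManifold (𝓡 n) ∞ M]
    [RiemannianBundle (fun x : M => TangentSpace (𝓡 n) x)] [MeasurableSpace M]
    (f : M → ℝ) : Measure M :=
  (riemannianVolume n M).withDensity fun x => ENNReal.ofReal (Real.exp (-f x))

/-- The Riemannian gradient `∇w` of a real function: `⟨∇w, v⟩ = dw(v)`. -/
def grad (w : M → ℝ) (x : M) : TangentSpace (𝓡 n) x :=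
  haveI : FiniteDimensional ℝ (TangentSpace (𝓡 n) x) :=
    inferInstanceAs (FiniteDimensional ℝ (EuclideanSpace ℝ (Fin n)))
  haveI : CompleteSpace (TangentSpace (𝓡 n) x) := FiniteDimensional.complete ℝ _
  (InnerProductSpace.toDual ℝ (TangentSpace (𝓡 n) x)).symm (mfderiv (𝓡 n) 𝓘(ℝ, ℝ) w x)

/-- The `i`-th component of a vector field in the chart at `x₀`, as a function of the
coordinates `z`. -/
def coordComp (X : (x : M) → TangentSpace (𝓡 n) x) (x₀ : M) (i : Fin n)
    (z : EuclideanSpace ℝ (Fin n)) : ℝ :=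
  (show EuclideanSpace ℝ (Fin n) from
    mfderiv (𝓡 n) 𝓘(ℝ, EuclideanSpace ℝ (Fin n)) (extChartAt (𝓡 n) x₀)
      ((extChartAt (𝓡 n) x₀).symm z) (X ((extChartAt (𝓡 n) x₀).symm z))) i

/-- The Riemannian divergence `div X = (det g)^{-1/2} ∑ᵢ ∂ᵢ((det g)^{1/2} Xⁱ)`, computed at `x` in
the preferred chart at `x`. -/
def divergence (X : (x : M) → TangentSpace (𝓡 n) x) (x : M) : ℝ :=
  (volDensity x (extChartAt (𝓡 n) x x))⁻¹ *
    ∑ i : Fin n, fderiv ℝ (fun z => volDensity x z * coordComp X x i z)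
      (extChartAt (𝓡 n) x x) (EuclideanSpace.single i (1 : ℝ))

/-- The weighted divergence `div_f X = e^f div(e^{-f} X)`. -/
def weightedDiv (f : M → ℝ) (X : (x : M) → TangentSpace (𝓡 n) x) (x : M) : ℝ :=
  Real.exp (f x) * divergence (fun y => Real.exp (-f y) • X y) x

variable {m : ℕ}

/-- The norm `|∇u| = (∑ₖ |∇uₖ|²)^{1/2}` of the gradient of a map `u` into `ℝᵐ`. -/
def gradNorm (n : ℕ) {M : Type*} [TopologicalSpace M]
    [ChartedSpace (EuclideanSpace ℝ (Fin n)) M] [IsManifold (𝓡 n) ∞ M]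
    [RiemannianBundle (fun x : M => TangentSpace (𝓡 n) x)] {m : ℕ}
    (u : M → EuclideanSpace ℝ (Fin m)) (x : M) : ℝ :=
  Real.sqrt (∑ k : Fin m, ‖grad (n := n) (fun y => u y k) x‖ ^ 2)

/-- The `k`-th component `|∇u|^{p-2} ∇uₖ` of the vector fields `|∇u|^{p-2} ∇u`. -/
def pFlux (p : ℝ) (u : M → EuclideanSpace ℝ (Fin m)) (k : Fin m) (x : M) :
    TangentSpace (𝓡 n) x :=
  (gradNorm n u x ^ (p - 2)) • grad (n := n) (fun y => u y k) x

/-- The weighted `p`-Laplacian `Δ_{f,p} u = div_f(|∇u|^{p-2} ∇u)`, taken componentwise. -/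
def pLaplacian (n : ℕ) {M : Type*} [TopologicalSpace M]
    [ChartedSpace (EuclideanSpace ℝ (Fin n)) M] [IsManifold (𝓡 n) ∞ M]
    [RiemannianBundle (fun x : M => TangentSpace (𝓡 n) x)] {m : ℕ}
    (f : M → ℝ) (p : ℝ) (u : M → EuclideanSpace ℝ (Fin m)) (x : M) :
    EuclideanSpace ℝ (Fin m) :=
  WithLp.toLp 2 fun k => weightedDiv (n := n) f (pFlux p u k) x

/-- `D_p(t) = -∫ |∇u(·,t)|^p dμ`. -/
def energyD (n : ℕ) {M : Type*} [TopologicalSpace M]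
    [ChartedSpace (EuclideanSpace ℝ (Fin n)) M] [IsManifold (𝓡 n) ∞ M]
    [RiemannianBundle (fun x : M => TangentSpace (𝓡 n) x)] [MeasurableSpace M] {m : ℕ}
    (f : M → ℝ) (p : ℝ) (u : M → ℝ → EuclideanSpace ℝ (Fin m)) (t : ℝ) : ℝ :=
  -∫ x, gradNorm n (fun y => u y t) x ^ p ∂(weightedVolume n f)

/-- `I_p(t) = ∫ |u(·,t)|^p dμ`. -/
def massI (n : ℕ) {M : Type*} [TopologicalSpace M]
    [ChartedSpace (EuclideanSpace ℝ (Fin n)) M] [IsManifold (𝓡 n) ∞ M]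
    [RiemannianBundle (fun x : M => TangentSpace (𝓡 n) x)] [MeasurableSpace M] {m : ℕ}
    (f : M → ℝ) (p : ℝ) (u : M → ℝ → EuclideanSpace ℝ (Fin m)) (t : ℝ) : ℝ :=
  ∫ x, ‖u x t‖ ^ p ∂(weightedVolume n f)

/-- The parabolic `p`-frequency `U_p(t) = D_p(t) / I_p(t)`. -/
def freqU (n : ℕ) {M : Type*} [TopologicalSpace M]
    [ChartedSpace (EuclideanSpace ℝ (Fin n)) M] [IsManifold (𝓡 n) ∞ M]
    [RiemannianBundle (fun x : M => TangentSpace (𝓡 n) x)] [MeasurableSpace M] {m : ℕ}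
    (f : M → ℝ) (p : ℝ) (u : M → ℝ → EuclideanSpace ℝ (Fin m)) (t : ℝ) : ℝ :=
  energyD n f p u t / massI n f p u t

end Geometry

end PFreq

end

set_option linter.unusedSectionVars false

/-! Write I, D, U for the mass, energy and frequency and Δ for the weighted p-Laplacian. Pairing the
equation with u gives I' = p(D + ηI). Differentiating the energy and integrating by parts against
u_t gives D' = p∫⟨u_t, Δu⟩. Where u ≠ 0, inserting Δu = |u|^{p-2}(u_t - ηu) and completing the
square gives, for every real l, ⟨u_t, Δu⟩ - (η + 2l)⟨u, Δu⟩ + l²|u|^p = |u|^{p-2}|u_t - (η + l)u|² ≥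
0. Integrated with l = U, this says that D'I - DI', the numerator of U', is pI times the integral of
a square, so U is nondecreasing. This replaces Cauchy–Schwarz and carries the equality case with it.
If U is constant, the square vanishes and u_t = (η + U)u where u ≠ 0. The equation then turns this
into the eigenvalue equation, and a linear ODE at each point gives the formula for |u|^{p-2}u.
Convexity of log I follows from (log I)' = p(U + η).

Three points need care. First, at zeros of u the equation may say nothing when p < 2. However, a
differentiable function has zero derivative at almost every one of its zeros. Applied to u, this
makes the flux |∇u|^{p-2}∇u vanish almost everywhere on {u = 0}; applied again to the components of
the C¹ flux, it makes Δu vanish there too (`ae_pLaplacian_eq_zero`). So only points with u ≠ 0 are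
ever used, for every p.

Second, I > 0 is part of the conclusion (`mass_pos`). Backwards in time it follows from D ≤ 0, by
Gronwall. Forwards, up to a first zero of I the frequency is monotone, hence bounded below, and
Gronwall excludes the zero.

Third, the geometry is built from charts. The change of variables formula makes the volume
independent of the charts (`riemannianVolume_apply`). Integration by parts in ℝⁿ and a partition of
unity give the divergence theorem (`integral_dirDeriv`), and from it Green's formula
(`integral_inner_pLaplacian`). For p ≥ 2 the flux is C¹ by `contDiffOn_rpow_mul`; the time
derivative of ∇u comes from symmetry of second derivatives. -/

namespace PFreq

/-! ### Coordinate frames, the metric matrix and gradients in a chart. -/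

section ChartGeometry

variable {n : ℕ} {M : Type*} [TopologicalSpace M] [ChartedSpace (EuclideanSpace ℝ (Fin n)) M]

/-- The `i`-th partial derivative of a function on `ℝⁿ`. -/
noncomputable def partialDeriv (i : Fin n) (h : EuclideanSpace ℝ (Fin n) → ℝ)
    (z : EuclideanSpace ℝ (Fin n)) : ℝ :=
  fderiv ℝ h z (EuclideanSpace.single i (1 : ℝ))

theorem euclidean_eq_sum_single (v : EuclideanSpace ℝ (Fin n)) :
    v = ∑ i, v i • EuclideanSpace.single i (1 : ℝ) := by
  ext j
  simp [Finset.sum_apply, Pi.single_apply]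

variable [IsManifold (𝓡 n) ∞ M]

theorem mdifferentiableAt_chart_symm {c : M} {z : EuclideanSpace ℝ (Fin n)}
    (hz : z ∈ (extChartAt (𝓡 n) c).target) :
    MDifferentiableAt 𝓘(ℝ, EuclideanSpace ℝ (Fin n)) (𝓡 n) (extChartAt (𝓡 n) c).symm z :=
  (((contMDiffOn_extChartAt_symm (n := ∞) c) z hz).contMDiffAt
    ((isOpen_extChartAt_target c).mem_nhds hz)).mdifferentiableAt (by simp)

theorem mdifferentiableAt_chart {c x : M} (hx : x ∈ (extChartAt (𝓡 n) c).source) :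
    MDifferentiableAt (𝓡 n) 𝓘(ℝ, EuclideanSpace ℝ (Fin n)) (extChartAt (𝓡 n) c) x :=
  (contMDiffAt_extChartAt' (n := ∞) (by simpa using hx)).mdifferentiableAt (by simp)

theorem mfderiv_chart_comp_symm {c : M} {z : EuclideanSpace ℝ (Fin n)}
    (hz : z ∈ (extChartAt (𝓡 n) c).target) (v : EuclideanSpace ℝ (Fin n)) :
    mfderiv (𝓡 n) 𝓘(ℝ, EuclideanSpace ℝ (Fin n)) (extChartAt (𝓡 n) c)
      ((extChartAt (𝓡 n) c).symm z)
      (mfderiv 𝓘(ℝ, EuclideanSpace ℝ (Fin n)) (𝓡 n) (extChartAt (𝓡 n) c).symm z v) = v := by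
  have h := mfderiv_extChartAt_comp_mfderivWithin_extChartAt_symm (I := 𝓡 n) hz
  simp only [ModelWithCorners.Boundaryless.range_eq_univ, mfderivWithin_univ] at h
  exact congrArg (fun A : EuclideanSpace ℝ (Fin n) →L[ℝ] EuclideanSpace ℝ (Fin n) => A v) h

theorem mfderiv_symm_comp_chart {c : M} {z : EuclideanSpace ℝ (Fin n)}
    (hz : z ∈ (extChartAt (𝓡 n) c).target)
    (v : TangentSpace (𝓡 n) ((extChartAt (𝓡 n) c).symm z)) :
    mfderiv 𝓘(ℝ, EuclideanSpace ℝ (Fin n)) (𝓡 n) (extChartAt (𝓡 n) c).symm z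
      (mfderiv (𝓡 n) 𝓘(ℝ, EuclideanSpace ℝ (Fin n)) (extChartAt (𝓡 n) c)
      ((extChartAt (𝓡 n) c).symm z) v) = v := by
  have h := mfderivWithin_extChartAt_symm_comp_mfderiv_extChartAt (I := 𝓡 n) hz
  simp only [ModelWithCorners.Boundaryless.range_eq_univ, mfderivWithin_univ] at h
  exact congrArg (fun A : EuclideanSpace ℝ (Fin n) →L[ℝ] EuclideanSpace ℝ (Fin n) => A v) h

/-- The coordinate field is the tangent map of the inverse chart applied to a constant section.
Together with smoothness of the metric this makes the functions g_{ij} smooth. -/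
theorem coordVec_contMDiffOn (c : M) (i : Fin n) :
    ContMDiffOn 𝓘(ℝ, EuclideanSpace ℝ (Fin n)) (𝓡 n).tangent ∞
      (fun z => (⟨(extChartAt (𝓡 n) c).symm z, coordVec c z i⟩ : TangentBundle (𝓡 n) M))
      (extChartAt (𝓡 n) c).target := by
  have h := (contMDiffOn_extChartAt_symm (I := 𝓡 n) (n := ∞) c).contMDiffOn_tangentMapWithin
    (m := ∞) (by simp) (isOpen_extChartAt_target c).uniqueMDiffOn
  have h2 : ContMDiff 𝓘(ℝ, EuclideanSpace ℝ (Fin n)) 𝓘(ℝ, EuclideanSpace ℝ (Fin n)).tangent ∞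
      (fun z => (⟨z, EuclideanSpace.single i (1 : ℝ)⟩ :
        TangentBundle 𝓘(ℝ, EuclideanSpace ℝ (Fin n)) (EuclideanSpace ℝ (Fin n)))) :=
    contMDiff_vectorSpace_iff_contDiff.2 contDiff_const
  refine (h.comp h2.contMDiffOn (fun z hz => hz)).congr ?_
  intro z hz
  simp only [Function.comp, tangentMapWithin]
  rw [mfderivWithin_of_isOpen (isOpen_extChartAt_target c) hz]
  rfl

variable [RiemannianBundle (fun x : M => TangentSpace (𝓡 n) x)]

section Smooth

variable [IsContMDiffRiemannianBundle (𝓡 n) ∞ (EuclideanSpace ℝ (Fin n))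
      (fun x : M => TangentSpace (𝓡 n) x)]

theorem gram_contDiffOn (c : M) (i j : Fin n) :
    ContDiffOn ℝ ∞ (fun z => gram c z i j) (extChartAt (𝓡 n) c).target := by
  rw [← contMDiffOn_iff_contDiffOn]
  exact (coordVec_contMDiffOn c i).inner_bundle (coordVec_contMDiffOn c j)

end Smooth

theorem coordVec_linearIndependent {c : M} {z : EuclideanSpace ℝ (Fin n)}
    (hz : z ∈ (extChartAt (𝓡 n) c).target) : LinearIndependent ℝ (coordVec c z) := by
  let A : EuclideanSpace ℝ (Fin n) →ₗ[ℝ] TangentSpace (𝓡 n) ((extChartAt (𝓡 n) c).symm z) :=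
    (mfderiv 𝓘(ℝ, EuclideanSpace ℝ (Fin n)) (𝓡 n) (extChartAt (𝓡 n) c).symm z).toLinearMap
  have hA : LinearMap.ker A = ⊥ := by
    rw [LinearMap.ker_eq_bot]
    exact Function.LeftInverse.injective (g := fun v => mfderiv (𝓡 n) 𝓘(ℝ, EuclideanSpace ℝ (Fin n))
      (extChartAt (𝓡 n) c) ((extChartAt (𝓡 n) c).symm z) v) (fun v => mfderiv_chart_comp_symm hz v)
  have h := (EuclideanSpace.basisFun (Fin n) ℝ).toBasis.linearIndependent.map' A hA
  have h2 : ⇑A ∘ ⇑(EuclideanSpace.basisFun (Fin n) ℝ).toBasis = coordVec c z := by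
    funext i
    rw [Function.comp_apply, OrthonormalBasis.coe_toBasis, EuclideanSpace.basisFun_apply]
    rfl
  rw [h2] at h
  exact h

theorem gram_posDef {c : M} {z : EuclideanSpace ℝ (Fin n)}
    (hz : z ∈ (extChartAt (𝓡 n) c).target) : (gram c z).PosDef :=
  Matrix.posDef_gram_of_linearIndependent (𝕜 := ℝ) (coordVec_linearIndependent hz)

theorem gram_det_pos {c : M} {z : EuclideanSpace ℝ (Fin n)}
    (hz : z ∈ (extChartAt (𝓡 n) c).target) : 0 < (gram c z).det := (gram_posDef hz).det_pos

theorem volDensity_pos {c : M} {z : EuclideanSpace ℝ (Fin n)}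
    (hz : z ∈ (extChartAt (𝓡 n) c).target) : 0 < volDensity c z :=
  Real.sqrt_pos.2 (gram_det_pos hz)

/-- A tangent vector is the combination of the coordinate vectors with its components. -/
theorem eq_sum_coordComp (X : (x : M) → TangentSpace (𝓡 n) x) {c : M}
    {z : EuclideanSpace ℝ (Fin n)} (hz : z ∈ (extChartAt (𝓡 n) c).target) :
    X ((extChartAt (𝓡 n) c).symm z) = ∑ i, coordComp X c i z • coordVec c z i := by
  have h := mfderiv_symm_comp_chart hz (X ((extChartAt (𝓡 n) c).symm z))
  conv_lhs => rw [← h]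
  set v : EuclideanSpace ℝ (Fin n) := mfderiv (𝓡 n) 𝓘(ℝ, EuclideanSpace ℝ (Fin n))
    (extChartAt (𝓡 n) c) ((extChartAt (𝓡 n) c).symm z) (X ((extChartAt (𝓡 n) c).symm z)) with hv
  have h3 : mfderiv 𝓘(ℝ, EuclideanSpace ℝ (Fin n)) (𝓡 n) (extChartAt (𝓡 n) c).symm z v
      = ∑ i, v i • mfderiv 𝓘(ℝ, EuclideanSpace ℝ (Fin n)) (𝓡 n) (extChartAt (𝓡 n) c).symm z
        (EuclideanSpace.single i (1 : ℝ)) := by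
    conv_lhs => rw [euclidean_eq_sum_single v]
    erw [map_sum]
    refine Finset.sum_congr rfl fun i _ => ?_
    exact ContinuousLinearMap.map_smul _ _ _
  exact h3

theorem mfderiv_coordVec {w : M → ℝ} {c : M} {z : EuclideanSpace ℝ (Fin n)}
    (hz : z ∈ (extChartAt (𝓡 n) c).target)
    (hw : MDifferentiableAt (𝓡 n) 𝓘(ℝ, ℝ) w ((extChartAt (𝓡 n) c).symm z)) (i : Fin n) :
    mfderiv (𝓡 n) 𝓘(ℝ, ℝ) w ((extChartAt (𝓡 n) c).symm z) (coordVec c z i)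
      = partialDeriv i (w ∘ (extChartAt (𝓡 n) c).symm) z := by
  have h := mfderiv_comp z hw (mdifferentiableAt_chart_symm hz)
  rw [mfderiv_eq_fderiv] at h
  rw [partialDeriv, h]
  rfl

theorem mfderiv_eq_sum_partialDeriv {w : M → ℝ} {c : M} {z : EuclideanSpace ℝ (Fin n)}
    (hz : z ∈ (extChartAt (𝓡 n) c).target)
    (hw : MDifferentiableAt (𝓡 n) 𝓘(ℝ, ℝ) w ((extChartAt (𝓡 n) c).symm z))
    (X : (x : M) → TangentSpace (𝓡 n) x) :
    mfderiv (𝓡 n) 𝓘(ℝ, ℝ) w ((extChartAt (𝓡 n) c).symm z) (X ((extChartAt (𝓡 n) c).symm z))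
      = ∑ i, coordComp X c i z * partialDeriv i (w ∘ (extChartAt (𝓡 n) c).symm) z := by
  rw [eq_sum_coordComp X hz]
  erw [map_sum]
  refine Finset.sum_congr rfl fun i _ => ?_
  rw [← mfderiv_coordVec hz hw]
  exact ContinuousLinearMap.map_smul _ _ _

theorem inner_grad (w : M → ℝ) (x : M) (v : TangentSpace (𝓡 n) x) :
    inner ℝ (grad w x) v = (mfderiv (𝓡 n) 𝓘(ℝ, ℝ) w x v : ℝ) := by
  have : FiniteDimensional ℝ (TangentSpace (𝓡 n) x) :=
    inferInstanceAs (FiniteDimensional ℝ (EuclideanSpace ℝ (Fin n)))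
  have : CompleteSpace (TangentSpace (𝓡 n) x) := FiniteDimensional.complete ℝ _
  exact InnerProductSpace.toDual_symm_apply

/-- Pairing the gradient with the coordinate vectors gives the linear system g·(∇w) = ∂w, which is
inverted. -/
theorem coordComp_grad {w : M → ℝ} {c : M} {z : EuclideanSpace ℝ (Fin n)}
    (hz : z ∈ (extChartAt (𝓡 n) c).target)
    (hw : MDifferentiableAt (𝓡 n) 𝓘(ℝ, ℝ) w ((extChartAt (𝓡 n) c).symm z)) (i : Fin n) :
    coordComp (grad w) c i z
      = ∑ j, (gram c z)⁻¹ i j * partialDeriv j (w ∘ (extChartAt (𝓡 n) c).symm) z := by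
  have h : ∀ j, ∑ i, gram c z j i * coordComp (grad w) c i z
      = partialDeriv j (w ∘ (extChartAt (𝓡 n) c).symm) z := by
    intro j
    rw [← mfderiv_coordVec hz hw, ← inner_grad, eq_sum_coordComp (grad w) hz, sum_inner]
    refine Finset.sum_congr rfl fun i _ => ?_
    rw [inner_smul_left, real_inner_comm, mul_comm]
    rfl
  have h2 : (gram c z).mulVec (fun i => coordComp (grad w) c i z)
      = fun j => partialDeriv j (w ∘ (extChartAt (𝓡 n) c).symm) z := funext h
  have h3 := congrArg (fun v => (gram c z)⁻¹.mulVec v) h2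
  simp only [Matrix.mulVec_mulVec] at h3
  rw [Matrix.nonsing_inv_mul _ (gram_det_pos hz).ne'.isUnit, Matrix.one_mulVec] at h3
  exact congrFun h3 i

theorem inner_grad_grad {w v : M → ℝ} {c : M} {z : EuclideanSpace ℝ (Fin n)}
    (hz : z ∈ (extChartAt (𝓡 n) c).target)
    (hw : MDifferentiableAt (𝓡 n) 𝓘(ℝ, ℝ) w ((extChartAt (𝓡 n) c).symm z)) :
    inner ℝ (grad (n := n) w ((extChartAt (𝓡 n) c).symm z)) (grad v ((extChartAt (𝓡 n) c).symm z))
      = ∑ i, coordComp (grad v) c i z * partialDeriv i (w ∘ (extChartAt (𝓡 n) c).symm) z := by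
  rw [inner_grad, mfderiv_eq_sum_partialDeriv hz hw]

end ChartGeometry

end PFreq

namespace PFreq

/-! ### The Riemannian volume: independence of charts, finiteness, positivity on open sets. -/

section Volume

variable {n : ℕ} {M : Type*} [TopologicalSpace M] [ChartedSpace (EuclideanSpace ℝ (Fin n)) M]
  [IsManifold (𝓡 n) ∞ M] [RiemannianBundle (fun x : M => TangentSpace (𝓡 n) x)]

theorem transition_fderiv {c c' : M} {z : EuclideanSpace ℝ (Fin n)}
    (hz : z ∈ (extChartAt (𝓡 n) c).target)
    (hz' : (extChartAt (𝓡 n) c).symm z ∈ (extChartAt (𝓡 n) c').source) :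
    HasFDerivAt (fun y => extChartAt (𝓡 n) c' ((extChartAt (𝓡 n) c).symm y))
      (fderiv ℝ (fun y => extChartAt (𝓡 n) c' ((extChartAt (𝓡 n) c).symm y)) z) z := by
  have h := (mdifferentiableAt_chart hz').comp z (mdifferentiableAt_chart_symm hz)
  exact h.differentiableAt.hasFDerivAt

/-- Chain rule: near z the inverse of the first chart is the inverse of the second after the
transition map. The vectors are compared in the model space because the two tangent spaces sit at
points that are equal only by a proof. -/
theorem coordVec_transition {c c' : M} {z : EuclideanSpace ℝ (Fin n)}
    (hz : z ∈ (extChartAt (𝓡 n) c).target)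
    (hz' : (extChartAt (𝓡 n) c).symm z ∈ (extChartAt (𝓡 n) c').source) (i : Fin n) :
    (show EuclideanSpace ℝ (Fin n) from coordVec c z i) =
      (show EuclideanSpace ℝ (Fin n) →L[ℝ] EuclideanSpace ℝ (Fin n) from
        mfderiv 𝓘(ℝ, EuclideanSpace ℝ (Fin n)) (𝓡 n) (extChartAt (𝓡 n) c').symm
        (extChartAt (𝓡 n) c' ((extChartAt (𝓡 n) c).symm z)))
      (fderiv ℝ (fun y => extChartAt (𝓡 n) c' ((extChartAt (𝓡 n) c).symm y)) z
        (EuclideanSpace.single i (1 : ℝ))) := by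
  have hev : (fun y => (extChartAt (𝓡 n) c').symm
      ((fun y => extChartAt (𝓡 n) c' ((extChartAt (𝓡 n) c).symm y)) y))
      =ᶠ[nhds z] (extChartAt (𝓡 n) c).symm := by
    have h1 : ∀ᶠ y in nhds z, (extChartAt (𝓡 n) c).symm y ∈ (extChartAt (𝓡 n) c').source :=
      (continuousAt_extChartAt_symm'' hz).preimage_mem_nhds
        ((isOpen_extChartAt_source c').mem_nhds hz')
    filter_upwards [h1] with y hy
    exact (extChartAt (𝓡 n) c').left_inv hy
  have h := mfderiv_comp (I := 𝓘(ℝ, EuclideanSpace ℝ (Fin n)))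
    (I' := 𝓘(ℝ, EuclideanSpace ℝ (Fin n))) (I'' := 𝓡 n) z
    (g := (extChartAt (𝓡 n) c').symm)
    (f := fun y => extChartAt (𝓡 n) c' ((extChartAt (𝓡 n) c).symm y))
    (mdifferentiableAt_chart_symm ((extChartAt (𝓡 n) c').map_source hz'))
    (transition_fderiv hz hz').differentiableAt.mdifferentiableAt
  rw [mfderiv_eq_fderiv] at h
  have h2 := hev.mfderiv_eq (I := 𝓘(ℝ, EuclideanSpace ℝ (Fin n))) (I' := 𝓡 n)
  have h3 : (show EuclideanSpace ℝ (Fin n) →L[ℝ] EuclideanSpace ℝ (Fin n) from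
      mfderiv 𝓘(ℝ, EuclideanSpace ℝ (Fin n)) (𝓡 n) (extChartAt (𝓡 n) c).symm z) =
      (show EuclideanSpace ℝ (Fin n) →L[ℝ] EuclideanSpace ℝ (Fin n) from
        mfderiv 𝓘(ℝ, EuclideanSpace ℝ (Fin n)) (𝓡 n) (extChartAt (𝓡 n) c').symm
        (extChartAt (𝓡 n) c' ((extChartAt (𝓡 n) c).symm z))).comp
      (fderiv ℝ (fun y => extChartAt (𝓡 n) c' ((extChartAt (𝓡 n) c).symm y)) z) :=
    h2.symm.trans h
  exact congrArg (fun A : EuclideanSpace ℝ (Fin n) →L[ℝ] EuclideanSpace ℝ (Fin n) =>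
    A (EuclideanSpace.single i (1 : ℝ))) h3

/-- The metric at a point, as a function of vectors of the model space. -/
noncomputable def metricAt (x : M) (v w : EuclideanSpace ℝ (Fin n)) : ℝ :=
  inner ℝ (show TangentSpace (𝓡 n) x from v) (show TangentSpace (𝓡 n) x from w)

theorem metricAt_sum (x : M) (a b : Fin n → ℝ) (v w : Fin n → EuclideanSpace ℝ (Fin n)) :
    metricAt x (∑ i, a i • v i) (∑ j, b j • w j) = ∑ i, ∑ j, a i * metricAt x (v i) (w j) * b j := by
  have h : metricAt x (∑ i, a i • v i) (∑ j, b j • w j)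
    = inner ℝ (∑ i, a i • (show TangentSpace (𝓡 n) x from v i))
      (∑ j, b j • (show TangentSpace (𝓡 n) x from w j)) := rfl
  rw [h, sum_inner]
  refine Finset.sum_congr rfl fun i _ => ?_
  rw [inner_sum]
  refine Finset.sum_congr rfl fun j _ => ?_
  rw [inner_smul_left, inner_smul_right]
  simp only [metricAt, conj_trivial]
  ring

theorem gram_transition {c c' : M} {z : EuclideanSpace ℝ (Fin n)}
    (hz : z ∈ (extChartAt (𝓡 n) c).target)
    (hz' : (extChartAt (𝓡 n) c).symm z ∈ (extChartAt (𝓡 n) c').source) :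
    gram c z = (Matrix.of fun i a => fderiv ℝ
        (fun y => extChartAt (𝓡 n) c' ((extChartAt (𝓡 n) c).symm y)) z
        (EuclideanSpace.single i (1 : ℝ)) a) *
      gram c' (extChartAt (𝓡 n) c' ((extChartAt (𝓡 n) c).symm z)) *
      (Matrix.of fun i a => fderiv ℝ
        (fun y => extChartAt (𝓡 n) c' ((extChartAt (𝓡 n) c).symm y)) z
        (EuclideanSpace.single i (1 : ℝ)) a).transpose := by
  ext i j
  have h1 : gram c z i j = metricAt ((extChartAt (𝓡 n) c).symm z)
    (show EuclideanSpace ℝ (Fin n) from coordVec c z i)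
    (show EuclideanSpace ℝ (Fin n) from coordVec c z j) := rfl
  have h2 : ∀ k l, gram c' (extChartAt (𝓡 n) c' ((extChartAt (𝓡 n) c).symm z)) k l
      = metricAt ((extChartAt (𝓡 n) c).symm z)
        (show EuclideanSpace ℝ (Fin n) from coordVec c'
          (extChartAt (𝓡 n) c' ((extChartAt (𝓡 n) c).symm z)) k)
        (show EuclideanSpace ℝ (Fin n) from coordVec c'
          (extChartAt (𝓡 n) c' ((extChartAt (𝓡 n) c).symm z)) l) := by
    intro k l
    -- The base point is made a variable so that the equality of the two base points can be
    -- eliminated by substitution.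
    have : ∀ x, (extChartAt (𝓡 n) c').symm (extChartAt (𝓡 n) c' ((extChartAt (𝓡 n) c).symm z)) = x →
      gram c' (extChartAt (𝓡 n) c' ((extChartAt (𝓡 n) c).symm z)) k l
      = metricAt x
        (show EuclideanSpace ℝ (Fin n) from coordVec c'
          (extChartAt (𝓡 n) c' ((extChartAt (𝓡 n) c).symm z)) k)
        (show EuclideanSpace ℝ (Fin n) from coordVec c'
          (extChartAt (𝓡 n) c' ((extChartAt (𝓡 n) c).symm z)) l) := by
      rintro x rfl
      rfl
    exact this _ ((extChartAt (𝓡 n) c').left_inv hz')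
  have h3 : ∀ i, (show EuclideanSpace ℝ (Fin n) from coordVec c z i) =
      ∑ a, fderiv ℝ (fun y => extChartAt (𝓡 n) c' ((extChartAt (𝓡 n) c).symm y)) z
        (EuclideanSpace.single i (1 : ℝ)) a • (show EuclideanSpace ℝ (Fin n) from coordVec c'
          (extChartAt (𝓡 n) c' ((extChartAt (𝓡 n) c).symm z)) a) := by
    intro i
    rw [coordVec_transition hz hz']
    conv_lhs => rw [euclidean_eq_sum_single (fderiv ℝ
      (fun y => extChartAt (𝓡 n) c' ((extChartAt (𝓡 n) c).symm y)) z
        (EuclideanSpace.single i (1 : ℝ)))]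
    rw [map_sum]
    refine Finset.sum_congr rfl fun a _ => ?_
    rw [map_smul]
    rfl
  rw [h1, h3 i, h3 j, metricAt_sum, Matrix.mul_apply]
  simp only [Matrix.mul_apply, Matrix.of_apply, Matrix.transpose_apply, h2]
  rw [Finset.sum_comm]
  simp only [Finset.sum_mul]

/-- The metric matrices satisfy G = A G' Aᵀ with A the transposed Jacobian, so the determinants
differ by the factor (det A)², whose root is an absolute value. -/
theorem volDensity_transition {c c' : M} {z : EuclideanSpace ℝ (Fin n)}
    (hz : z ∈ (extChartAt (𝓡 n) c).target)
    (hz' : (extChartAt (𝓡 n) c).symm z ∈ (extChartAt (𝓡 n) c').source) :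
    volDensity c z = |(fderiv ℝ
        (fun y => extChartAt (𝓡 n) c' ((extChartAt (𝓡 n) c).symm y)) z).det| *
      volDensity c' (extChartAt (𝓡 n) c' ((extChartAt (𝓡 n) c).symm z)) := by
  have hdet : (Matrix.of fun i a => fderiv ℝ
        (fun y => extChartAt (𝓡 n) c' ((extChartAt (𝓡 n) c).symm y)) z
        (EuclideanSpace.single i (1 : ℝ)) a).det = (fderiv ℝ
        (fun y => extChartAt (𝓡 n) c' ((extChartAt (𝓡 n) c).symm y)) z).det := by
    -- The images of the basis vectors form the rows here and the columns in `LinearMap.toMatrix`,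
    -- hence the transpose.
    rw [ContinuousLinearMap.det, ← LinearMap.det_toMatrix (EuclideanSpace.basisFun (Fin n) ℝ).toBasis,
      ← Matrix.det_transpose]
    congr 1
  rw [volDensity, gram_transition hz hz', Matrix.det_mul, Matrix.det_mul, Matrix.det_transpose, hdet,
    mul_right_comm, Real.sqrt_mul (mul_self_nonneg _), Real.sqrt_mul_self_eq_abs, volDensity]

section Smooth

variable [IsContMDiffRiemannianBundle (𝓡 n) ∞ (EuclideanSpace ℝ (Fin n))
      (fun x : M => TangentSpace (𝓡 n) x)]

theorem gram_det_contDiffOn (c : M) :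
    ContDiffOn ℝ ∞ (fun z => (gram c z).det) (extChartAt (𝓡 n) c).target := by
  simp only [Matrix.det_apply]
  refine ContDiffOn.sum fun σ _ => ContDiffOn.const_smul _ ?_
  exact contDiffOn_prod fun i _ => gram_contDiffOn c _ _

theorem gram_inv_contDiffOn (c : M) (i j : Fin n) :
    ContDiffOn ℝ ∞ (fun z => (gram c z)⁻¹ i j) (extChartAt (𝓡 n) c).target := by
  have h : ∀ z, (gram c z)⁻¹ i j = ((gram c z).det)⁻¹ * (gram c z).adjugate i j := fun z => by
    rw [Matrix.inv_def, Matrix.smul_apply, Ring.inverse_eq_inv', smul_eq_mul]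
  simp only [h]
  refine ((gram_det_contDiffOn c).inv fun z hz => (gram_det_pos hz).ne').mul ?_
  simp only [Matrix.adjugate_apply, Matrix.det_apply]
  refine ContDiffOn.sum fun σ _ => ContDiffOn.const_smul _ ?_
  refine contDiffOn_prod fun k _ => ?_
  by_cases hk : σ k = j
  · simp only [hk, Matrix.updateRow_self]
    exact contDiffOn_const
  · simp only [Matrix.updateRow_ne hk]
    exact gram_contDiffOn c _ _

theorem volDensity_contDiffOn (c : M) :
    ContDiffOn ℝ ∞ (fun z => volDensity c z) (extChartAt (𝓡 n) c).target :=
  (gram_det_contDiffOn c).sqrt fun _ hz => (gram_det_pos hz).ne'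

variable [MeasurableSpace M] [BorelSpace M]

theorem aemeasurable_chart_symm (c : M) :
    AEMeasurable (extChartAt (𝓡 n) c).symm
      ((volume.restrict (extChartAt (𝓡 n) c).target).withDensity
        (fun z => ENNReal.ofReal (volDensity c z))) :=
  ((continuousOn_extChartAt_symm c).aemeasurable
    (isOpen_extChartAt_target c).measurableSet).mono_ac (withDensity_absolutelyContinuous _ _)

theorem aemeasurable_volDensity (c : M) :
    AEMeasurable (fun z => volDensity c z) (volume.restrict (extChartAt (𝓡 n) c).target) :=
  (volDensity_contDiffOn c).continuousOn.aemeasurable (isOpen_extChartAt_target c).measurableSet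

theorem chartVolume_apply (c : M) {B : Set M} (hB : MeasurableSet B) :
    chartVolume (n := n) c B = ∫⁻ z in (extChartAt (𝓡 n) c).symm ⁻¹' B ∩ (extChartAt (𝓡 n) c).target,
      ENNReal.ofReal (volDensity c z) := by
  rw [chartVolume, Measure.map_apply_of_aemeasurable (aemeasurable_chart_symm c) hB,
    withDensity_apply', Measure.restrict_restrict' (isOpen_extChartAt_target c).measurableSet]

/-- The inverse chart is continuous only on its target, so measurability is obtained on the subtype
and pushed forward. -/
theorem measurableSet_chart_preimage (c : M) {B : Set M} (hB : MeasurableSet B) :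
    MeasurableSet ((extChartAt (𝓡 n) c).symm ⁻¹' B ∩ (extChartAt (𝓡 n) c).target) := by
  have h : Measurable ((extChartAt (𝓡 n) c).target.domRestrict (extChartAt (𝓡 n) c).symm) :=
    (continuousOn_iff_continuous_domRestrict.1 (continuousOn_extChartAt_symm c)).measurable
  have h2 := MeasurableSet.subtype_image (isOpen_extChartAt_target c).measurableSet (h hB)
  convert h2 using 1
  ext z
  simp only [mem_inter_iff, mem_preimage, mem_image, Subtype.exists, domRestrict_apply,
    exists_and_right, exists_eq_right]
  tauto

/-- The chart volumes of two charts agree on the intersection of the domains. -/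
theorem chartVolume_eq (c c' : M) {B : Set M} (hB : MeasurableSet B)
    (h : B ⊆ (extChartAt (𝓡 n) c).source) (h' : B ⊆ (extChartAt (𝓡 n) c').source) :
    chartVolume (n := n) c B = chartVolume (n := n) c' B := by
  rw [chartVolume_apply c hB, chartVolume_apply c' hB]
  set S := (extChartAt (𝓡 n) c).symm ⁻¹' B ∩ (extChartAt (𝓡 n) c).target
  have hS : (extChartAt (𝓡 n) c').symm ⁻¹' B ∩ (extChartAt (𝓡 n) c').target =
      (fun y => extChartAt (𝓡 n) c' ((extChartAt (𝓡 n) c).symm y)) '' S := by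
    ext z
    constructor
    · rintro ⟨hz, hz'⟩
      refine ⟨extChartAt (𝓡 n) c ((extChartAt (𝓡 n) c').symm z), ⟨?_, ?_⟩, ?_⟩
      · rw [mem_preimage, (extChartAt (𝓡 n) c).left_inv (h hz)]
        exact hz
      · exact (extChartAt (𝓡 n) c).map_source (h hz)
      · simp only
        rw [(extChartAt (𝓡 n) c).left_inv (h hz), (extChartAt (𝓡 n) c').right_inv hz']
    · rintro ⟨y, ⟨hy, hy'⟩, rfl⟩
      refine ⟨?_, (extChartAt (𝓡 n) c').map_source (h' hy)⟩
      rw [mem_preimage, (extChartAt (𝓡 n) c').left_inv (h' hy)]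
      exact hy
  have hinj : InjOn (fun y => extChartAt (𝓡 n) c' ((extChartAt (𝓡 n) c).symm y)) S := by
    intro y hy z hz hyz
    exact (extChartAt (𝓡 n) c).symm.injOn hy.2 hz.2
      ((extChartAt (𝓡 n) c').injOn (h' hy.1) (h' hz.1) hyz)
  rw [hS, lintegral_image_eq_lintegral_abs_det_fderiv_mul volume (measurableSet_chart_preimage c hB)
    (fun z hz => (transition_fderiv hz.2 (h' hz.1)).hasFDerivWithinAt) hinj]
  refine setLIntegral_congr_fun (measurableSet_chart_preimage c hB) fun z hz => ?_
  rw [volDensity_transition hz.2 (h' hz.1), ENNReal.ofReal_mul (abs_nonneg _)]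

variable [CompactSpace M]

theorem exists_chart_sequence [Nonempty M] :
    ∃ c : ℕ → M, ⋃ k, (chartAt (EuclideanSpace ℝ (Fin n)) (c k)).source = univ := by
  obtain ⟨s, hsc, hs⟩ := countable_cover_nhds_of_sigmaCompact
    fun x : M => chart_source_mem_nhds (EuclideanSpace ℝ (Fin n)) x
  have hne : s.Nonempty := by
    rw [nonempty_iff_ne_empty]
    rintro rfl
    simp only [mem_empty_iff_false, iUnion_of_empty, iUnion_empty] at hs
    exact empty_ne_univ hs
  obtain ⟨c, rfl⟩ := hsc.exists_eq_range hne
  exact ⟨c, by simpa using hs⟩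

/-- The disjointed cover cuts B into pieces. On each piece the chart volume used in the definition
agrees with that of the chart at c, and countable additivity reassembles them. -/
theorem riemannianVolume_apply [Nonempty M] (c : M) {B : Set M} (hB : MeasurableSet B)
    (h : B ⊆ (extChartAt (𝓡 n) c).source) :
    riemannianVolume n M B = chartVolume (n := n) c B := by
  have hex := exists_chart_sequence (n := n) (M := M)
  rw [riemannianVolume, dif_pos hex]
  set d := hex.choose
  have hd : ⋃ k, (chartAt (EuclideanSpace ℝ (Fin n)) (d k)).source = univ := hex.choose_spec
  set A : ℕ → Set M := fun k => (chartAt (EuclideanSpace ℝ (Fin n)) (d k)).source \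
    ⋃ j < k, (chartAt (EuclideanSpace ℝ (Fin n)) (d j)).source with hA
  have hAm : ∀ k, MeasurableSet (A k) := fun k =>
    (chartAt (EuclideanSpace ℝ (Fin n)) (d k)).open_source.measurableSet.diff
      (isOpen_biUnion fun j _ => (chartAt (EuclideanSpace ℝ (Fin n)) (d j)).open_source).measurableSet
  have hdisj : Pairwise (Function.onFun Disjoint fun k => B ∩ A k) := by
    have key : ∀ i j, i < j → Disjoint (B ∩ A i) (B ∩ A j) := by
      intro i j hij
      rw [Set.disjoint_left]
      rintro x ⟨_, hx⟩ ⟨_, hx'⟩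
      exact hx'.2 (mem_iUnion₂.2 ⟨i, hij, hx.1⟩)
    intro i j hij
    rcases lt_or_gt_of_ne hij with h1 | h1
    · exact key i j h1
    · exact (key j i h1).symm
  have hunion : ⋃ k, B ∩ A k = B := by
    rw [← inter_iUnion, inter_eq_left]
    intro x _
    have hx : ∃ k, x ∈ (chartAt (EuclideanSpace ℝ (Fin n)) (d k)).source :=
      mem_iUnion.1 (hd ▸ mem_univ x)
    classical
    -- The piece containing x belongs to the first chart of the sequence whose domain contains x.
    refine mem_iUnion.2 ⟨Nat.find hx, Nat.find_spec hx, ?_⟩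
    rw [mem_iUnion₂]
    rintro ⟨j, hj, hxj⟩
    exact Nat.find_min hx hj hxj
  rw [Measure.sum_apply _ hB]
  have h2 : ∀ k, ((chartVolume (n := n) (d k)).restrict (A k)) B = chartVolume (n := n) c (B ∩ A k) := by
    intro k
    rw [Measure.restrict_apply hB]
    refine chartVolume_eq _ _ (hB.inter (hAm k)) ?_ (inter_subset_left.trans h)
    rw [extChartAt_source]
    exact inter_subset_right.trans sdiff_subset
  calc _ = ∑' k, chartVolume (n := n) c (B ∩ A k) := tsum_congr h2
    _ = _ := by rw [← measure_iUnion hdisj (fun k => hB.inter (hAm k)), hunion]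

theorem riemannianVolume_restrict [Nonempty M] (c : M) :
    (riemannianVolume n M).restrict (extChartAt (𝓡 n) c).source = chartVolume (n := n) c := by
  ext B hB
  have hs := (isOpen_extChartAt_source (I := 𝓡 n) c).measurableSet
  rw [Measure.restrict_apply hB, riemannianVolume_apply c (hB.inter hs) inter_subset_right,
    chartVolume_apply c hB, chartVolume_apply c (hB.inter hs)]
  congr 2
  ext z
  simp only [mem_inter_iff, mem_preimage]
  exact ⟨fun h => ⟨h.1.1, h.2⟩, fun h => ⟨⟨h.1, (extChartAt (𝓡 n) c).map_target h.2⟩, h.2⟩⟩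

theorem setIntegral_chart [Nonempty M] (c : M) {h : M → ℝ}
    (hm : AEStronglyMeasurable h
      ((riemannianVolume n M).restrict (extChartAt (𝓡 n) c).source)) :
    ∫ x in (extChartAt (𝓡 n) c).source, h x ∂(riemannianVolume n M) =
      ∫ z in (extChartAt (𝓡 n) c).target, volDensity c z * h ((extChartAt (𝓡 n) c).symm z) := by
  have hm2 : AEStronglyMeasurable h (chartVolume (n := n) c) := by
    rw [← riemannianVolume_restrict]
    exact hm
  rw [riemannianVolume_restrict]
  rw [chartVolume] at hm2 ⊢
  rw [integral_map (aemeasurable_chart_symm c) hm2,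
    integral_withDensity_eq_integral_toReal_smul₀ (aemeasurable_volDensity c).ennreal_ofReal
      (ae_of_all _ fun _ => ENNReal.ofReal_lt_top)]
  refine setIntegral_congr_fun (isOpen_extChartAt_target c).measurableSet fun z hz => ?_
  simp only [smul_eq_mul]
  rw [ENNReal.toReal_ofReal (volDensity_pos hz).le]

/-- Countably many charts suffice, and in each the volume has a density with respect to Lebesgue
measure. -/
theorem ae_riemannianVolume_of_chart [Nonempty M] {P : M → Prop} (hP : MeasurableSet {x | P x})
    (h : ∀ c : M, ∀ᵐ z ∂(volume.restrict (extChartAt (𝓡 n) c).target),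
      P ((extChartAt (𝓡 n) c).symm z)) :
    ∀ᵐ x ∂(riemannianVolume n M), P x := by
  obtain ⟨d, hd⟩ := exists_chart_sequence (n := n) (M := M)
  have h2 : ∀ k, ∀ᵐ x ∂(riemannianVolume n M),
      x ∈ (chartAt (EuclideanSpace ℝ (Fin n)) (d k)).source → P x := by
    intro k
    rw [← ae_restrict_iff' (chartAt (EuclideanSpace ℝ (Fin n)) (d k)).open_source.measurableSet,
      ← extChartAt_source (𝓡 n), riemannianVolume_restrict, chartVolume,
      ae_map_iff (aemeasurable_chart_symm _) hP]
    exact (withDensity_absolutelyContinuous _ _).ae_le (h (d k))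
  filter_upwards [ae_all_iff.2 h2] with x hx
  obtain ⟨k, hk⟩ := mem_iUnion.1 (hd ▸ mem_univ x)
  exact hx k hk

/-- The continuous density is bounded on a small coordinate ball, so the measure is locally finite,
and M is compact. -/
instance isFiniteMeasure_riemannianVolume : IsFiniteMeasure (riemannianVolume n M) := by
  rcases isEmpty_or_nonempty M with hM | hM
  · exact ⟨by rw [univ_eq_empty_iff.2 hM]; simp⟩
  suffices IsLocallyFiniteMeasure (riemannianVolume n M) from inferInstance
  refine ⟨fun x => ?_⟩
  have ht := isOpen_extChartAt_target (I := 𝓡 n) x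
  have hx := mem_extChartAt_target (I := 𝓡 n) x
  have hcont : ContinuousAt (fun z => volDensity x z) (extChartAt (𝓡 n) x x) :=
    (volDensity_contDiffOn x).continuousOn.continuousAt (ht.mem_nhds hx)
  have h1 : ∀ᶠ z in nhds (extChartAt (𝓡 n) x x),
      volDensity x z < volDensity x (extChartAt (𝓡 n) x x) + 1 ∧ z ∈ (extChartAt (𝓡 n) x).target :=
    (hcont.eventually (gt_mem_nhds (by linarith))).and (ht.mem_nhds hx)
  obtain ⟨r, hr, hball⟩ := Metric.eventually_nhds_iff_ball.1 h1
  have hpre := (continuousAt_extChartAt (I := 𝓡 n) x).preimage_mem_nhds (Metric.ball_mem_nhds _ hr)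
  have hN : IsOpen ((extChartAt (𝓡 n) x).source ∩
      extChartAt (𝓡 n) x ⁻¹' Metric.ball (extChartAt (𝓡 n) x x) r) :=
    (continuousOn_extChartAt x).isOpen_inter_preimage (isOpen_extChartAt_source x) Metric.isOpen_ball
  refine ⟨_, Filter.inter_mem (extChartAt_source_mem_nhds (I := 𝓡 n) x) hpre, ?_⟩
  rw [riemannianVolume_apply x hN.measurableSet inter_subset_left, chartVolume_apply x hN.measurableSet]
  set S := (extChartAt (𝓡 n) x).symm ⁻¹' ((extChartAt (𝓡 n) x).source ∩
      extChartAt (𝓡 n) x ⁻¹' Metric.ball (extChartAt (𝓡 n) x x) r) ∩ (extChartAt (𝓡 n) x).target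
  have hS : S ⊆ Metric.ball (extChartAt (𝓡 n) x x) r := by
    rintro z ⟨hz, hz'⟩
    have := hz.2
    rwa [mem_preimage, (extChartAt (𝓡 n) x).right_inv hz'] at this
  calc ∫⁻ z in S, ENNReal.ofReal (volDensity x z)
      ≤ ∫⁻ z in S, ENNReal.ofReal (volDensity x (extChartAt (𝓡 n) x x) + 1) := by
        refine setLIntegral_mono measurable_const fun z hz => ENNReal.ofReal_le_ofReal ?_
        exact (hball z (hS hz)).1.le
    _ = ENNReal.ofReal (volDensity x (extChartAt (𝓡 n) x x) + 1) * volume S := by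
        rw [lintegral_const, Measure.restrict_apply_univ]
    _ < ⊤ := ENNReal.mul_lt_top ENNReal.ofReal_lt_top
        ((measure_mono hS).trans_lt measure_ball_lt_top)

/-- The density is strictly positive, so a null open set would have a Lebesgue null, nonempty open
image in a chart. This is what later upgrades almost everywhere equalities of continuous functions
to everywhere. -/
instance isOpenPosMeasure_riemannianVolume : (riemannianVolume n M).IsOpenPosMeasure := by
  refine ⟨fun U hU hne h0 => ?_⟩
  obtain ⟨x, hx⟩ := hne
  have : Nonempty M := ⟨x⟩
  have hV : IsOpen (U ∩ (extChartAt (𝓡 n) x).source) := hU.inter (isOpen_extChartAt_source x)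
  have h1 : riemannianVolume n M (U ∩ (extChartAt (𝓡 n) x).source) = 0 :=
    measure_mono_null inter_subset_left h0
  rw [riemannianVolume_apply x hV.measurableSet inter_subset_right,
    chartVolume_apply x hV.measurableSet] at h1
  set S := (extChartAt (𝓡 n) x).symm ⁻¹' (U ∩ (extChartAt (𝓡 n) x).source) ∩
    (extChartAt (𝓡 n) x).target with hSdef
  have hSo : IsOpen S := by
    rw [hSdef, inter_comm]
    exact (continuousOn_extChartAt_symm x).isOpen_inter_preimage (isOpen_extChartAt_target x) hV
  have hSx : extChartAt (𝓡 n) x x ∈ S := by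
    refine ⟨?_, mem_extChartAt_target x⟩
    rw [mem_preimage, extChartAt_to_inv]
    exact ⟨hx, mem_extChartAt_source x⟩
  have hae := (lintegral_eq_zero_iff' ((aemeasurable_volDensity x).ennreal_ofReal.mono_measure
    (Measure.restrict_mono inter_subset_right le_rfl))).1 h1
  have hS0 : volume S = 0 := by
    have h2 : ∀ᵐ z ∂(volume.restrict S), False := by
      filter_upwards [hae, ae_restrict_mem hSo.measurableSet] with z hz hzS
      have := volDensity_pos hzS.2
      simp only [Pi.zero_apply, ENNReal.ofReal_eq_zero] at hz
      linarith
    rw [Filter.eventually_false_iff_eq_bot, ae_eq_bot, Measure.restrict_eq_zero] at h2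
    exact h2
  exact (hSo.measure_pos volume ⟨_, hSx⟩).ne' hS0

end Smooth

end Volume

end PFreq

namespace PFreq

/-! ### Integration by parts on open subsets of ℝⁿ. -/

section EuclideanParts

variable {n : ℕ}

theorem integrable_of_continuousOn_of_compact {T K : Set (EuclideanSpace ℝ (Fin n))}
    (hK : IsCompact K) (hKT : K ⊆ T) {h : EuclideanSpace ℝ (Fin n) → ℝ} (hc : ContinuousOn h T)
    (h0 : ∀ z ∉ K, h z = 0) : Integrable h := by
  rw [← integrableOn_iff_integrable_of_support_subset (s := K)
    (fun z hz => by_contra fun hzK => hz (h0 z hzK))]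
  exact (hc.mono hKT).integrableOn_compact hK

/-- Integration by parts on an open subset of `ℝⁿ` against a function with compact support. -/
theorem setIntegral_mul_partialDeriv {T K : Set (EuclideanSpace ℝ (Fin n))} (hT : IsOpen T)
    (hK : IsCompact K) (hKT : K ⊆ T) {w G : EuclideanSpace ℝ (Fin n) → ℝ}
    (hw : ContDiffOn ℝ 1 w T) (hG : ContDiffOn ℝ 1 G T) (h0 : ∀ z ∈ T \ K, w z = 0) (i : Fin n) :
    IntegrableOn (fun z => w z * partialDeriv i G z) T ∧
    IntegrableOn (fun z => partialDeriv i w z * G z) T ∧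
    ∫ z in T, w z * partialDeriv i G z = -∫ z in T, partialDeriv i w z * G z := by
  classical
  -- Extension by zero is differentiable on all of ℝⁿ because w vanishes on T outside the compact
  -- set K. The values of G outside T never matter: every product below vanishes there.
  set W : EuclideanSpace ℝ (Fin n) → ℝ := T.indicator w with hWdef
  have hWT : ∀ z ∈ T, W z = w z := fun z hz => indicator_of_mem hz w
  have hW0 : ∀ z ∉ K, W z = 0 := by
    intro z hz
    by_cases hzT : z ∈ T
    · rw [hWT z hzT, h0 z ⟨hzT, hz⟩]
    · exact indicator_of_notMem hzT w
  have hWev : ∀ z ∈ T, W =ᶠ[nhds z] w := fun z hz => by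
    filter_upwards [hT.mem_nhds hz] with y hy using hWT y hy
  have hWev0 : ∀ z ∉ K, W =ᶠ[nhds z] fun _ => 0 := fun z hz => by
    filter_upwards [hK.isClosed.isOpen_compl.mem_nhds hz] with y hy using hW0 y hy
  have hdW : ∀ z ∈ T, partialDeriv i W z = partialDeriv i w z := fun z hz => by
    rw [partialDeriv, partialDeriv, (hWev z hz).fderiv_eq]
  have hdW0 : ∀ z ∉ K, partialDeriv i W z = 0 := fun z hz => by
    rw [partialDeriv, (hWev0 z hz).fderiv_eq]
    simp
  have hWd : Differentiable ℝ W := by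
    intro z
    by_cases hz : z ∈ K
    · exact ((hw.differentiableOn one_ne_zero).differentiableAt
        (hT.mem_nhds (hKT hz))).congr_of_eventuallyEq (hWev z (hKT hz))
    · exact (differentiableAt_const 0).congr_of_eventuallyEq (hWev0 z hz)
  have hsub : tsupport W ⊆ K :=
    closure_minimal (fun z hz => by_contra fun hzK => hz (hW0 z hzK)) hK.isClosed
  have hcw := (hw.continuousOn_fderiv_of_isOpen hT le_rfl).clm_apply
    (continuousOn_const (c := EuclideanSpace.single i (1 : ℝ)))
  have hcG := (hG.continuousOn_fderiv_of_isOpen hT le_rfl).clm_apply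
    (continuousOn_const (c := EuclideanSpace.single i (1 : ℝ)))
  have hcW : ContinuousOn W T := hw.continuousOn.congr hWT
  have i1 : Integrable (fun z => partialDeriv i W z * G z) :=
    integrable_of_continuousOn_of_compact hK hKT
      ((hcw.mul hG.continuousOn).congr fun z hz => by
        simp only [Pi.mul_apply, hdW z hz]; rfl)
      (fun z hz => by rw [hdW0 z hz, zero_mul])
  have i2 : Integrable (fun z => W z * partialDeriv i G z) :=
    integrable_of_continuousOn_of_compact hK hKT (hcW.mul hcG)
      (fun z hz => by rw [hW0 z hz, zero_mul])
  have i3 : Integrable (fun z => W z * G z) :=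
    integrable_of_continuousOn_of_compact hK hKT (hcW.mul hG.continuousOn)
      (fun z hz => by rw [hW0 z hz, zero_mul])
  have hmain := integral_mul_fderiv_eq_neg_fderiv_mul_of_integrable (v := EuclideanSpace.single i (1 : ℝ))
    i1 i2 i3 (fun z _ => hWd z) (fun z hz => (hG.differentiableOn one_ne_zero).differentiableAt
        (hT.mem_nhds (hKT (hsub hz))))
  have e1 : EqOn (fun z => W z * partialDeriv i G z) (fun z => w z * partialDeriv i G z) T :=
    fun z hz => by simp only [hWT z hz]
  have e2 : EqOn (fun z => partialDeriv i W z * G z) (fun z => partialDeriv i w z * G z) T :=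
    fun z hz => by simp only [hdW z hz]
  refine ⟨i2.integrableOn.congr_fun e1 hT.measurableSet,
    i1.integrableOn.congr_fun e2 hT.measurableSet, ?_⟩
  rw [← setIntegral_congr_fun hT.measurableSet e1, ← setIntegral_congr_fun hT.measurableSet e2,
    setIntegral_eq_integral_of_forall_compl_eq_zero, setIntegral_eq_integral_of_forall_compl_eq_zero]
  · exact hmain
  · intro z hz
    rw [hdW0 z fun h => hz (hKT h), zero_mul]
  · intro z hz
    rw [hW0 z fun h => hz (hKT h), zero_mul]

end EuclideanParts

/-! ### The divergence theorem on a closed manifold. -/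

section Divergence

variable {n : ℕ} {M : Type*} [TopologicalSpace M] [ChartedSpace (EuclideanSpace ℝ (Fin n)) M]

/-- The derivative of a function in the direction of a vector field. -/
noncomputable def dirDeriv (w : M → ℝ) (X : (x : M) → TangentSpace (𝓡 n) x) (x : M) : ℝ :=
  mfderiv (𝓡 n) 𝓘(ℝ, ℝ) w x (X x)

/-- A vector field is of class `C¹` if its components in all charts are. -/
def IsC1Field (X : (x : M) → TangentSpace (𝓡 n) x) : Prop :=
  ∀ (c : M) (i : Fin n), ContDiffOn ℝ 1 (coordComp X c i) (extChartAt (𝓡 n) c).target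

variable [IsManifold (𝓡 n) ∞ M]

theorem contDiffOn_comp_chart_symm {k : WithTop ℕ∞} (hk : k ≤ ∞) {w : M → ℝ}
    (hw : ContMDiff (𝓡 n) 𝓘(ℝ, ℝ) k w) (c : M) :
    ContDiffOn ℝ k (w ∘ (extChartAt (𝓡 n) c).symm) (extChartAt (𝓡 n) c).target := by
  rw [← contMDiffOn_iff_contDiffOn]
  exact hw.comp_contMDiffOn ((contMDiffOn_extChartAt_symm (n := ∞) c).of_le hk)

variable [RiemannianBundle (fun x : M => TangentSpace (𝓡 n) x)]

/-- The divergence of a vector field computed in the chart at `c`. -/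
noncomputable def chartDiv (X : (x : M) → TangentSpace (𝓡 n) x) (c : M)
    (z : EuclideanSpace ℝ (Fin n)) : ℝ :=
  (volDensity c z)⁻¹ * ∑ i : Fin n, partialDeriv i (fun z => volDensity c z * coordComp X c i z) z

theorem dirDeriv_chart_symm {w : M → ℝ} (hw : ContMDiff (𝓡 n) 𝓘(ℝ, ℝ) 1 w)
    (X : (x : M) → TangentSpace (𝓡 n) x) {c : M} {z : EuclideanSpace ℝ (Fin n)}
    (hz : z ∈ (extChartAt (𝓡 n) c).target) :
    dirDeriv w X ((extChartAt (𝓡 n) c).symm z) =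
      ∑ i, coordComp X c i z * partialDeriv i (w ∘ (extChartAt (𝓡 n) c).symm) z :=
  mfderiv_eq_sum_partialDeriv hz (hw.mdifferentiable one_ne_zero _) X

theorem continuousOn_source_of_chart {c : M} {h : M → ℝ}
    (hc : ContinuousOn (fun z => h ((extChartAt (𝓡 n) c).symm z)) (extChartAt (𝓡 n) c).target) :
    ContinuousOn h (extChartAt (𝓡 n) c).source := by
  refine (hc.comp (continuousOn_extChartAt c) (extChartAt (𝓡 n) c).mapsTo).congr fun x hx => ?_
  simp only [Function.comp, (extChartAt (𝓡 n) c).left_inv hx]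

theorem continuous_of_chart {h : M → ℝ}
    (hc : ∀ c : M, ContinuousOn (fun z => h ((extChartAt (𝓡 n) c).symm z))
      (extChartAt (𝓡 n) c).target) : Continuous h :=
  continuous_iff_continuousAt.2 fun x =>
    (continuousOn_source_of_chart (hc x)).continuousAt (extChartAt_source_mem_nhds x)

theorem continuousOn_partialDeriv {T : Set (EuclideanSpace ℝ (Fin n))} (hT : IsOpen T)
    {G : EuclideanSpace ℝ (Fin n) → ℝ} (hG : ContDiffOn ℝ 1 G T) (i : Fin n) :
    ContinuousOn (partialDeriv i G) T :=
  (hG.continuousOn_fderiv_of_isOpen hT le_rfl).clm_apply continuousOn_const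

theorem continuous_dirDeriv {w : M → ℝ} (hw : ContMDiff (𝓡 n) 𝓘(ℝ, ℝ) 1 w)
    {X : (x : M) → TangentSpace (𝓡 n) x} (hX : IsC1Field X) : Continuous (dirDeriv w X) := by
  refine continuous_of_chart (n := n) fun c => ?_
  refine ContinuousOn.congr ?_ fun z hz => dirDeriv_chart_symm hw X hz
  exact continuousOn_finsetSum _ fun i _ => (hX c i).continuousOn.mul
    (continuousOn_partialDeriv (isOpen_extChartAt_target c)
      (contDiffOn_comp_chart_symm (by simp) hw c) i)

variable [IsContMDiffRiemannianBundle (𝓡 n) ∞ (EuclideanSpace ℝ (Fin n))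
      (fun x : M => TangentSpace (𝓡 n) x)]

theorem contDiffOn_volDensity_mul {X : (x : M) → TangentSpace (𝓡 n) x} (hX : IsC1Field X) (c : M)
    (i : Fin n) : ContDiffOn ℝ 1 (fun z => volDensity c z * coordComp X c i z)
      (extChartAt (𝓡 n) c).target :=
  ((volDensity_contDiffOn c).of_le (by simp)).mul (hX c i)

theorem continuousOn_chartDiv {X : (x : M) → TangentSpace (𝓡 n) x} (hX : IsC1Field X) (c : M) :
    ContinuousOn (chartDiv X c) (extChartAt (𝓡 n) c).target :=
  ((volDensity_contDiffOn c).continuousOn.inv₀ fun _ hz => (volDensity_pos hz).ne').mul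
    (continuousOn_finsetSum _ fun i _ =>
      continuousOn_partialDeriv (isOpen_extChartAt_target c) (contDiffOn_volDensity_mul hX c i) i)

theorem continuousOn_chartDiv_comp {X : (x : M) → TangentSpace (𝓡 n) x} (hX : IsC1Field X) (c : M) :
    ContinuousOn (fun x => chartDiv X c (extChartAt (𝓡 n) c x)) (extChartAt (𝓡 n) c).source :=
  (continuousOn_chartDiv hX c).comp (continuousOn_extChartAt c) (extChartAt (𝓡 n) c).mapsTo

variable [MeasurableSpace M] [BorelSpace M] [CompactSpace M] [T2Space M]

/-- The divergence theorem for functions supported in the domain of a chart. -/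
theorem integral_dirDeriv_of_tsupport_subset {X : (x : M) → TangentSpace (𝓡 n) x}
    (hX : IsC1Field X) (c : M) {w : M → ℝ} (hw : ContMDiff (𝓡 n) 𝓘(ℝ, ℝ) 1 w)
    (hsupp : tsupport w ⊆ (extChartAt (𝓡 n) c).source) :
    ∫ x, dirDeriv w X x ∂(riemannianVolume n M) =
      -∫ x, w x * chartDiv X c (extChartAt (𝓡 n) c x) ∂(riemannianVolume n M) := by
  have : Nonempty M := ⟨c⟩
  have hT := isOpen_extChartAt_target (I := 𝓡 n) c
  have hw0 : ∀ x ∉ (extChartAt (𝓡 n) c).source, w x = 0 := fun x hx =>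
    image_eq_zero_of_notMem_tsupport fun h => hx (hsupp h)
  have hd0 : ∀ x ∉ (extChartAt (𝓡 n) c).source, dirDeriv w X x = 0 := by
    intro x hx
    have h1 : w =ᶠ[nhds x] fun _ => (0 : ℝ) :=
      notMem_tsupport_iff_eventuallyEq.1 fun h => hx (hsupp h)
    rw [dirDeriv, h1.mfderiv_eq, mfderiv_const]
    rfl
  have hd1 : ∀ x ∉ (extChartAt (𝓡 n) c).source,
      w x * chartDiv X c (extChartAt (𝓡 n) c x) = 0 := fun x hx => by rw [hw0 x hx, zero_mul]
  rw [← setIntegral_eq_integral_of_forall_compl_eq_zero hd0,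
    ← setIntegral_eq_integral_of_forall_compl_eq_zero hd1,
    setIntegral_chart c (continuous_dirDeriv hw hX).aestronglyMeasurable,
    setIntegral_chart (h := fun x => w x * chartDiv X c (extChartAt (𝓡 n) c x)) c
      ((hw.continuous.continuousOn.mul (continuousOn_chartDiv_comp hX c)).aestronglyMeasurable
      (isOpen_extChartAt_source c).measurableSet)]
  set K := extChartAt (𝓡 n) c '' tsupport w with hKdef
  have hK : IsCompact K :=
    (isClosed_tsupport w).isCompact.image_of_continuousOn ((continuousOn_extChartAt c).mono hsupp)
  have hKT : K ⊆ (extChartAt (𝓡 n) c).target := by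
    rintro _ ⟨x, hx, rfl⟩
    exact (extChartAt (𝓡 n) c).map_source (hsupp hx)
  have h0 : ∀ z ∈ (extChartAt (𝓡 n) c).target \ K, (w ∘ (extChartAt (𝓡 n) c).symm) z = 0 := by
    rintro z ⟨hz, hzK⟩
    refine image_eq_zero_of_notMem_tsupport (f := w) fun h => hzK ?_
    exact ⟨_, h, (extChartAt (𝓡 n) c).right_inv hz⟩
  have parts := fun i => setIntegral_mul_partialDeriv hT hK hKT
    (contDiffOn_comp_chart_symm (by simp) hw c) (contDiffOn_volDensity_mul hX c i) h0 i
  calc ∫ z in (extChartAt (𝓡 n) c).target,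
        volDensity c z * dirDeriv w X ((extChartAt (𝓡 n) c).symm z)
      = ∫ z in (extChartAt (𝓡 n) c).target, ∑ i, partialDeriv i (w ∘ (extChartAt (𝓡 n) c).symm) z *
          (volDensity c z * coordComp X c i z) := by
        refine setIntegral_congr_fun hT.measurableSet fun z hz => ?_
        rw [dirDeriv_chart_symm hw X hz, Finset.mul_sum]
        exact Finset.sum_congr rfl fun i _ => by ring
    _ = ∑ i, ∫ z in (extChartAt (𝓡 n) c).target,
          partialDeriv i (w ∘ (extChartAt (𝓡 n) c).symm) z *
          (volDensity c z * coordComp X c i z) := integral_finsetSum _ fun i _ => (parts i).2.1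
    _ = ∑ i, -∫ z in (extChartAt (𝓡 n) c).target, (w ∘ (extChartAt (𝓡 n) c).symm) z *
          partialDeriv i (fun z => volDensity c z * coordComp X c i z) z :=
        Finset.sum_congr rfl fun i _ => by rw [(parts i).2.2, neg_neg]
    _ = -∫ z in (extChartAt (𝓡 n) c).target, ∑ i, (w ∘ (extChartAt (𝓡 n) c).symm) z *
          partialDeriv i (fun z => volDensity c z * coordComp X c i z) z := by
        rw [Finset.sum_neg_distrib, integral_finsetSum _ fun i _ => (parts i).1]
    _ = _ := by
        congr 1
        refine setIntegral_congr_fun hT.measurableSet fun z hz => ?_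
        have := (volDensity_pos hz).ne'
        simp only [(extChartAt (𝓡 n) c).right_inv hz, chartDiv, Function.comp_apply,
          ← Finset.mul_sum]
        field_simp

/-- The divergence computed in a chart does not depend on the chart. -/
theorem chartDiv_eq {X : (x : M) → TangentSpace (𝓡 n) x} (hX : IsC1Field X) (c c' : M) {x : M}
    (hx : x ∈ (extChartAt (𝓡 n) c).source) (hx' : x ∈ (extChartAt (𝓡 n) c').source) :
    chartDiv X c (extChartAt (𝓡 n) c x) = chartDiv X c' (extChartAt (𝓡 n) c' x) := by
  set U := (extChartAt (𝓡 n) c).source ∩ (extChartAt (𝓡 n) c').source with hU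
  have hUo : IsOpen U := (isOpen_extChartAt_source c).inter (isOpen_extChartAt_source c')
  have hc := (continuousOn_chartDiv_comp hX c).mono (inter_subset_left : U ⊆ _)
  have hc' := (continuousOn_chartDiv_comp hX c').mono (inter_subset_right : U ⊆ _)
  have hloc : ∀ d : M → ℝ, ContinuousOn d U → ∀ g : M → ℝ, Continuous g → tsupport g ⊆ U →
      Integrable (fun y => g y * d y) (riemannianVolume n M) := by
    intro d hd g hg hgU
    rw [← integrableOn_iff_integrable_of_support_subset (s := tsupport g)]
    · exact ((hg.continuousOn.mul hd).mono hgU).integrableOn_compact (isClosed_tsupport g).isCompact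
    · intro y hy
      by_contra h
      exact hy (by simp only [image_eq_zero_of_notMem_tsupport h, zero_mul])
  have := ChartedSpace.locallyCompactSpace (EuclideanSpace ℝ (Fin n)) M
  -- Instead of transforming the coordinate expression, the argument is weak: tested against any
  -- smooth g supported in the overlap, both chart divergences give -∫ dg(X). Hence they agree
  -- almost everywhere, and by continuity everywhere.
  have hae := hUo.ae_eq_zero_of_integral_contMDiff_smul_eq_zero (𝓡 n) (μ := riemannianVolume n M)
    (f := fun y => chartDiv X c (extChartAt (𝓡 n) c y) - chartDiv X c' (extChartAt (𝓡 n) c' y))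
    ((hc.sub hc').locallyIntegrableOn hUo.measurableSet) (by
      intro g hg _ hgU
      have hg1 : ContMDiff (𝓡 n) 𝓘(ℝ, ℝ) 1 g := hg.of_le (by simp)
      have e1 := integral_dirDeriv_of_tsupport_subset hX c hg1 (hgU.trans inter_subset_left)
      have e2 := integral_dirDeriv_of_tsupport_subset hX c' hg1 (hgU.trans inter_subset_right)
      simp only [smul_eq_mul, mul_sub]
      rw [integral_sub (hloc _ hc g hg.continuous hgU) (hloc _ hc' g hg.continuous hgU)]
      linarith)
  have h2 : (fun y => chartDiv X c (extChartAt (𝓡 n) c y)) =ᵐ[(riemannianVolume n M).restrict U]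
      fun y => chartDiv X c' (extChartAt (𝓡 n) c' y) := by
    rw [Filter.EventuallyEq, ae_restrict_iff' hUo.measurableSet]
    filter_upwards [hae] with y hy hyU
    linarith [hy hyU]
  exact Measure.eqOn_open_of_ae_eq h2 hUo hc hc' ⟨hx, hx'⟩

/-- By definition the divergence changes its chart with the point. Fixing one chart on a whole
neighbourhood makes continuity and integration accessible. -/
theorem divergence_eq_chartDiv {X : (x : M) → TangentSpace (𝓡 n) x} (hX : IsC1Field X) (c : M) {x : M}
    (hx : x ∈ (extChartAt (𝓡 n) c).source) :
    divergence X x = chartDiv X c (extChartAt (𝓡 n) c x) :=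
  chartDiv_eq hX x c (mem_extChartAt_source x) hx

theorem continuous_divergence {X : (x : M) → TangentSpace (𝓡 n) x} (hX : IsC1Field X) :
    Continuous (divergence X) :=
  continuous_iff_continuousAt.2 fun x => ((continuousOn_chartDiv_comp hX x).congr
    fun _ hy => divergence_eq_chartDiv hX x hy).continuousAt (extChartAt_source_mem_nhds x)

theorem dirDeriv_sum {ι : Type*} (s : Finset ι) {w : ι → M → ℝ}
    (hw : ∀ i ∈ s, ContMDiff (𝓡 n) 𝓘(ℝ, ℝ) 1 (w i)) (X : (x : M) → TangentSpace (𝓡 n) x) (x : M) :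
    dirDeriv (fun y => ∑ i ∈ s, w i y) X x = ∑ i ∈ s, dirDeriv (w i) X x := by
  have hz := mem_extChartAt_target (I := 𝓡 n) x
  have hsum : ContMDiff (𝓡 n) 𝓘(ℝ, ℝ) 1 (fun y => ∑ i ∈ s, w i y) := contMDiff_finsetSum hw
  have key := fun v (hv : ContMDiff (𝓡 n) 𝓘(ℝ, ℝ) 1 v) => dirDeriv_chart_symm hv X hz
  simp only [extChartAt_to_inv] at key
  rw [key _ hsum, Finset.sum_congr rfl fun i hi => key _ (hw i hi), Finset.sum_comm]
  refine Finset.sum_congr rfl fun j _ => ?_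
  rw [← Finset.mul_sum]
  congr 1
  have hd : ∀ i ∈ s, DifferentiableAt ℝ (w i ∘ (extChartAt (𝓡 n) x).symm) (extChartAt (𝓡 n) x x) :=
    fun i hi => ((contDiffOn_comp_chart_symm (by simp) (hw i hi) x).differentiableOn
      one_ne_zero).differentiableAt ((isOpen_extChartAt_target x).mem_nhds hz)
  have h2 : ((fun y => ∑ i ∈ s, w i y) ∘ (extChartAt (𝓡 n) x).symm) =
      fun z => ∑ i ∈ s, (w i ∘ (extChartAt (𝓡 n) x).symm) z := rfl
  rw [partialDeriv, h2, fderiv_fun_sum hd, _root_.sum_apply]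
  rfl

/-- The divergence theorem on a closed Riemannian manifold. -/
theorem integral_dirDeriv {X : (x : M) → TangentSpace (𝓡 n) x} (hX : IsC1Field X)
    {w : M → ℝ} (hw : ContMDiff (𝓡 n) 𝓘(ℝ, ℝ) 1 w) :
    ∫ x, dirDeriv w X x ∂(riemannianVolume n M) =
      -∫ x, w x * divergence X x ∂(riemannianVolume n M) := by
  -- The function w is split into pieces supported in charts; by compactness only finitely many are
  -- nonzero.
  obtain ⟨ρ, hρ⟩ := SmoothPartitionOfUnity.exists_isSubordinate_chartAt_source (𝓡 n) M
  have hfin := ρ.locallyFinite.finite_nonempty_of_compact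
  set s := hfin.toFinset with hs
  have hsum : ∀ x, ∑ i ∈ s, ρ i x = 1 := by
    intro x
    rw [← ρ.sum_eq_one (mem_univ x), finsum_eq_sum_of_support_subset]
    intro i hi
    rw [Finset.mem_coe, hs, Finite.mem_toFinset]
    exact ⟨x, hi⟩
  have hρw : ∀ i, ContMDiff (𝓡 n) 𝓘(ℝ, ℝ) 1 (fun x => ρ i x * w x) := fun i =>
    ((ρ i).contMDiff.of_le (by simp)).mul hw
  have hsub : ∀ i, tsupport (fun x => ρ i x * w x) ⊆ (extChartAt (𝓡 n) i).source := fun i => by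
    rw [extChartAt_source]
    exact (tsupport_mul_subset_left).trans (hρ i)
  have hw_eq : w = fun x => ∑ i ∈ s, ρ i x * w x := by
    ext x
    rw [← Finset.sum_mul, hsum, one_mul]
  have e1 : ∀ i, ∫ x, dirDeriv (fun x => ρ i x * w x) X x ∂(riemannianVolume n M) =
      -∫ x, ρ i x * w x * divergence X x ∂(riemannianVolume n M) := by
    intro i
    rw [integral_dirDeriv_of_tsupport_subset hX i (hρw i) (hsub i)]
    congr 1
    refine integral_congr_ae (ae_of_all _ fun x => ?_)
    by_cases hx : x ∈ (extChartAt (𝓡 n) i).source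
    · simp only [divergence_eq_chartDiv hX i hx]
    · have h0 : ρ i x * w x = 0 := image_eq_zero_of_notMem_tsupport
        (f := fun x => ρ i x * w x) fun h => hx (hsub i h)
      simp only [h0, zero_mul]
  have int1 : ∀ i, Integrable (dirDeriv (fun x => ρ i x * w x) X) (riemannianVolume n M) := fun i =>
    (continuous_dirDeriv (hρw i) hX).integrable_of_hasCompactSupport
      (HasCompactSupport.of_compactSpace _)
  have int2 : ∀ i, Integrable (fun x => ρ i x * w x * divergence X x) (riemannianVolume n M) :=
    fun i => ((hρw i).continuous.mul (continuous_divergence hX)).integrable_of_hasCompactSupport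
      (HasCompactSupport.of_compactSpace _)
  calc ∫ x, dirDeriv w X x ∂(riemannianVolume n M)
      = ∫ x, ∑ i ∈ s, dirDeriv (fun x => ρ i x * w x) X x ∂(riemannianVolume n M) := by
        refine integral_congr_ae (ae_of_all _ fun x => ?_)
        simp only
        conv_lhs => rw [hw_eq]
        exact dirDeriv_sum s (fun i _ => hρw i) X x
    _ = -∑ i ∈ s, ∫ x, ρ i x * w x * divergence X x ∂(riemannianVolume n M) := by
        rw [integral_finsetSum _ fun i _ => int1 i, ← Finset.sum_neg_distrib]
        exact Finset.sum_congr rfl fun i _ => e1 i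
    _ = -∫ x, w x * divergence X x ∂(riemannianVolume n M) := by
        rw [← integral_finsetSum _ fun i _ => int2 i]
        congr 1
        refine integral_congr_ae (ae_of_all _ fun x => ?_)
        simp only
        rw [← Finset.sum_mul, ← Finset.sum_mul, hsum, one_mul]

end Divergence

end PFreq

namespace PFreq

/-! ### Derivatives on the zero set of a function. -/

section ZeroSet

variable {n : ℕ}

/-- The derivative of a function vanishes at almost every zero of the function. -/
theorem ae_fderiv_eq_zero_of_eq_zero {T : Set (EuclideanSpace ℝ (Fin n))} (hT : IsOpen T)
    {g : EuclideanSpace ℝ (Fin n) → ℝ} (hg : DifferentiableOn ℝ g T) :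
    ∀ᵐ z ∂(volume.restrict T), g z = 0 → fderiv ℝ g z = 0 := by
  rcases subsingleton_or_nontrivial (EuclideanSpace ℝ (Fin n)) with hE | hE
  · refine ae_of_all _ fun z _ => ?_
    ext v
    rw [Subsingleton.elim v 0]
    simp
  -- The estimate `ApproximatesLinearOn.norm_fderiv_sub_le` concerns maps of a space into itself, so
  -- g is replaced by g·v. On the zero set of g this map is approximated by the zero map with
  -- constant 0, which forces its derivative to vanish at almost every point of the set.
  obtain ⟨v, hv⟩ := exists_ne (0 : EuclideanSpace ℝ (Fin n))
  set s := {z | z ∈ T ∧ g z = 0} with hs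
  have hsm : MeasurableSet s := by
    have h1 : Measurable (T.domRestrict g) :=
      (continuousOn_iff_continuous_domRestrict.1 hg.continuousOn).measurable
    have h2 := MeasurableSet.subtype_image hT.measurableSet (h1 (measurableSet_singleton (0 : ℝ)))
    convert h2 using 1
    ext z
    simp only [hs, mem_ofPred_eq, mem_image, Subtype.exists, mem_preimage, domRestrict_apply,
      mem_singleton_iff, exists_and_right, exists_eq_right]
    exact ⟨fun h => ⟨h.1, h.2⟩, fun ⟨h, h'⟩ => ⟨h, h'⟩⟩
  have hlin : ApproximatesLinearOn (fun z => g z • v)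
      (0 : EuclideanSpace ℝ (Fin n) →L[ℝ] EuclideanSpace ℝ (Fin n)) s 0 := by
    intro x hx y hy
    simp [hx.2, hy.2]
  have h := hlin.norm_fderiv_sub_le volume hsm (fun z => (fderiv ℝ g z).smulRight v) (fun z hz =>
    ((hg.differentiableAt (hT.mem_nhds hz.1)).hasFDerivAt.smul_const v).hasFDerivWithinAt)
  rw [ae_restrict_iff' hsm] at h
  rw [ae_restrict_iff' hT.measurableSet]
  filter_upwards [h] with z hz hzT h0
  have h1 := hz ⟨hzT, h0⟩
  rw [sub_zero, nonpos_iff_eq_zero, nnnorm_eq_zero] at h1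
  ext w
  have h2 := congrArg (fun A : EuclideanSpace ℝ (Fin n) →L[ℝ] EuclideanSpace ℝ (Fin n) => A w) h1
  simp only [ContinuousLinearMap.smulRight_apply, zero_apply, smul_eq_zero] at h2
  exact h2.resolve_right hv

end ZeroSet

/-! ### Regularity of N^r Y at the zeros of N. -/

section PowerRegularity

variable {E : Type*} [NormedAddCommGroup E] [NormedSpace ℝ E]

/-- If `N² = ∑ₐ Yₐ yₐ` with `C¹` functions bounded by multiples of `N`, then `N^r Yₐ` is `C¹` for
`r > 0`. -/
theorem contDiffOn_rpow_mul {T : Set E} (hT : IsOpen T) {ι : Type*} [Fintype ι] {Y y : ι → E → ℝ}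
    (hY : ∀ a, ContDiffOn ℝ 1 (Y a) T) (hy : ∀ a, ContDiffOn ℝ 1 (y a) T) {K N : E → ℝ}
    (hK : ContinuousOn K T) (hN0 : ∀ z, 0 ≤ N z) (hN : ∀ z ∈ T, N z ^ 2 = ∑ a, Y a z * y a z)
    (hYK : ∀ z ∈ T, ∀ a, |Y a z| ≤ K z * N z) (hyK : ∀ z ∈ T, ∀ a, |y a z| ≤ K z * N z)
    {r : ℝ} (hr : 0 < r) (a : ι) : ContDiffOn ℝ 1 (fun z => N z ^ r * Y a z) T := by
  set S : E → ℝ := fun z => ∑ a, Y a z * y a z with hS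
  have hSd : ContDiffOn ℝ 1 S T := ContDiffOn.sum fun a _ => (hY a).mul (hy a)
  have hNS : ∀ z ∈ T, N z = Real.sqrt (S z) := fun z hz => by
    rw [show S z = N z ^ 2 from (hN z hz).symm, Real.sqrt_sq (hN0 z)]
  have hNr : ∀ z ∈ T, ∀ q : ℝ, N z ^ q = S z ^ (q / 2) := fun z hz q => by
    have h0 : 0 ≤ S z := (sq_nonneg (N z)).trans_eq (hN z hz)
    rw [hNS z hz, Real.sqrt_eq_rpow, ← Real.rpow_mul h0]
    congr 1
    ring
  have hNc : ContinuousOn N T := (hSd.continuousOn.sqrt).congr hNS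
  have dY : ∀ b, ∀ z ∈ T, HasFDerivAt (Y b) (fderiv ℝ (Y b) z) z := fun b z hz =>
    (((hY b).differentiableOn one_ne_zero).differentiableAt (hT.mem_nhds hz)).hasFDerivAt
  have dy : ∀ b, ∀ z ∈ T, HasFDerivAt (y b) (fderiv ℝ (y b) z) z := fun b z hz =>
    (((hy b).differentiableOn one_ne_zero).differentiableAt (hT.mem_nhds hz)).hasFDerivAt
  have dS : ∀ z ∈ T, HasFDerivAt S (fderiv ℝ S z) z := fun z hz =>
    ((hSd.differentiableOn one_ne_zero).differentiableAt (hT.mem_nhds hz)).hasFDerivAt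
  set L : E → ℝ := fun z => ∑ b, (‖fderiv ℝ (y b) z‖ + ‖fderiv ℝ (Y b) z‖) with hL
  have hLc : ContinuousOn L T := continuousOn_finsetSum _ fun b _ =>
    ((hy b).continuousOn_fderiv_of_isOpen hT le_rfl).norm.add
      ((hY b).continuousOn_fderiv_of_isOpen hT le_rfl).norm
  have hdS : ∀ z ∈ T, ‖fderiv ℝ S z‖ ≤ K z * N z * L z := by
    intro z hz
    have h1 : fderiv ℝ S z = ∑ b, (Y b z • fderiv ℝ (y b) z + y b z • fderiv ℝ (Y b) z) :=
      (HasFDerivAt.fun_sum fun b _ => (dY b z hz).mul (dy b z hz)).fderiv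
    rw [h1, hL, Finset.mul_sum]
    refine (norm_sum_le _ _).trans (Finset.sum_le_sum fun b _ => (norm_add_le _ _).trans ?_)
    rw [norm_smul, norm_smul, mul_add]
    exact add_le_add (mul_le_mul_of_nonneg_right (hYK z hz b) (norm_nonneg _))
      (mul_le_mul_of_nonneg_right (hyK z hz b) (norm_nonneg _))
  -- The product rule with N^r = S^{r/2}. Where N = 0 the formula gives the correct value 0 whatever
  -- N^{r-2} means there, since Y vanishes too.
  set D : E → E →L[ℝ] ℝ := fun z => N z ^ r • fderiv ℝ (Y a) z +
    (Y a z * (r / 2 * N z ^ (r - 2))) • fderiv ℝ S z with hD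
  have hY0 : ∀ z ∈ T, N z = 0 → Y a z = 0 := fun z hz h => by
    have := hYK z hz a
    rw [h, mul_zero] at this
    exact abs_nonpos_iff.1 this
  have hD0 : ∀ z ∈ T, N z = 0 → D z = 0 := fun z hz h => by
    simp only [hD]
    rw [hY0 z hz h, h, Real.zero_rpow hr.ne']
    simp
  have hder : ∀ z ∈ T, HasFDerivAt (fun z => N z ^ r * Y a z) (D z) z := by
    intro z hz
    by_cases h : N z = 0
    · rw [hD0 z hz h]
      have hO : (fun x => Y a x) =O[nhds z] fun x => x - z := by
        have := (dY a z hz).isBigO_sub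
        simpa only [hY0 z hz h, sub_zero] using this
      -- At a zero of N, N^r is o(1) and Y is O(x - z), so the product is o(x - z).
      have ho : (fun x => N x ^ r) =o[nhds z] fun _ => (1 : ℝ) := by
        rw [Asymptotics.isLittleO_one_iff]
        have hc := ((hNc.continuousAt (hT.mem_nhds hz)).rpow_const (p := r) (Or.inr hr.le)).tendsto
        rwa [h, Real.zero_rpow hr.ne'] at hc
      refine HasFDerivAt.of_isLittleO ?_
      have h3 := ho.mul_isBigO hO.norm_right
      simp only [one_mul] at h3
      have h4 := h3.of_norm_right
      refine h4.congr_left fun x => ?_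
      simp [h, Real.zero_rpow hr.ne']
    · have hS0 : S z ≠ 0 := fun h0 => h (by rw [hNS z hz, h0, Real.sqrt_zero])
      have h1 := ((dS z hz).rpow_const (p := r / 2) (Or.inl hS0)).mul (dY a z hz)
      have h2 : (fun z => N z ^ r * Y a z) =ᶠ[nhds z] (fun z => S z ^ (r / 2)) * Y a := by
        filter_upwards [hT.mem_nhds hz] with x hx
        rw [Pi.mul_apply, hNr x hx]
      refine (h1.congr_of_eventuallyEq h2).congr_fderiv ?_
      simp only [hD]
      rw [hNr z hz r, hNr z hz (r - 2), smul_smul, show (r - 2) / 2 = r / 2 - 1 by ring]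
  -- The bounds |Y| ≤ KN and ‖dS‖ ≤ KNL absorb the possibly negative power N^{r-2}. What remains
  -- tends to 0 at the zeros of N, which gives continuity of D there.
  have hbound : ∀ z ∈ T, ‖D z‖ ≤ N z ^ r * (‖fderiv ℝ (Y a) z‖ + r / 2 * K z ^ 2 * L z) := by
    intro z hz
    by_cases h : N z = 0
    · rw [hD0 z hz h, h, Real.zero_rpow hr.ne']
      simp
    · have hpos : 0 < N z := lt_of_le_of_ne (hN0 z) (Ne.symm h)
      have e : N z ^ r = N z ^ (r - 2) * (N z * N z) := by
        rw [← sq, ← Real.rpow_natCast, ← Real.rpow_add hpos]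
        congr 1
        norm_num
      have hq : 0 ≤ N z ^ (r - 2) := Real.rpow_nonneg hpos.le _
      refine (norm_add_le _ _).trans ?_
      rw [norm_smul, norm_smul, Real.norm_of_nonneg (Real.rpow_nonneg hpos.le r), mul_add,
        Real.norm_eq_abs, abs_mul, abs_of_nonneg (mul_nonneg (half_pos hr).le hq)]
      refine add_le_add le_rfl ?_
      calc |Y a z| * (r / 2 * N z ^ (r - 2)) * ‖fderiv ℝ S z‖
          ≤ (K z * N z) * (r / 2 * N z ^ (r - 2)) * (K z * N z * L z) := by
            gcongr
            · exact mul_nonneg ((abs_nonneg _).trans (hYK z hz a))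
                (mul_nonneg (half_pos hr).le hq)
            · exact hYK z hz a
            · exact hdS z hz
        _ = N z ^ r * (r / 2 * K z ^ 2 * L z) := by rw [e]; ring
  have hDc : ContinuousOn D T := by
    intro z hz
    have hzT := hT.mem_nhds hz
    have cdY := ((hY a).continuousOn_fderiv_of_isOpen hT le_rfl).continuousAt hzT
    have cN := hNc.continuousAt hzT
    refine ContinuousAt.continuousWithinAt ?_
    by_cases h : N z = 0
    · have hlim : Filter.Tendsto
          (fun z => N z ^ r * (‖fderiv ℝ (Y a) z‖ + r / 2 * K z ^ 2 * L z)) (nhds z) (nhds 0) := by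
        have hc : ContinuousAt
            (fun z => N z ^ r * (‖fderiv ℝ (Y a) z‖ + r / 2 * K z ^ 2 * L z)) z :=
          (cN.rpow_const (Or.inr hr.le)).mul (cdY.norm.add
            ((continuousAt_const.mul ((hK.continuousAt hzT).pow 2)).mul (hLc.continuousAt hzT)))
        have h1 := hc.tendsto
        rwa [h, Real.zero_rpow hr.ne', zero_mul] at h1
      rw [ContinuousAt, hD0 z hz h]
      refine squeeze_zero_norm' ?_ hlim
      filter_upwards [hzT] with x hx using hbound x hx
    · exact ((cN.rpow_const (Or.inl h)).smul cdY).add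
        ((((hY a).continuousOn.continuousAt hzT).mul
          (continuousAt_const.mul (cN.rpow_const (Or.inl h)))).smul
          ((hSd.continuousOn_fderiv_of_isOpen hT le_rfl).continuousAt hzT))
  rw [← zero_add (1 : WithTop ℕ∞), contDiffOn_succ_iff_fderiv_of_isOpen hT, contDiffOn_zero]
  exact ⟨fun z hz => (hder z hz).differentiableAt.differentiableWithinAt, by simp,
    hDc.congr fun z hz => (hder z hz).fderiv⟩

end PowerRegularity

end PFreq

namespace PFreq

/-! ### C¹ vector fields, the flux |∇u|^{p-2}∇u and the weighted measure. -/

section Fields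

variable {n : ℕ} {M : Type*} [TopologicalSpace M] [ChartedSpace (EuclideanSpace ℝ (Fin n)) M]
  [IsManifold (𝓡 n) ∞ M]

theorem coordComp_smul (h : M → ℝ) (X : (x : M) → TangentSpace (𝓡 n) x) (c : M) (i : Fin n)
    (z : EuclideanSpace ℝ (Fin n)) :
    coordComp (fun x => h x • X x) c i z = h ((extChartAt (𝓡 n) c).symm z) * coordComp X c i z := by
  have h1 : (show EuclideanSpace ℝ (Fin n) from
      mfderiv (𝓡 n) 𝓘(ℝ, EuclideanSpace ℝ (Fin n)) (extChartAt (𝓡 n) c)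
      ((extChartAt (𝓡 n) c).symm z)
      (h ((extChartAt (𝓡 n) c).symm z) • X ((extChartAt (𝓡 n) c).symm z))) =
      h ((extChartAt (𝓡 n) c).symm z) • (show EuclideanSpace ℝ (Fin n) from
      mfderiv (𝓡 n) 𝓘(ℝ, EuclideanSpace ℝ (Fin n)) (extChartAt (𝓡 n) c)
      ((extChartAt (𝓡 n) c).symm z) (X ((extChartAt (𝓡 n) c).symm z))) :=
    ContinuousLinearMap.map_smul (mfderiv (𝓡 n) 𝓘(ℝ, EuclideanSpace ℝ (Fin n))
      (extChartAt (𝓡 n) c) ((extChartAt (𝓡 n) c).symm z)) (h ((extChartAt (𝓡 n) c).symm z))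
      (X ((extChartAt (𝓡 n) c).symm z))
  exact congrArg (fun v : EuclideanSpace ℝ (Fin n) => v i) h1

theorem isC1Field_of_contMDiff {X : (x : M) → TangentSpace (𝓡 n) x}
    (hX : ContMDiff (𝓡 n) (𝓡 n).tangent 1 (fun x => (⟨x, X x⟩ : TangentBundle (𝓡 n) M))) :
    IsC1Field X := by
  intro c i
  have h1 := (contMDiffOn_extChartAt (I := 𝓡 n) (n := 2) (x := c)).contMDiffOn_tangentMapWithin
    (m := 1) (by norm_num) (chartAt (EuclideanSpace ℝ (Fin n)) c).open_source.uniqueMDiffOn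
  have h2 := hX.comp_contMDiffOn ((contMDiffOn_extChartAt_symm (I := 𝓡 n) (n := ∞) c).of_le
    (show (1 : WithTop ℕ∞) ≤ ∞ by simp))
  have hmem : ∀ z ∈ (extChartAt (𝓡 n) c).target,
      (extChartAt (𝓡 n) c).symm z ∈ (chartAt (EuclideanSpace ℝ (Fin n)) c).source := fun z hz => by
    rw [← extChartAt_source (𝓡 n)]
    exact (extChartAt (𝓡 n) c).map_target hz
  have h3 := h1.comp h2 hmem
  have h4 := (contMDiff_snd_tangentBundle_modelSpace (n := 1) (EuclideanSpace ℝ (Fin n))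
    𝓘(ℝ, EuclideanSpace ℝ (Fin n))).comp_contMDiffOn h3
  rw [contMDiffOn_iff_contDiffOn] at h4
  have h5 := (EuclideanSpace.proj i : EuclideanSpace ℝ (Fin n) →L[ℝ] ℝ).contDiff.comp_contDiffOn h4
  refine h5.congr fun z hz => ?_
  simp only [Function.comp, tangentMapWithin]
  rw [mfderivWithin_of_isOpen (chartAt (EuclideanSpace ℝ (Fin n)) c).open_source (hmem z hz)]
  rfl

theorem IsC1Field.smul {h : M → ℝ} (hh : ContMDiff (𝓡 n) 𝓘(ℝ, ℝ) 1 h)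
    {X : (x : M) → TangentSpace (𝓡 n) x} (hX : IsC1Field X) : IsC1Field (fun x => h x • X x) :=
  fun c i => ((contDiffOn_comp_chart_symm (by simp) hh c).mul (hX c i)).congr
    fun z _ => coordComp_smul h X c i z

theorem exp_neg_contMDiff {f : M → ℝ} (hf : ContMDiff (𝓡 n) 𝓘(ℝ, ℝ) 1 f) :
    ContMDiff (𝓡 n) 𝓘(ℝ, ℝ) 1 (fun x => Real.exp (-f x)) :=
  (Real.contDiff_exp.comp contDiff_neg).comp_contMDiff hf

variable [RiemannianBundle (fun x : M => TangentSpace (𝓡 n) x)]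

theorem dirDeriv_smul (w : M → ℝ) (h : M → ℝ) (X : (x : M) → TangentSpace (𝓡 n) x) (x : M) :
    dirDeriv w (fun x => h x • X x) x = h x * dirDeriv w X x :=
  ContinuousLinearMap.map_smul (mfderiv (𝓡 n) 𝓘(ℝ, ℝ) w x) (h x) (X x)

theorem dirDeriv_grad (w v : M → ℝ) (x : M) :
    dirDeriv w (grad (n := n) v) x = inner ℝ (grad (n := n) w x) (grad (n := n) v x) :=
  (inner_grad w x _).symm

theorem sq_gradNorm {m : ℕ} (u : M → EuclideanSpace ℝ (Fin m)) (x : M) :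
    gradNorm n u x ^ 2 = ∑ k : Fin m, ‖grad (n := n) (fun y => u y k) x‖ ^ 2 :=
  Real.sq_sqrt (Finset.sum_nonneg fun _ _ => sq_nonneg _)

theorem gradNorm_nonneg {m : ℕ} (u : M → EuclideanSpace ℝ (Fin m)) (x : M) :
    0 ≤ gradNorm n u x := Real.sqrt_nonneg _

theorem norm_grad_le_gradNorm {m : ℕ} (u : M → EuclideanSpace ℝ (Fin m)) (x : M) (k : Fin m) :
    ‖grad (n := n) (fun y => u y k) x‖ ≤ gradNorm n u x := by
  refine Real.le_sqrt_of_sq_le ?_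
  exact Finset.single_le_sum (f := fun k => ‖grad (n := n) (fun y => u y k) x‖ ^ 2)
    (fun _ _ => sq_nonneg _) (Finset.mem_univ k)

variable [IsContMDiffRiemannianBundle (𝓡 n) ∞ (EuclideanSpace ℝ (Fin n))
      (fun x : M => TangentSpace (𝓡 n) x)]

theorem two_le_infty : (2 : WithTop ℕ∞) ≤ ∞ := WithTop.coe_le_coe.2 le_top

theorem partialDeriv_contDiffOn {T : Set (EuclideanSpace ℝ (Fin n))} (hT : IsOpen T)
    {G : EuclideanSpace ℝ (Fin n) → ℝ} (hG : ContDiffOn ℝ 2 G T) (i : Fin n) :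
    ContDiffOn ℝ 1 (partialDeriv i G) T :=
  (hG.fderiv_of_isOpen hT (m := 1) (by norm_num)).clm_apply contDiffOn_const

theorem isC1Field_grad {w : M → ℝ} (hw : ContMDiff (𝓡 n) 𝓘(ℝ, ℝ) 2 w) :
    IsC1Field (grad (n := n) w) := by
  intro c i
  refine ContDiffOn.congr ?_ fun z hz => coordComp_grad hz (hw.mdifferentiable two_ne_zero _) i
  refine ContDiffOn.sum fun j _ => ((gram_inv_contDiffOn c i j).of_le (by simp)).mul ?_
  refine partialDeriv_contDiffOn (isOpen_extChartAt_target c) (contDiffOn_comp_chart_symm ?_ hw c) j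
  exact two_le_infty

theorem isC1Field_pFlux {m : ℕ} {p : ℝ} (hp : 2 ≤ p) {u : M → EuclideanSpace ℝ (Fin m)}
    (hu : ∀ k, ContMDiff (𝓡 n) 𝓘(ℝ, ℝ) 2 (fun x => u x k)) (k : Fin m) :
    IsC1Field (pFlux (n := n) p u k) := by
  rcases hp.eq_or_lt with rfl | hp
  · have h : pFlux (n := n) 2 u k = grad (n := n) (fun x => u x k) := by
      ext x
      rw [pFlux, sub_self, Real.rpow_zero, one_smul]
    rw [h]
    exact isC1Field_grad (hu k)
  intro c i
  have hT := isOpen_extChartAt_target (I := 𝓡 n) c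
  have hle : (2 : WithTop ℕ∞) ≤ ∞ := by exact two_le_infty
  set K₁ : EuclideanSpace ℝ (Fin n) → ℝ := fun z => ∑ j, ‖coordVec c z j‖ with hK₁
  set K₂ : EuclideanSpace ℝ (Fin n) → ℝ := fun z => ∑ i, ∑ j, |(gram c z)⁻¹ i j| with hK₂
  have hK₁0 : ∀ z, 0 ≤ K₁ z := fun z => Finset.sum_nonneg fun _ _ => norm_nonneg _
  have hK₂0 : ∀ z, 0 ≤ K₂ z := fun z =>
    Finset.sum_nonneg fun _ _ => Finset.sum_nonneg fun _ _ => abs_nonneg _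
  have hK₁c : ContinuousOn K₁ (extChartAt (𝓡 n) c).target := by
    refine continuousOn_finsetSum _ fun j _ => ?_
    have : (fun z => ‖coordVec c z j‖) = fun z => Real.sqrt (gram c z j j) := by
      ext z
      rw [gram, Matrix.of_apply, real_inner_self_eq_norm_sq, Real.sqrt_sq (norm_nonneg _)]
    rw [this]
    exact (gram_contDiffOn c j j).continuousOn.sqrt
  have hK₂c : ContinuousOn K₂ (extChartAt (𝓡 n) c).target :=
    continuousOn_finsetSum _ fun i _ => continuousOn_finsetSum _ fun j _ =>
      (gram_inv_contDiffOn c i j).continuousOn.abs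
  set N : EuclideanSpace ℝ (Fin n) → ℝ := fun z => gradNorm n u ((extChartAt (𝓡 n) c).symm z)
  have hN0 : ∀ z, 0 ≤ N z := fun z => gradNorm_nonneg u _
  have hd : ∀ z k, MDifferentiableAt (𝓡 n) 𝓘(ℝ, ℝ) (fun x => u x k)
      ((extChartAt (𝓡 n) c).symm z) := fun z k => (hu k).mdifferentiable two_ne_zero _
  have b1 : ∀ z ∈ (extChartAt (𝓡 n) c).target, ∀ k j,
      |partialDeriv j ((fun x => u x k) ∘ (extChartAt (𝓡 n) c).symm) z| ≤ K₁ z * N z := by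
    intro z hz k j
    rw [← mfderiv_coordVec hz (hd z k), ← inner_grad, mul_comm]
    refine (abs_real_inner_le_norm _ _).trans (mul_le_mul (norm_grad_le_gradNorm u _ k) ?_
      (norm_nonneg _) (hN0 z))
    exact Finset.single_le_sum (f := fun j => ‖coordVec c z j‖) (fun _ _ => norm_nonneg _)
      (Finset.mem_univ j)
  have b2 : ∀ z ∈ (extChartAt (𝓡 n) c).target, ∀ k i,
      |coordComp (grad (n := n) fun x => u x k) c i z| ≤ K₂ z * (K₁ z * N z) := by
    intro z hz k i
    rw [coordComp_grad hz (hd z k)]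
    refine (Finset.abs_sum_le_sum_abs _ _).trans ?_
    calc ∑ j, |(gram c z)⁻¹ i j *
          partialDeriv j ((fun x => u x k) ∘ (extChartAt (𝓡 n) c).symm) z|
        ≤ ∑ j, |(gram c z)⁻¹ i j| * (K₁ z * N z) := by
          refine Finset.sum_le_sum fun j _ => ?_
          rw [abs_mul]
          exact mul_le_mul_of_nonneg_left (b1 z hz k j) (abs_nonneg _)
      _ = (∑ j, |(gram c z)⁻¹ i j|) * (K₁ z * N z) := (Finset.sum_mul _ _ _).symm
      _ ≤ K₂ z * (K₁ z * N z) := by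
          refine mul_le_mul_of_nonneg_right ?_ (mul_nonneg (hK₁0 z) (hN0 z))
          exact Finset.single_le_sum (f := fun i => ∑ j, |(gram c z)⁻¹ i j|)
            (fun _ _ => Finset.sum_nonneg fun _ _ => abs_nonneg _) (Finset.mem_univ i)
  -- In coordinates |∇u|² is the sum over k, i of (∇uₖ)ⁱ ∂ᵢuₖ: the contravariant components serve as
  -- Y, the covariant ones as y. The exponent p - 2 is positive because p = 2 was treated apart.
  have hmain := contDiffOn_rpow_mul (ι := Fin m × Fin n) hT
    (Y := fun a => coordComp (grad (n := n) fun x => u x a.1) c a.2)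
    (y := fun a => partialDeriv a.2 ((fun x => u x a.1) ∘ (extChartAt (𝓡 n) c).symm))
    (K := fun z => K₁ z + K₂ z * K₁ z) (N := N) (fun a => isC1Field_grad (hu a.1) c a.2)
    (fun a => partialDeriv_contDiffOn hT (contDiffOn_comp_chart_symm hle (hu a.1) c) a.2)
    (hK₁c.add (hK₂c.mul hK₁c)) hN0 (by
      intro z hz
      rw [sq_gradNorm, Fintype.sum_prod_type]
      refine Finset.sum_congr rfl fun k _ => ?_
      rw [← real_inner_self_eq_norm_sq, inner_grad_grad hz (hd z k)])
    (by
      intro z hz a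
      refine (b2 z hz a.1 a.2).trans ?_
      have := mul_nonneg (hK₁0 z) (hN0 z)
      rw [add_mul]
      linarith)
    (by
      intro z hz a
      refine (b1 z hz a.1 a.2).trans ?_
      have := mul_nonneg (mul_nonneg (hK₂0 z) (hK₁0 z)) (hN0 z)
      rw [add_mul]
      linarith) (sub_pos.2 hp) (k, i)
  exact hmain.congr fun z _ => coordComp_smul (fun x => gradNorm n u x ^ (p - 2)) _ c i z

theorem continuous_inner_grad {w v : M → ℝ} (hw : ContMDiff (𝓡 n) 𝓘(ℝ, ℝ) 2 w)
    (hv : ContMDiff (𝓡 n) 𝓘(ℝ, ℝ) 2 v) :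
    Continuous fun x => inner ℝ (grad (n := n) w x) (grad (n := n) v x) := by
  have := continuous_dirDeriv (hw.of_le one_le_two) (isC1Field_grad hv)
  exact this.congr fun x => dirDeriv_grad w v x

theorem continuous_weightedDiv {f : M → ℝ} [MeasurableSpace M] [BorelSpace M] [CompactSpace M]
    [T2Space M] (hf : ContMDiff (𝓡 n) 𝓘(ℝ, ℝ) 1 f) {X : (x : M) → TangentSpace (𝓡 n) x}
    (hX : IsC1Field X) : Continuous (weightedDiv f X) :=
  (Real.continuous_exp.comp hf.continuous).mul
    (continuous_divergence (hX.smul (exp_neg_contMDiff hf)))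

variable [MeasurableSpace M] [BorelSpace M] [CompactSpace M]

theorem integral_weightedVolume {f : M → ℝ} (hf : Continuous f) (h : M → ℝ) :
    ∫ x, h x ∂(weightedVolume n f) = ∫ x, Real.exp (-f x) * h x ∂(riemannianVolume n M) := by
  rw [weightedVolume, integral_withDensity_eq_integral_toReal_smul
    (by fun_prop) (ae_of_all _ fun _ => ENNReal.ofReal_lt_top)]
  simp only [smul_eq_mul, ENNReal.toReal_ofReal (Real.exp_pos _).le]

theorem ae_weightedVolume {f : M → ℝ} {P : M → Prop}
    (h : ∀ᵐ x ∂(riemannianVolume n M), P x) : ∀ᵐ x ∂(weightedVolume n f), P x :=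
  (withDensity_absolutelyContinuous _ _).ae_le h

theorem isFiniteMeasure_weightedVolume {f : M → ℝ} (hf : Continuous f) :
    IsFiniteMeasure (weightedVolume n f) := by
  have h : Integrable (fun x => Real.exp (-f x)) (riemannianVolume n M) :=
    (by fun_prop : Continuous fun x => Real.exp (-f x)).integrable_of_hasCompactSupport
      (HasCompactSupport.of_compactSpace _)
  exact isFiniteMeasure_withDensity_ofReal h.2

theorem isOpenPosMeasure_weightedVolume {f : M → ℝ} (hf : Continuous f) :
    (weightedVolume n f).IsOpenPosMeasure :=
  Measure.AbsolutelyContinuous.isOpenPosMeasure (μ := riemannianVolume n M)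
    (withDensity_absolutelyContinuous' (by fun_prop)
      (ae_of_all _ fun x => by simp [Real.exp_pos]))

variable [T2Space M]

/-- The divergence theorem for the weighted measure. -/
theorem integral_dirDeriv_weighted {f : M → ℝ} (hf : ContMDiff (𝓡 n) 𝓘(ℝ, ℝ) 1 f)
    {X : (x : M) → TangentSpace (𝓡 n) x} (hX : IsC1Field X) {w : M → ℝ}
    (hw : ContMDiff (𝓡 n) 𝓘(ℝ, ℝ) 1 w) :
    ∫ x, dirDeriv w X x ∂(weightedVolume n f) =
      -∫ x, w x * weightedDiv f X x ∂(weightedVolume n f) := by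
  have h := integral_dirDeriv (hX.smul (exp_neg_contMDiff hf)) hw
  simp only [dirDeriv_smul] at h
  rw [integral_weightedVolume hf.continuous, integral_weightedVolume hf.continuous, h]
  congr 1
  refine integral_congr_ae (ae_of_all _ fun x => ?_)
  simp only [weightedDiv]
  rw [mul_left_comm, ← mul_assoc (Real.exp (-f x)), ← Real.exp_add, neg_add_cancel, Real.exp_zero,
    one_mul]

/-- The weighted `p`-Laplacian vanishes at almost every zero of the function. -/
theorem ae_pLaplacian_eq_zero {m : ℕ} {f : M → ℝ} (hf : ContMDiff (𝓡 n) 𝓘(ℝ, ℝ) 1 f) {p : ℝ}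
    {u : M → EuclideanSpace ℝ (Fin m)}
    (hu : ∀ k, ContMDiff (𝓡 n) 𝓘(ℝ, ℝ) 1 (fun x => u x k)) (huc : Continuous u)
    (hX : ∀ k, IsC1Field (pFlux (n := n) p u k)) :
    ∀ᵐ x ∂(weightedVolume n f), u x = 0 → pLaplacian n f p u x = 0 := by
  rcases isEmpty_or_nonempty M with hM | hM
  · exact ae_of_all _ fun x => (IsEmpty.false x).elim
  refine ae_weightedVolume ?_
  have hdiv : ∀ k, Continuous (weightedDiv f (pFlux (n := n) p u k)) := fun k =>
    continuous_weightedDiv hf (hX k)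
  have hlap : Continuous (pLaplacian n f p u) :=
    (PiLp.continuous_toLp 2 _).comp (continuous_pi hdiv)
  refine ae_riemannianVolume_of_chart ?_ fun c => ?_
  · have h1 : MeasurableSet {x | u x = 0} := (isClosed_eq huc continuous_const).measurableSet
    have h2 : MeasurableSet {x | pLaplacian n f p u x = 0} :=
      (isClosed_eq hlap continuous_const).measurableSet
    simp only [imp_iff_not_or]
    exact h1.compl.union h2
  have hT := isOpen_extChartAt_target (I := 𝓡 n) c
  have hY : ∀ k, IsC1Field (fun y => Real.exp (-f y) • pFlux (n := n) p u k y) := fun k =>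
    (hX k).smul (exp_neg_contMDiff hf)
  -- The zero set principle is used twice: for u, so that ∇u and hence the flux vanish almost
  -- everywhere on {u = 0}, and for the flux components with their density, whose derivatives make
  -- up the divergence.
  have a1 : ∀ k, ∀ᵐ z ∂(volume.restrict (extChartAt (𝓡 n) c).target),
      ((fun x => u x k) ∘ (extChartAt (𝓡 n) c).symm) z = 0 →
      fderiv ℝ ((fun x => u x k) ∘ (extChartAt (𝓡 n) c).symm) z = 0 := fun k =>
    ae_fderiv_eq_zero_of_eq_zero hT
      ((contDiffOn_comp_chart_symm (by simp) (hu k) c).differentiableOn one_ne_zero)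
  have a2 : ∀ k i, ∀ᵐ z ∂(volume.restrict (extChartAt (𝓡 n) c).target),
      volDensity c z * coordComp (fun y => Real.exp (-f y) • pFlux (n := n) p u k y) c i z = 0 →
      fderiv ℝ (fun z => volDensity c z *
        coordComp (fun y => Real.exp (-f y) • pFlux (n := n) p u k y) c i z) z = 0 := fun k i =>
    ae_fderiv_eq_zero_of_eq_zero hT
      ((contDiffOn_volDensity_mul (hY k) c i).differentiableOn one_ne_zero)
  filter_upwards [ae_all_iff.2 a1, ae_all_iff.2 fun k => ae_all_iff.2 (a2 k),
    ae_restrict_mem hT.measurableSet] with z h1 h2 hz h0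
  have hcomp : ∀ k i, coordComp (fun y => Real.exp (-f y) • pFlux (n := n) p u k y) c i z = 0 := by
    intro k i
    have hg : coordComp (grad (n := n) fun x => u x k) c i z = 0 := by
      rw [coordComp_grad hz ((hu k).mdifferentiable one_ne_zero _)]
      refine Finset.sum_eq_zero fun j _ => ?_
      rw [partialDeriv, h1 k (by simp only [Function.comp_apply, h0]; rfl)]
      simp
    have hp : coordComp (pFlux (n := n) p u k) c i z = 0 := by
      have := coordComp_smul (fun x => gradNorm n u x ^ (p - 2)) (grad (n := n) fun x => u x k) c i z
      rw [hg, mul_zero] at this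
      exact this
    rw [coordComp_smul, hp, mul_zero]
  ext k
  have hd : divergence (fun y => Real.exp (-f y) • pFlux (n := n) p u k y)
      ((extChartAt (𝓡 n) c).symm z) = 0 := by
    rw [divergence_eq_chartDiv (hY k) c ((extChartAt (𝓡 n) c).map_target hz),
      (extChartAt (𝓡 n) c).right_inv hz, chartDiv, Finset.sum_eq_zero, mul_zero]
    intro i _
    rw [partialDeriv, h2 k i (by rw [hcomp k i, mul_zero])]
    simp
  simp only [pLaplacian, weightedDiv, hd, mul_zero]
  rfl

end Fields

end PFreq

namespace PFreq

/-! ### Time-dependent functions: time derivatives and spatial gradients. -/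

section TimeDependent

variable {n : ℕ} {M : Type*} [TopologicalSpace M] [ChartedSpace (EuclideanSpace ℝ (Fin n)) M]

/-- A time-dependent function that is smooth in the charts of `M`, for times in `J`. -/
def SmoothFamily (n : ℕ) {M : Type*} [TopologicalSpace M]
    [ChartedSpace (EuclideanSpace ℝ (Fin n)) M] (w : M → ℝ → ℝ) (J : Set ℝ) : Prop :=
  ∀ c : M, ContDiffOn ℝ ∞
    (fun q : EuclideanSpace ℝ (Fin n) × ℝ => w ((extChartAt (𝓡 n) c).symm q.1) q.2)
    ((extChartAt (𝓡 n) c).target ×ˢ J)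

theorem SmoothFamily.mono {w : M → ℝ → ℝ} {J J' : Set ℝ} (hw : SmoothFamily n w J) (h : J' ⊆ J) :
    SmoothFamily n w J' := fun c => (hw c).mono (prod_mono_right h)

theorem SmoothFamily.contDiffOn_slice {w : M → ℝ → ℝ} {J : Set ℝ} (hw : SmoothFamily n w J) {t : ℝ}
    (ht : t ∈ J) (c : M) : ContDiffOn ℝ ∞ ((fun x => w x t) ∘ (extChartAt (𝓡 n) c).symm)
      (extChartAt (𝓡 n) c).target :=
  (hw c).comp (f := fun z => (z, t)) (contDiffOn_id.prodMk contDiffOn_const) fun _ hz => ⟨hz, ht⟩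

theorem SmoothFamily.continuousOn {w : M → ℝ → ℝ} {J : Set ℝ} (hw : SmoothFamily n w J) :
    ContinuousOn (fun q : M × ℝ => w q.1 q.2) (univ ×ˢ J) := by
  rintro ⟨x, t⟩ ⟨-, ht⟩
  have h1 : ContinuousOn (fun q : M × ℝ => (extChartAt (𝓡 n) x q.1, q.2))
      ((extChartAt (𝓡 n) x).source ×ˢ J) :=
    ((continuousOn_extChartAt x).comp continuousOn_fst fun q hq => hq.1).prodMk continuousOn_snd
  have h2 := (hw x).continuousOn.comp h1
    fun q hq => ⟨(extChartAt (𝓡 n) x).map_source hq.1, hq.2⟩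
  have h3 : ContinuousOn (fun q : M × ℝ => w q.1 q.2) ((extChartAt (𝓡 n) x).source ×ˢ J) :=
    h2.congr fun q hq => by simp only [Function.comp, (extChartAt (𝓡 n) x).left_inv hq.1]
  refine (h3 (x, t) ⟨mem_extChartAt_source x, ht⟩).mono_of_mem_nhdsWithin ?_
  rw [nhdsWithin_prod_eq]
  exact Filter.prod_mem_prod (mem_nhdsWithin_of_mem_nhds (extChartAt_source_mem_nhds x))
    self_mem_nhdsWithin

theorem SmoothFamily.hasDerivAt {w : M → ℝ → ℝ} {J : Set ℝ} (hJ : IsOpen J)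
    (hw : SmoothFamily n w J) {t : ℝ} (ht : t ∈ J) (x : M) :
    HasDerivAt (w x) (deriv (w x) t) t := by
  have hT := (isOpen_extChartAt_target (I := 𝓡 n) x).prod hJ
  have hmem : (extChartAt (𝓡 n) x x, t) ∈ (extChartAt (𝓡 n) x).target ×ˢ J :=
    ⟨mem_extChartAt_target x, ht⟩
  have h1 := ((hw x).differentiableOn (by simp)).differentiableAt (hT.mem_nhds hmem)
  have h2 : DifferentiableAt ℝ (fun s => ((extChartAt (𝓡 n) x x, s) :
      EuclideanSpace ℝ (Fin n) × ℝ)) t := (differentiableAt_const _).prodMk differentiableAt_id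
  have h3 := DifferentiableAt.comp t h1 h2
  simp only [Function.comp_def, extChartAt_to_inv] at h3
  exact h3.hasDerivAt

theorem SmoothFamily.timeDeriv {w : M → ℝ → ℝ} {J : Set ℝ} (hJ : IsOpen J) (hw : SmoothFamily n w J) :
    SmoothFamily n (fun x t => deriv (w x) t) J := by
  intro c
  have hT := (isOpen_extChartAt_target (I := 𝓡 n) c).prod hJ
  have h1 := ((hw c).fderiv_of_isOpen hT (m := ∞) (by simp)).clm_apply
    (contDiffOn_const (c := ((0 : EuclideanSpace ℝ (Fin n)), (1 : ℝ))))
  refine h1.congr fun q hq => ?_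
  have h2 := (((hw c).differentiableOn (by simp)).differentiableAt (hT.mem_nhds hq)).hasFDerivAt
  have h3 := h2.comp_hasDerivAt (f := fun s => (q.1, s)) q.2
    ((hasDerivAt_const q.2 q.1).prodMk (hasDerivAt_id q.2))
  exact h3.deriv

/-- Both orders of differentiation are values of the second derivative of W on (eᵢ, 0) and (0, 1),
and that derivative is symmetric. -/
theorem hasDerivAt_partialDeriv {T : Set (EuclideanSpace ℝ (Fin n))} (hT : IsOpen T) {J : Set ℝ}
    (hJ : IsOpen J) {W : EuclideanSpace ℝ (Fin n) × ℝ → ℝ} (hW : ContDiffOn ℝ ∞ W (T ×ˢ J))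
    {z : EuclideanSpace ℝ (Fin n)} (hz : z ∈ T) {t : ℝ} (ht : t ∈ J) (i : Fin n) :
    HasDerivAt (fun s => partialDeriv i (fun y => W (y, s)) z)
      (partialDeriv i (fun y => deriv (fun s => W (y, s)) t) z) t := by
  have hTJ := hT.prod hJ
  have hq : ∀ q ∈ T ×ˢ J, HasFDerivAt W (fderiv ℝ W q) q := fun q hq =>
    ((hW.differentiableOn (by simp)).differentiableAt (hTJ.mem_nhds hq)).hasFDerivAt
  have hmem : (z, t) ∈ T ×ˢ J := ⟨hz, ht⟩
  have h2 := hW.fderiv_of_isOpen hTJ (m := ∞) (by simp)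
  have h3 := ((h2.differentiableOn (by simp)).differentiableAt (hTJ.mem_nhds hmem)).hasFDerivAt
  have hpi : ∀ s ∈ J, partialDeriv i (fun y => W (y, s)) z =
      fderiv ℝ W (z, s) (EuclideanSpace.single i 1, 0) := by
    intro s hs
    have h4 := (hq (z, s) ⟨hz, hs⟩).comp (f := fun y => (y, s)) z (hasFDerivAt_prodMk_left z s)
    have h5 : (fun y => W (y, s)) = W ∘ fun y => (y, s) := rfl
    rw [partialDeriv, h5, h4.fderiv]
    simp
  have hdt : ∀ y ∈ T, deriv (fun s => W (y, s)) t = fderiv ℝ W (y, t) (0, 1) := by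
    intro y hy
    exact ((hq (y, t) ⟨hy, ht⟩).comp_hasDerivAt (f := fun s => (y, s)) t
      ((hasDerivAt_const t y).prodMk (hasDerivAt_id t))).deriv
  have hR : partialDeriv i (fun y => deriv (fun s => W (y, s)) t) z =
      fderiv ℝ (fderiv ℝ W) (z, t) (EuclideanSpace.single i 1, 0) (0, 1) := by
    have hev : (fun y => deriv (fun s => W (y, s)) t) =ᶠ[nhds z]
        fun y => fderiv ℝ W (y, t) (0, 1) := by
      filter_upwards [hT.mem_nhds hz] with y hy using hdt y hy
    have h6 := (h3.comp (f := fun y => (y, t)) z (hasFDerivAt_prodMk_left z t)).clm_apply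
      (hasFDerivAt_const ((0 : EuclideanSpace ℝ (Fin n)), (1 : ℝ)) z)
    rw [partialDeriv, hev.fderiv_eq]
    have h7 : (fun y => fderiv ℝ W (y, t) (0, 1)) =
      fun y => ((fderiv ℝ W) ∘ fun y => (y, t)) y (0, 1) := rfl
    rw [h7, h6.fderiv]
    simp
  have hsymm := ((hW.contDiffAt (hTJ.mem_nhds hmem)).isSymmSndFDerivAt
    (by simp only [minSmoothness_of_isRCLikeNormedField]; exact two_le_infty)).eq
    (EuclideanSpace.single i 1, 0) (0, 1)
  rw [hR, hsymm]
  have h8 := (h3.comp_hasDerivAt (f := fun s => (z, s)) t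
      ((hasDerivAt_const t z).prodMk (hasDerivAt_id t))).clm_apply
      (hasDerivAt_const t ((EuclideanSpace.single i (1 : ℝ)), (0 : ℝ)))
  have h9 : (fun s => partialDeriv i (fun y => W (y, s)) z) =ᶠ[nhds t]
      fun s => fderiv ℝ W (z, s) (EuclideanSpace.single i 1, 0) := by
    filter_upwards [hJ.mem_nhds ht] with s hs using hpi s hs
  refine (h8.congr_of_eventuallyEq h9).congr_deriv ?_
  simp

/-- The time set may be a closed interval, so the joint derivative is only a derivative within T ×
J; in the space directions it is a true derivative since T is open. This gives continuity of ∇u up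
to the end times. -/
theorem continuousOn_partialDeriv_slice {T : Set (EuclideanSpace ℝ (Fin n))} (hT : IsOpen T)
    {J : Set ℝ} (hJ : UniqueDiffOn ℝ J) {W : EuclideanSpace ℝ (Fin n) × ℝ → ℝ}
    (hW : ContDiffOn ℝ ∞ W (T ×ˢ J)) (i : Fin n) :
    ContinuousOn (fun q : EuclideanSpace ℝ (Fin n) × ℝ => partialDeriv i (fun y => W (y, q.2)) q.1)
      (T ×ˢ J) := by
  have h1 := (hW.continuousOn_fderivWithin (hT.uniqueDiffOn.prod hJ) (by simp)).clm_apply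
    (continuousOn_const (c := (EuclideanSpace.single i (1 : ℝ), (0 : ℝ))))
  refine h1.congr fun q hq => ?_
  have h2 := ((hW.differentiableOn (by simp)) q hq).hasFDerivWithinAt
  have h3 : HasFDerivWithinAt (fun y => W (y, q.2))
      ((fderivWithin ℝ W (T ×ˢ J) q).comp (ContinuousLinearMap.inl ℝ _ ℝ)) T q.1 :=
    HasFDerivWithinAt.comp (g := W) (f := fun y => (y, q.2)) q.1 h2
      (hasFDerivAt_prodMk_left q.1 q.2).hasFDerivWithinAt fun y hy => ⟨hy, hq.2⟩
  rw [partialDeriv, (h3.hasFDerivAt (hT.mem_nhds hq.1)).fderiv]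
  simp

variable [IsManifold (𝓡 n) ∞ M]

theorem contMDiff_of_chart {k : WithTop ℕ∞} (hk : k ≤ ∞) {w : M → ℝ}
    (h : ∀ c : M, ContDiffOn ℝ k (w ∘ (extChartAt (𝓡 n) c).symm) (extChartAt (𝓡 n) c).target) :
    ContMDiff (𝓡 n) 𝓘(ℝ, ℝ) k w := by
  intro x
  have h1 := ((h x).contDiffAt ((isOpen_extChartAt_target x).mem_nhds
    (mem_extChartAt_target x))).contMDiffAt
  have h2 := h1.comp x ((contMDiffAt_extChartAt (I := 𝓡 n) (n := ∞) (x := x)).of_le hk)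
  refine h2.congr_of_eventuallyEq ?_
  filter_upwards [extChartAt_source_mem_nhds (I := 𝓡 n) x] with y hy
  simp only [Function.comp, (extChartAt (𝓡 n) x).left_inv hy]

theorem SmoothFamily.contMDiff {w : M → ℝ → ℝ} {J : Set ℝ} (hw : SmoothFamily n w J) {t : ℝ}
    (ht : t ∈ J) : ContMDiff (𝓡 n) 𝓘(ℝ, ℝ) ∞ (fun x => w x t) :=
  contMDiff_of_chart le_rfl (hw.contDiffOn_slice ht)

theorem smoothFamily_of_contMDiffOn {w : M → ℝ → ℝ} {J : Set ℝ}
    (hw : ContMDiffOn ((𝓡 n).prod 𝓘(ℝ, ℝ)) 𝓘(ℝ, ℝ) ∞ (fun q : M × ℝ => w q.1 q.2) (univ ×ˢ J)) :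
    SmoothFamily n w J := by
  intro c
  rw [← contMDiffOn_iff_contDiffOn, modelWithCornersSelf_prod, ← chartedSpaceSelf_prod]
  have h1 : ContMDiffOn (𝓘(ℝ, EuclideanSpace ℝ (Fin n)).prod 𝓘(ℝ, ℝ)) ((𝓡 n).prod 𝓘(ℝ, ℝ)) ∞
      (fun q : EuclideanSpace ℝ (Fin n) × ℝ => ((extChartAt (𝓡 n) c).symm q.1, q.2))
      ((extChartAt (𝓡 n) c).target ×ˢ J) :=
    ((contMDiffOn_extChartAt_symm (I := 𝓡 n) (n := ∞) c).comp contMDiffOn_fst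
      fun q hq => hq.1).prodMk contMDiffOn_snd
  exact hw.comp h1 fun q hq => ⟨mem_univ _, hq.2⟩

variable [RiemannianBundle (fun x : M => TangentSpace (𝓡 n) x)]

theorem SmoothFamily.hasDerivAt_grad {w : M → ℝ → ℝ} {J : Set ℝ} (hJ : IsOpen J)
    (hw : SmoothFamily n w J) {t : ℝ} (ht : t ∈ J) (x : M) :
    HasDerivAt (fun s => grad (n := n) (fun y => w y s) x)
      (grad (n := n) (fun y => deriv (w y) t) x) t := by
  -- The coordinate formulas live at the image of z under the inverse chart. There the frame and the
  -- inverse metric do not depend on time, and only partial derivatives have to be differentiated.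
  have key : ∀ z ∈ (extChartAt (𝓡 n) x).target,
      HasDerivAt (fun s => grad (n := n) (fun y => w y s) ((extChartAt (𝓡 n) x).symm z))
      (grad (n := n) (fun y => deriv (w y) t) ((extChartAt (𝓡 n) x).symm z)) t := by
    intro z hz
    have e1 : ∀ s ∈ J, grad (n := n) (fun y => w y s) ((extChartAt (𝓡 n) x).symm z) =
        ∑ i, (∑ j, (gram x z)⁻¹ i j *
          partialDeriv j (fun y => w ((extChartAt (𝓡 n) x).symm y) s) z) • coordVec x z i := by
      intro s hs
      rw [eq_sum_coordComp (grad (n := n) fun y => w y s) hz]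
      refine Finset.sum_congr rfl fun i _ => ?_
      rw [coordComp_grad hz ((hw.contMDiff hs).mdifferentiable (by simp) _)]
      rfl
    have e2 : grad (n := n) (fun y => deriv (w y) t) ((extChartAt (𝓡 n) x).symm z) =
        ∑ i, (∑ j, (gram x z)⁻¹ i j *
          partialDeriv j (fun y => deriv (w ((extChartAt (𝓡 n) x).symm y)) t) z) •
            coordVec x z i := by
      rw [eq_sum_coordComp (grad (n := n) fun y => deriv (w y) t) hz]
      refine Finset.sum_congr rfl fun i _ => ?_
      rw [coordComp_grad hz (((hw.timeDeriv hJ).contMDiff ht).mdifferentiable (by simp) _)]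
      rfl
    have h1 : HasDerivAt (fun s => ∑ i, (∑ j, (gram x z)⁻¹ i j *
          partialDeriv j (fun y => w ((extChartAt (𝓡 n) x).symm y) s) z) • coordVec x z i)
        (∑ i, (∑ j, (gram x z)⁻¹ i j *
          partialDeriv j (fun y => deriv (w ((extChartAt (𝓡 n) x).symm y)) t) z) •
            coordVec x z i) t :=
      HasDerivAt.fun_sum fun i _ => HasDerivAt.smul_const (HasDerivAt.fun_sum fun j _ =>
        (hasDerivAt_partialDeriv (isOpen_extChartAt_target x) hJ (hw x) hz ht j).const_mul _) _
    rw [e2]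
    refine h1.congr_of_eventuallyEq ?_
    filter_upwards [hJ.mem_nhds ht] with s hs using e1 s hs
  have h := key _ (mem_extChartAt_target x)
  rwa [extChartAt_to_inv] at h

variable [IsContMDiffRiemannianBundle (𝓡 n) ∞ (EuclideanSpace ℝ (Fin n))
      (fun x : M => TangentSpace (𝓡 n) x)]

theorem SmoothFamily.continuousOn_inner_grad {w v : M → ℝ → ℝ} {J : Set ℝ} (hJ : UniqueDiffOn ℝ J)
    (hw : SmoothFamily n w J) (hv : SmoothFamily n v J) :
    ContinuousOn (fun q : M × ℝ => inner ℝ (grad (n := n) (fun y => w y q.2) q.1)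
      (grad (n := n) (fun y => v y q.2) q.1)) (univ ×ˢ J) := by
  rintro ⟨x, t⟩ ⟨-, ht⟩
  have hT := isOpen_extChartAt_target (I := 𝓡 n) x
  have h1 : ContinuousOn (fun q : M × ℝ => (extChartAt (𝓡 n) x q.1, q.2))
      ((extChartAt (𝓡 n) x).source ×ˢ J) :=
    ((continuousOn_extChartAt x).comp continuousOn_fst fun q hq => hq.1).prodMk continuousOn_snd
  have h2 : ContinuousOn (fun q : EuclideanSpace ℝ (Fin n) × ℝ =>
      ∑ i, (∑ j, (gram x q.1)⁻¹ i j *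
        partialDeriv j (fun y => v ((extChartAt (𝓡 n) x).symm y) q.2) q.1) *
        partialDeriv i (fun y => w ((extChartAt (𝓡 n) x).symm y) q.2) q.1)
      ((extChartAt (𝓡 n) x).target ×ˢ J) := by
    refine continuousOn_finsetSum _ fun i _ => ContinuousOn.mul
      (continuousOn_finsetSum _ fun j _ => ContinuousOn.mul ?_ ?_) ?_
    · exact (gram_inv_contDiffOn x i j).continuousOn.comp continuousOn_fst fun q hq => hq.1
    · exact continuousOn_partialDeriv_slice hT hJ (hv x) j
    · exact continuousOn_partialDeriv_slice hT hJ (hw x) i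
  have h3 := h2.comp h1 fun q hq => ⟨(extChartAt (𝓡 n) x).map_source hq.1, hq.2⟩
  have h4 : ContinuousOn (fun q : M × ℝ => inner ℝ (grad (n := n) (fun y => w y q.2) q.1)
      (grad (n := n) (fun y => v y q.2) q.1)) ((extChartAt (𝓡 n) x).source ×ˢ J) := by
    refine h3.congr fun q hq => ?_
    have hz := (extChartAt (𝓡 n) x).map_source hq.1
    have hwd := (hw.contMDiff hq.2).mdifferentiable (by simp)
    have hvd := (hv.contMDiff hq.2).mdifferentiable (by simp)
    have h5 := inner_grad_grad (v := fun y => v y q.2) hz (hwd ((extChartAt (𝓡 n) x).symm (extChartAt (𝓡 n) x q.1)))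
    rw [(extChartAt (𝓡 n) x).left_inv hq.1] at h5
    rw [h5]
    refine Finset.sum_congr rfl fun i _ => ?_
    rw [coordComp_grad hz (hvd _)]
    rfl
  refine (h4 (x, t) ⟨mem_extChartAt_source x, ht⟩).mono_of_mem_nhdsWithin ?_
  rw [nhdsWithin_prod_eq]
  exact Filter.prod_mem_prod (mem_nhdsWithin_of_mem_nhds (extChartAt_source_mem_nhds x))
    self_mem_nhdsWithin

theorem continuousOn_gradNorm {m : ℕ} {u : M → ℝ → EuclideanSpace ℝ (Fin m)} {J : Set ℝ}
    (hJ : UniqueDiffOn ℝ J) (hu : ∀ k, SmoothFamily n (fun x t => u x t k) J) :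
    ContinuousOn (fun q : M × ℝ => gradNorm n (fun y => u y q.2) q.1) (univ ×ˢ J) := by
  refine ContinuousOn.sqrt (continuousOn_finsetSum _ fun k _ => ?_)
  exact ((hu k).continuousOn_inner_grad hJ (hu k)).congr fun q _ =>
    (real_inner_self_eq_norm_sq _).symm

end TimeDependent

end PFreq

namespace PFreq

/-! ### Integrals depending on time over a compact space. -/

section ParametricIntegral

variable {M : Type*} [TopologicalSpace M] [CompactSpace M] [MeasurableSpace M] [BorelSpace M]
  {μ : Measure M} [IsFiniteMeasure μ]

theorem continuousOn_integral_of_continuousOn {F : M → ℝ → ℝ} {J : Set ℝ}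
    (hF : ContinuousOn (fun q : M × ℝ => F q.1 q.2) (univ ×ˢ J)) :
    ContinuousOn (fun t => ∫ x, F x t ∂μ) J :=
  continuousOn_integral_of_compact_support isCompact_univ
    (hF.comp (f := fun q : ℝ × M => (q.2, q.1)) (by fun_prop) fun _ hq => ⟨mem_univ _, hq.1⟩)
    fun _ x _ hx => (hx (mem_univ x)).elim

theorem continuous_slice {F : M → ℝ → ℝ} {J : Set ℝ}
    (hF : ContinuousOn (fun q : M × ℝ => F q.1 q.2) (univ ×ˢ J)) {t : ℝ} (ht : t ∈ J) :
    Continuous fun x => F x t :=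
  continuousOn_univ.1 (hF.comp (f := fun x => (x, t)) (by fun_prop) fun _ _ => ⟨mem_univ _, ht⟩)

/-- Differentiation under the integral over a compact space, with a continuous bound. -/
theorem hasDerivAt_integral_of_continuousOn {F F' B : M → ℝ → ℝ} {J : Set ℝ} (hJ : IsOpen J)
    (hF : ContinuousOn (fun q : M × ℝ => F q.1 q.2) (univ ×ˢ J))
    (hder : ∀ x, ∀ t ∈ J, HasDerivAt (F x) (F' x t) t)
    (hB : ContinuousOn (fun q : M × ℝ => B q.1 q.2) (univ ×ˢ J))
    (hle : ∀ x, ∀ t ∈ J, |F' x t| ≤ B x t) {t : ℝ} (ht : t ∈ J)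
    (hm : AEStronglyMeasurable (fun x => F' x t) μ) :
    HasDerivAt (fun t => ∫ x, F x t ∂μ) (∫ x, F' x t ∂μ) t := by
  -- A constant bound comes from compactness of M × [t - r, t + r]. Only B has to be continuous: the
  -- later choices of F' contain the exponent p - 2, which may be negative, those of B only p - 1.
  obtain ⟨r, hr, hball⟩ := Metric.nhds_basis_closedBall.mem_iff.1 (hJ.mem_nhds ht)
  have hK : IsCompact ((univ : Set M) ×ˢ Metric.closedBall t r) :=
    isCompact_univ.prod (isCompact_closedBall t r)
  obtain ⟨C, hC⟩ := hK.bddAbove_image (hB.mono (prod_mono_right hball))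
  have hint : Integrable (fun x => F x t) μ :=
    Continuous.integrable_of_hasCompactSupport (continuous_slice hF ht)
      (HasCompactSupport.of_compactSpace _)
  refine (hasDerivAt_integral_of_dominated_loc_of_deriv_le (μ := μ) (F := fun t x => F x t)
    (F' := fun t x => F' x t) (bound := fun _ => C) (Metric.closedBall_mem_nhds t hr) ?_ hint hm
    (ae_of_all _ fun x s hs => ?_) (integrable_const C)
    (ae_of_all _ fun x s hs => hder x s (hball hs))).2
  · filter_upwards [hJ.mem_nhds ht] with s hs
    exact (Continuous.integrable_of_hasCompactSupport (continuous_slice hF hs)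
      (HasCompactSupport.of_compactSpace _)).aestronglyMeasurable
  · exact (hle x s (hball hs)).trans (hC ⟨(x, s), ⟨mem_univ _, hs⟩, rfl⟩)

end ParametricIntegral

/-! ### Differential inequalities and equations in one variable. -/

section RealAnalysis

/-- Gronwall: e^{Kt} y(t) is nondecreasing. -/
theorem pos_of_deriv_ge {a b K : ℝ} {y y' : ℝ → ℝ} (hc : ContinuousOn y (Icc a b))
    (hd : ∀ t ∈ Ioo a b, HasDerivAt y (y' t) t) (hle : ∀ t ∈ Ioo a b, -K * y t ≤ y' t)
    (hab : a ≤ b) (ha : 0 < y a) : 0 < y b := by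
  have hmono : MonotoneOn (fun t => Real.exp (K * t) * y t) (Icc a b) := by
    refine monotoneOn_of_hasDerivWithinAt_nonneg (convex_Icc a b)
      (f' := fun t => Real.exp (K * t) * (K * y t + y' t))
      (ContinuousOn.mul (by fun_prop) hc) ?_ ?_
    · intro t ht
      rw [interior_Icc] at ht
      have h1 : HasDerivAt (fun t => Real.exp (K * t)) (Real.exp (K * t) * K) t := by
        simpa using ((hasDerivAt_id t).const_mul K).exp
      refine ((h1.mul (hd t ht)).congr_deriv ?_).hasDerivWithinAt
      ring
    · intro t ht
      rw [interior_Icc] at ht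
      exact mul_nonneg (Real.exp_pos _).le (by linarith [hle t ht])
  have h := hmono (left_mem_Icc.2 hab) (right_mem_Icc.2 hab) hab
  have h2 : 0 < Real.exp (K * b) * y b := lt_of_lt_of_le (mul_pos (Real.exp_pos _) ha) h
  exact (pos_iff_pos_of_mul_pos h2).1 (Real.exp_pos _)

section Frequency

variable {a b p : ℝ} {I D D' η : ℝ → ℝ}

theorem hasDerivAt_div_freq {t : ℝ} (hI : HasDerivAt I (p * (D t + η t * I t)) t)
    (hD : HasDerivAt D (D' t) t) (hpos : 0 < I t) :
    HasDerivAt (fun t => D t / I t)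
      ((D' t * I t - D t * (p * (D t + η t * I t))) / I t ^ 2) t := hD.div hI hpos.ne'

/-- The inequality assumed is the sign of the numerator in the quotient rule. The interval is kept
general because `mass_pos` needs a half-open one, ending at a hypothetical zero of I. -/
theorem monotoneOn_div_of_pos {J : Set ℝ} (hJ : Convex ℝ J) (hIc : ContinuousOn I J)
    (hDc : ContinuousOn D J) (hpos : ∀ t ∈ J, 0 < I t)
    (hI : ∀ t ∈ interior J, HasDerivAt I (p * (D t + η t * I t)) t)
    (hD : ∀ t ∈ interior J, HasDerivAt D (D' t) t)
    (hCS : ∀ t ∈ interior J, 0 < I t → 0 ≤ D' t * I t - D t * (p * (D t + η t * I t))) :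
    MonotoneOn (fun t => D t / I t) J :=
  monotoneOn_of_hasDerivWithinAt_nonneg hJ (hDc.div hIc fun t ht => (hpos t ht).ne')
    (fun t ht => (hasDerivAt_div_freq (hI t ht) (hD t ht)
      (hpos t (interior_subset ht))).hasDerivWithinAt)
    (fun t ht => div_nonneg (hCS t ht (hpos t (interior_subset ht))) (sq_nonneg _))

/-- Unique continuation in time: if the mass is positive at some time, then it is positive at all
times. -/
theorem mass_pos (hp : 0 < p) (hIc : ContinuousOn I (Icc a b)) (hDc : ContinuousOn D (Icc a b))
    (hη : ContinuousOn η (Icc a b)) (hI0 : ∀ t, 0 ≤ I t) (hD0 : ∀ t, D t ≤ 0)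
    (hI : ∀ t ∈ Ioo a b, HasDerivAt I (p * (D t + η t * I t)) t)
    (hD : ∀ t ∈ Ioo a b, HasDerivAt D (D' t) t)
    (hCS : ∀ t ∈ Ioo a b, 0 < I t → 0 ≤ D' t * I t - D t * (p * (D t + η t * I t)))
    (hne : ∃ t ∈ Icc a b, 0 < I t) : ∀ t ∈ Icc a b, 0 < I t := by
  obtain ⟨t₀, ht₀, hpos⟩ := hne
  obtain ⟨C, hC⟩ := isCompact_Icc.exists_bound_of_continuousOn hη
  simp only [Real.norm_eq_abs] at hC
  -- Since D ≤ 0 and |η| ≤ C, I' ≤ pCI; Gronwall is applied to the time-reversed function.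
  have hback : ∀ s ∈ Icc a b, ∀ t ∈ Icc a b, s ≤ t → 0 < I t → 0 < I s := by
    intro s hs t ht hst hIt
    have hmem : ∀ r ∈ Ioo (-t) (-s), -r ∈ Ioo a b := fun r hr =>
      ⟨by linarith [hs.1, hr.2], by linarith [ht.2, hr.1]⟩
    have h := pos_of_deriv_ge (a := -t) (b := -s) (K := p * C) (y := fun r => I (-r))
      (y' := fun r => -(p * (D (-r) + η (-r) * I (-r))))
      (hIc.comp (by fun_prop) fun r hr =>
        ⟨by linarith [hs.1, hr.2], by linarith [ht.2, hr.1]⟩)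
      (fun r hr => by
        have := (hI (-r) (hmem r hr)).comp r (hasDerivAt_neg r)
        exact this.congr_deriv (by ring))
      (fun r hr => by
        have h1 := hmem r hr
        have h2 := mul_nonneg (sub_nonneg.2 ((le_abs_self _).trans (hC _ (Ioo_subset_Icc_self h1))))
          (mul_nonneg hp.le (hI0 (-r)))
        have h3 := mul_nonneg hp.le (neg_nonneg.2 (hD0 (-r)))
        nlinarith)
      (neg_le_neg hst) (by simpa using hIt)
    simpa using h
  intro t ht
  by_contra hcon
  have hIt : I t = 0 := le_antisymm (not_lt.1 hcon) (hI0 t)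
  have htt : t₀ < t := by
    by_contra hle
    exact hcon (hback t ht t₀ ht₀ (not_lt.1 hle) hpos)
  have hsub : Icc t₀ b ⊆ Icc a b := Icc_subset_Icc_left ht₀.1
  have hK : IsCompact (Icc t₀ b ∩ I ⁻¹' {0}) :=
    isCompact_Icc.of_isClosed_subset
      ((hIc.mono hsub).preimage_isClosed_of_isClosed isClosed_Icc isClosed_singleton)
      inter_subset_left
  -- The first zero of I after t₀; before it the quotient D/I is defined and monotone.
  obtain ⟨t₁, ⟨ht₁, hIt₁⟩, hmin⟩ := hK.exists_isLeast ⟨t, ⟨htt.le, ht.2⟩, hIt⟩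
  have hIt₁' : I t₁ = 0 := hIt₁
  have hlt : t₀ < t₁ := lt_of_le_of_ne ht₁.1 fun h => by rw [h, hIt₁'] at hpos; exact hpos.false
  have hposJ : ∀ s ∈ Ico t₀ t₁, 0 < I s := by
    intro s hs
    refine lt_of_le_of_ne (hI0 s) fun h => ?_
    exact absurd (hmin ⟨⟨hs.1, hs.2.le.trans ht₁.2⟩, h.symm⟩) (not_le.2 hs.2)
  have hsubJ : Ico t₀ t₁ ⊆ Icc a b := fun s hs => ⟨ht₀.1.trans hs.1, hs.2.le.trans ht₁.2⟩
  have hintJ : Ioo t₀ t₁ ⊆ Ioo a b := Ioo_subset_Ioo ht₀.1 ht₁.2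
  have hmono := monotoneOn_div_of_pos (p := p) (η := η) (D' := D') (convex_Ico t₀ t₁)
    (hIc.mono hsubJ) (hDc.mono hsubJ) hposJ
    (fun s hs => hI s (hintJ (by rwa [interior_Ico] at hs)))
    (fun s hs => hD s (hintJ (by rwa [interior_Ico] at hs)))
    (fun s hs => hCS s (hintJ (by rwa [interior_Ico] at hs)))
  -- Monotonicity gives D ≥ (D(t₀)/I(t₀)) I, and η ≥ -C, so I' ≥ -K I with this K, and I cannot
  -- vanish at t₁.
  have hfin := pos_of_deriv_ge (a := t₀) (b := t₁) (K := p * (C - D t₀ / I t₀)) (y := I)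
    (y' := fun t => p * (D t + η t * I t))
    (hIc.mono ((Icc_subset_Icc_right ht₁.2).trans hsub)) (fun s hs => hI s (hintJ hs))
    (fun s hs => by
      have hs' : s ∈ Ico t₀ t₁ := ⟨hs.1.le, hs.2⟩
      have h1 : D t₀ / I t₀ ≤ D s / I s := hmono ⟨le_rfl, hlt⟩ hs' hs.1.le
      rw [le_div_iff₀ (hposJ s hs')] at h1
      have h2 : -C ≤ η s := (abs_le.1 (hC s (hsubJ hs'))).1
      have h3 := mul_le_mul_of_nonneg_right h2 (hI0 s)
      have h4 := mul_le_mul_of_nonneg_left (add_le_add h1 h3) hp.le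
      linarith) hlt.le hpos
  rw [hIt₁'] at hfin
  exact hfin.false

/-- The derivative of log I is p(D/I + η), a sum of nondecreasing functions. -/
theorem convexOn_log_mass (hIc : ContinuousOn I (Icc a b)) (hp : 0 ≤ p)
    (hpos : ∀ t ∈ Icc a b, 0 < I t)
    (hI : ∀ t ∈ Ioo a b, HasDerivAt I (p * (D t + η t * I t)) t)
    (hU : MonotoneOn (fun t => D t / I t) (Icc a b)) (hη : MonotoneOn η (Icc a b)) :
    ConvexOn ℝ (Icc a b) (fun t => Real.log (I t)) := by
  have hd : ∀ t ∈ Ioo a b, HasDerivAt (fun t => Real.log (I t)) (p * (D t / I t + η t)) t := by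
    intro t ht
    have h0 := (hpos t (Ioo_subset_Icc_self ht)).ne'
    refine ((hI t ht).log h0).congr_deriv ?_
    field_simp
  refine MonotoneOn.convexOn_of_deriv (convex_Icc a b) (hIc.log fun t ht => (hpos t ht).ne') ?_ ?_
  · rw [interior_Icc]
    exact fun t ht => (hd t ht).differentiableAt.differentiableWithinAt
  · rw [interior_Icc]
    intro s hs t ht hst
    rw [(hd s hs).deriv, (hd t ht).deriv]
    have hs' := Ioo_subset_Icc_self hs
    have ht' := Ioo_subset_Icc_self ht
    exact mul_le_mul_of_nonneg_left (add_le_add (hU hs' ht' hst) (hη hs' ht' hst)) hp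

end Frequency

theorem eq_left_of_hasDerivAt_zero {G : Type*} [NormedAddCommGroup G] [NormedSpace ℝ G] {a b : ℝ}
    {g : ℝ → G} (hg : ContinuousOn g (Icc a b)) (hd : ∀ t ∈ Ioo a b, HasDerivAt g 0 t) :
    ∀ t ∈ Icc a b, g t = g a := by
  intro t ht
  rcases eq_or_ne a b with rfl | hab
  · rw [le_antisymm ht.2 ht.1]
  have hab' : a < b := lt_of_le_of_ne (ht.1.trans ht.2) hab
  obtain ⟨c, hc⟩ := exists_between hab'
  have h1 : EqOn g (fun _ => g c) (Ioo a b) := fun s hs =>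
    (convex_Ioo a b).is_const_of_fderivWithin_eq_zero (𝕜 := ℝ)
      (fun r hr => (hd r hr).differentiableAt.differentiableWithinAt)
      (fun r hr => by
        rw [fderivWithin_of_isOpen isOpen_Ioo hr]
        ext
        simp [(hd r hr).deriv]) hs hc
  have h2 := h1.of_subset_closure hg continuousOn_const Ioo_subset_Icc_self
    (closure_Ioo hab).ge
  rw [h2 ht, h2 (left_mem_Icc.2 hab'.le)]

/-- A curve with `φ' = k φ` wherever `φ ≠ 0` is a solution of the linear equation. -/
theorem eq_exp_integral_smul {F : Type*} [NormedAddCommGroup F] [InnerProductSpace ℝ F] {a b : ℝ}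
    {φ φ' : ℝ → F} {k : ℝ → ℝ} (hφ : ContinuousOn φ (Icc a b))
    (hd : ∀ t ∈ Ioo a b, HasDerivAt φ (φ' t) t) (hk : ContinuousOn k (Icc a b))
    (heq : ∀ t ∈ Ioo a b, φ t ≠ 0 → φ' t = k t • φ t) :
    ∀ t ∈ Icc a b, φ t = Real.exp (∫ s in a..t, k s) • φ a := by
  rcases lt_or_ge b a with hba | hab
  · intro t ht
    exact absurd (ht.1.trans ht.2) (not_le.2 hba)
  set H : ℝ → ℝ := fun t => ∫ s in a..t, k s with hH
  have hHc : ContinuousOn H (Icc a b) := by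
    have h := intervalIntegral.continuousOn_primitive_interval (μ := volume) (f := k) (a := a) (b := b)
      (by rw [uIcc_of_le hab]; exact hk.integrableOn_Icc)
    rwa [uIcc_of_le hab] at h
  have hHd : ∀ t ∈ Ioo a b, HasDerivAt H (k t) t := by
    intro t ht
    have hmem : Icc a b ∈ nhds t := Icc_mem_nhds ht.1 ht.2
    have hsub : Icc a t ⊆ Icc a b := Icc_subset_Icc_right ht.2.le
    refine intervalIntegral.integral_hasDerivAt_right
      ((hk.mono hsub).intervalIntegrable_of_Icc ht.1.le) ?_ (hk.continuousAt hmem)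
    exact hk.stronglyMeasurableAtFilter_nhdsWithin measurableSet_Icc t |>.filter_mono
      (by rw [nhdsWithin_eq_nhds.2 hmem])
  have hE : ∀ (c : ℝ), ∀ t ∈ Ioo a b,
      HasDerivAt (fun t => Real.exp (c * H t)) (Real.exp (c * H t) * (c * k t)) t := fun c t ht =>
    ((hHd t ht).const_mul c).exp
  have hEc : ∀ c : ℝ, ContinuousOn (fun t => Real.exp (c * H t)) (Icc a b) := fun c =>
    (continuousOn_const.mul hHc).rexp
  have hHa : H a = 0 := intervalIntegral.integral_same
  -- The derivative of ‖φ‖² is 2⟨φ, φ'⟩, which vanishes at zeros of φ although φ' is unknown there.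
  -- So this quantity is constant and φ vanishes either always or never; in the second case the
  -- equation holds throughout the interior.
  have hnorm := eq_left_of_hasDerivAt_zero (g := fun t => Real.exp (-2 * H t) * ‖φ t‖ ^ 2)
    ((hEc (-2)).mul (hφ.norm.pow 2)) (by
      intro t ht
      refine ((hE (-2) t ht).mul (hd t ht).norm_sq).congr_deriv ?_
      by_cases h0 : φ t = 0
      · simp [h0]
      · rw [heq t ht h0, inner_smul_right, real_inner_self_eq_norm_sq]
        ring)
  intro t ht
  have h1 := hnorm t ht
  simp only [hHa, mul_zero, Real.exp_zero, one_mul] at h1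
  by_cases ha : φ a = 0
  · rw [ha, norm_zero] at h1
    have h2 : φ t = 0 := by
      simpa [(Real.exp_pos _).ne'] using h1
    rw [h2, ha, smul_zero]
  · have hne : ∀ s ∈ Icc a b, φ s ≠ 0 := by
      intro s hs h0
      have h2 := hnorm s hs
      simp only [hHa, mul_zero, Real.exp_zero, one_mul, h0, norm_zero] at h2
      exact ha (by simpa using h2.symm)
    have h3 := eq_left_of_hasDerivAt_zero (g := fun t => Real.exp (-1 * H t) • φ t) ((hEc (-1)).smul hφ) (by
      intro s hs
      refine ((hE (-1) s hs).smul (hd s hs)).congr_deriv ?_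
      rw [heq s hs (hne s (Ioo_subset_Icc_self hs)), smul_smul, ← add_smul]
      simp) t ht
    simp only [hHa, mul_zero, Real.exp_zero, one_smul] at h3
    rw [← h3, smul_smul, ← Real.exp_add]
    simp [hH]

end RealAnalysis

/-! ### The map y ↦ |y|^{p-2} y. -/

section PowerMap

variable {F : Type*} [NormedAddCommGroup F] [InnerProductSpace ℝ F]

theorem norm_rpow_smul_norm {p : ℝ} (hp : 1 < p) (y : F) :
    ‖‖y‖ ^ (p - 2) • y‖ = ‖y‖ ^ (p - 1) := by
  rw [norm_smul, Real.norm_of_nonneg (Real.rpow_nonneg (norm_nonneg y) _)]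
  rcases eq_or_ne y 0 with rfl | hy
  · rw [norm_zero, mul_zero, Real.zero_rpow (by linarith)]
  · rw [← Real.rpow_add_one (norm_ne_zero_iff.2 hy)]
    congr 1
    ring

/-- Only the origin needs an argument: the exponent p - 2 may be negative, but the norm of the value
is ‖y‖^{p-1}, which tends to 0. -/
theorem continuous_rpow_smul {p : ℝ} (hp : 1 < p) :
    Continuous fun y : F => ‖y‖ ^ (p - 2) • y := by
  refine continuous_iff_continuousAt.2 fun y => ?_
  rcases eq_or_ne y 0 with rfl | hy
  · rw [ContinuousAt, smul_zero]
    refine squeeze_zero_norm (fun y => (norm_rpow_smul_norm hp y).le) ?_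
    have h : ContinuousAt (fun y : F => ‖y‖ ^ (p - 1)) 0 :=
      continuousAt_id.norm.rpow_const (Or.inr (by linarith))
    have h2 := h.tendsto
    rwa [norm_zero, Real.zero_rpow (by linarith)] at h2
  · exact (continuousAt_id.norm.rpow_const (Or.inl (norm_ne_zero_iff.2 hy))).smul continuousAt_id

theorem rpow_smul_smul {p : ℝ} {c : ℝ} (hc : 0 < c) (y : F) :
    ‖c • y‖ ^ (p - 2) • (c • y) = c ^ (p - 1) • (‖y‖ ^ (p - 2) • y) := by
  rw [norm_smul, Real.norm_of_nonneg hc.le, Real.mul_rpow hc.le (norm_nonneg y), smul_smul, smul_smul]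
  congr 1
  rw [show p - 1 = p - 2 + 1 by ring, Real.rpow_add_one hc.ne']
  ring

theorem rpow_mul_norm_sq {p : ℝ} (hp : 0 < p) (y : F) : ‖y‖ ^ (p - 2) * ‖y‖ ^ 2 = ‖y‖ ^ p := by
  rcases eq_or_ne y 0 with rfl | hy
  · simp [Real.zero_rpow hp.ne']
  · rw [← Real.rpow_natCast, ← Real.rpow_add (norm_pos_iff.2 hy)]
    congr 1
    norm_num

end PowerMap

end PFreq

namespace PFreq

/-! ### Derivatives of p-th powers of norms. -/

section EuclideanNorm

variable {F : Type*} [NormedAddCommGroup F] [InnerProductSpace ℝ F] {m : ℕ}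

theorem hasDerivAt_norm_rpow_comp {p : ℝ} (hp : 1 < p) {y : ℝ → F} {y' : F} {t : ℝ}
    (h : HasDerivAt y y' t) :
    HasDerivAt (fun s => ‖y s‖ ^ p) (p * ‖y t‖ ^ (p - 2) * inner ℝ (y t) y') t := by
  have h1 := (hasFDerivAt_norm_rpow (y t) hp).comp_hasDerivAt t h
  refine h1.congr_deriv ?_
  simp

theorem abs_norm_rpow_deriv_le {p : ℝ} (hp : 1 < p) (y y' : F) :
    |p * ‖y‖ ^ (p - 2) * inner ℝ y y'| ≤ p * ‖y‖ ^ (p - 1) * ‖y'‖ := by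
  rw [abs_mul, abs_mul, abs_of_pos (by linarith : 0 < p),
    abs_of_nonneg (Real.rpow_nonneg (norm_nonneg y) _), ← norm_rpow_smul_norm hp y, norm_smul,
    Real.norm_of_nonneg (Real.rpow_nonneg (norm_nonneg y) _), mul_assoc, mul_assoc, mul_assoc]
  refine mul_le_mul_of_nonneg_left (mul_le_mul_of_nonneg_left (abs_real_inner_le_norm _ _)
    (Real.rpow_nonneg (norm_nonneg y) _)) (by linarith)

theorem norm_toLp_eq_sqrt (G : Fin m → F) :
    ‖(WithLp.toLp 2 G : PiLp 2 fun _ : Fin m => F)‖ = Real.sqrt (∑ k, ‖G k‖ ^ 2) := by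
  rw [PiLp.norm_eq_of_L2]

/-- The vectors are collected into one element of an ℓ² product, so that |∇u|^p becomes a power of a
single Hilbert norm, differentiable also at 0 because p > 1. -/
theorem hasDerivAt_sqrt_rpow {p : ℝ} (hp : 1 < p) {G : Fin m → ℝ → F} {G' : Fin m → F} {t : ℝ}
    (h : ∀ k, HasDerivAt (G k) (G' k) t) :
    HasDerivAt (fun s => Real.sqrt (∑ k, ‖G k s‖ ^ 2) ^ p)
      (p * Real.sqrt (∑ k, ‖G k t‖ ^ 2) ^ (p - 2) * ∑ k, inner ℝ (G k t) (G' k)) t := by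
  have h1 : HasDerivAt (fun s => (WithLp.toLp 2 (fun k => G k s) : PiLp 2 fun _ : Fin m => F))
      (WithLp.toLp 2 G') t :=
    ((PiLp.continuousLinearEquiv 2 ℝ fun _ : Fin m => F).symm.hasFDerivAt).comp_hasDerivAt t
      (hasDerivAt_pi.2 h)
  have h2 := hasDerivAt_norm_rpow_comp hp h1
  simp only [norm_toLp_eq_sqrt, PiLp.inner_apply] at h2
  exact h2

theorem abs_sqrt_rpow_deriv_le {p : ℝ} (hp : 1 < p) (G G' : Fin m → F) :
    |p * Real.sqrt (∑ k, ‖G k‖ ^ 2) ^ (p - 2) * ∑ k, inner ℝ (G k) (G' k)| ≤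
      p * Real.sqrt (∑ k, ‖G k‖ ^ 2) ^ (p - 1) * Real.sqrt (∑ k, ‖G' k‖ ^ 2) := by
  have h := abs_norm_rpow_deriv_le hp (WithLp.toLp 2 G : PiLp 2 fun _ : Fin m => F)
    (WithLp.toLp 2 G')
  simpa only [norm_toLp_eq_sqrt, PiLp.inner_apply] using h

end EuclideanNorm

/-! ### Green's formula and the time derivatives of mass and energy. -/

section Evolution

variable {n m : ℕ} {M : Type*} [TopologicalSpace M] [T2Space M] [CompactSpace M]
    [ChartedSpace (EuclideanSpace ℝ (Fin n)) M] [IsManifold (𝓡 n) ∞ M]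
    [RiemannianBundle (fun x : M => TangentSpace (𝓡 n) x)]
    [IsContMDiffRiemannianBundle (𝓡 n) ∞ (EuclideanSpace ℝ (Fin n))
      (fun x : M => TangentSpace (𝓡 n) x)]
    [MeasurableSpace M] [BorelSpace M]

theorem continuous_pLaplacian {f : M → ℝ} (hf : ContMDiff (𝓡 n) 𝓘(ℝ, ℝ) 1 f) {p : ℝ}
    {u : M → EuclideanSpace ℝ (Fin m)} (hX : ∀ k, IsC1Field (pFlux (n := n) p u k)) :
    Continuous (pLaplacian n f p u) :=
  (PiLp.continuous_toLp 2 _).comp (continuous_pi fun k => continuous_weightedDiv hf (hX k))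

theorem dirDeriv_pFlux (p : ℝ) (u : M → EuclideanSpace ℝ (Fin m)) (k : Fin m) (w : M → ℝ) (x : M) :
    dirDeriv w (pFlux (n := n) p u k) x = gradNorm n u x ^ (p - 2) *
      inner ℝ (grad (n := n) (fun y => u y k) x) (grad (n := n) w x) := by
  rw [real_inner_comm, ← dirDeriv_grad w (fun y => u y k) x]
  exact dirDeriv_smul w _ _ x

/-- Green's formula for the weighted `p`-Laplacian. -/
theorem integral_inner_pLaplacian {f : M → ℝ} (hf : ContMDiff (𝓡 n) 𝓘(ℝ, ℝ) 1 f) {p : ℝ}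
    {u w : M → EuclideanSpace ℝ (Fin m)} (hX : ∀ k, IsC1Field (pFlux (n := n) p u k))
    (hw : ∀ k, ContMDiff (𝓡 n) 𝓘(ℝ, ℝ) 1 (fun x => w x k)) :
    ∫ x, gradNorm n u x ^ (p - 2) * ∑ k, inner ℝ (grad (n := n) (fun y => u y k) x)
        (grad (n := n) (fun y => w y k) x) ∂(weightedVolume n f) =
      -∫ x, inner ℝ (w x) (pLaplacian n f p u x) ∂(weightedVolume n f) := by
  have := isFiniteMeasure_weightedVolume (n := n) hf.continuous
  have i1 : ∀ k, Integrable (dirDeriv (fun x => w x k) (pFlux (n := n) p u k))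
      (weightedVolume n f) := fun k => (continuous_dirDeriv (hw k) (hX k)).integrable_of_hasCompactSupport
    (HasCompactSupport.of_compactSpace _)
  have i2 : ∀ k, Integrable (fun x => w x k * weightedDiv f (pFlux (n := n) p u k) x)
      (weightedVolume n f) := fun k => ((hw k).continuous.mul
    (continuous_weightedDiv hf (hX k))).integrable_of_hasCompactSupport
    (HasCompactSupport.of_compactSpace _)
  calc _ = ∫ x, ∑ k, dirDeriv (fun x => w x k) (pFlux (n := n) p u k) x ∂(weightedVolume n f) := by
        refine integral_congr_ae (ae_of_all _ fun x => ?_)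
        simp only [dirDeriv_pFlux, Finset.mul_sum]
    _ = -∑ k, ∫ x, w x k * weightedDiv f (pFlux (n := n) p u k) x ∂(weightedVolume n f) := by
        rw [integral_finsetSum _ fun k _ => i1 k, ← Finset.sum_neg_distrib]
        exact Finset.sum_congr rfl fun k _ => integral_dirDeriv_weighted hf (hX k) (hw k)
    _ = _ := by
        rw [← integral_finsetSum _ fun k _ => i2 k]
        congr 1
        refine integral_congr_ae (ae_of_all _ fun x => ?_)
        simp only [PiLp.inner_apply, pLaplacian, RCLike.inner_apply, conj_trivial]
        exact Finset.sum_congr rfl fun k _ => mul_comm _ _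

theorem energyD_eq {f : M → ℝ} (hf : ContMDiff (𝓡 n) 𝓘(ℝ, ℝ) 1 f) {p : ℝ} (hp : 0 < p)
    {u : M → ℝ → EuclideanSpace ℝ (Fin m)} {t : ℝ}
    (hX : ∀ k, IsC1Field (pFlux (n := n) p (fun y => u y t) k))
    (hu : ∀ k, ContMDiff (𝓡 n) 𝓘(ℝ, ℝ) 1 (fun x => u x t k)) :
    energyD n f p u t = ∫ x, inner ℝ (u x t) (pLaplacian n f p (fun y => u y t) x)
      ∂(weightedVolume n f) := by
  rw [energyD, neg_eq_iff_eq_neg, ← integral_inner_pLaplacian hf hX hu]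
  refine integral_congr_ae (ae_of_all _ fun x => ?_)
  simp only [real_inner_self_eq_norm_sq]
  rw [← sq_gradNorm]
  have h := rpow_mul_norm_sq hp (gradNorm n (fun y => u y t) x)
  rw [Real.norm_of_nonneg (gradNorm_nonneg _ _)] at h
  exact h.symm

variable {u : M → ℝ → EuclideanSpace ℝ (Fin m)} {J : Set ℝ}

theorem smoothFamily_component
    (hu : ContMDiffOn ((𝓡 n).prod 𝓘(ℝ, ℝ)) 𝓘(ℝ, EuclideanSpace ℝ (Fin m)) ∞
      (fun q : M × ℝ => u q.1 q.2) (univ ×ˢ J)) (k : Fin m) :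
    SmoothFamily n (fun x t => u x t k) J :=
  smoothFamily_of_contMDiffOn
    ((EuclideanSpace.proj k : EuclideanSpace ℝ (Fin m) →L[ℝ] ℝ).contMDiff.comp_contMDiffOn hu)

theorem hasDerivAt_of_components (hJ : IsOpen J)
    (hu : ∀ k, SmoothFamily n (fun x t => u x t k) J) {t : ℝ} (ht : t ∈ J) (x : M) :
    HasDerivAt (u x) (deriv (u x) t) t ∧
      ∀ k, (deriv (u x) t) k = deriv (fun s => u x s k) t := by
  have h1 : HasDerivAt (u x) (WithLp.toLp 2 fun k => deriv (fun s => u x s k) t) t :=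
    ((PiLp.continuousLinearEquiv 2 ℝ fun _ : Fin m => ℝ).symm.hasFDerivAt).comp_hasDerivAt t
      (hasDerivAt_pi.2 fun k => (hu k).hasDerivAt hJ ht x)
  refine ⟨h1.differentiableAt.hasDerivAt, fun k => ?_⟩
  rw [h1.deriv]

theorem continuousOn_of_components (hu : ∀ k, SmoothFamily n (fun x t => u x t k) J) :
    ContinuousOn (fun q : M × ℝ => u q.1 q.2) (univ ×ˢ J) :=
  (PiLp.continuous_toLp 2 fun _ : Fin m => ℝ).comp_continuousOn
    (continuousOn_pi.2 fun k => (hu k).continuousOn)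

theorem smoothFamily_deriv_component (hJ : IsOpen J)
    (hu : ∀ k, SmoothFamily n (fun x t => u x t k) J) (k : Fin m) :
    SmoothFamily n (fun x t => (deriv (u x) t) k) J := fun c =>
  ((hu k).timeDeriv hJ c).congr fun _ hq => (hasDerivAt_of_components hJ hu hq.2 _).2 k

theorem hasDerivAt_massI {f : M → ℝ} (hf : Continuous f) {p : ℝ} (hp : 1 < p) (hJ : IsOpen J)
    (hu : ∀ k, SmoothFamily n (fun x t => u x t k) J) {t : ℝ} (ht : t ∈ J) :
    HasDerivAt (massI n f p u) (∫ x, p * ‖u x t‖ ^ (p - 2) * inner ℝ (u x t) (deriv (u x) t)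
      ∂(weightedVolume n f)) t := by
  have := isFiniteMeasure_weightedVolume (n := n) hf
  have hc := continuousOn_of_components hu
  have hc' := continuousOn_of_components (smoothFamily_deriv_component hJ hu)
  refine hasDerivAt_integral_of_continuousOn (F := fun x t => ‖u x t‖ ^ p)
    (F' := fun x t => p * ‖u x t‖ ^ (p - 2) * inner ℝ (u x t) (deriv (u x) t))
    (B := fun x t => p * ‖u x t‖ ^ (p - 1) * ‖deriv (u x) t‖) hJ
    (hc.norm.rpow_const fun _ _ => Or.inr (by linarith))
    (fun x s hs => hasDerivAt_norm_rpow_comp hp (hasDerivAt_of_components hJ hu hs x).1)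
    ((continuousOn_const.mul (hc.norm.rpow_const fun _ _ => Or.inr (by linarith))).mul hc'.norm)
    (fun x s _ => abs_norm_rpow_deriv_le hp _ _) ht ?_
  have h1 : Continuous fun x => u x t :=
    continuousOn_univ.1 (hc.comp (f := fun x => (x, t)) (by fun_prop) fun _ _ => ⟨mem_univ _, ht⟩)
  have h2 : Continuous fun x => deriv (u x) t :=
    continuousOn_univ.1 (hc'.comp (f := fun x => (x, t)) (by fun_prop) fun _ _ => ⟨mem_univ _, ht⟩)
  exact ((measurable_const.mul (h1.norm.measurable.pow_const _)).mul
    (h1.inner h2).measurable).aestronglyMeasurable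

/-- Differentiation under the integral gives -p∫|∇u|^{p-2}⟨∇u, ∇u_t⟩, and Green's formula moves the
gradient off u_t. The flux is never differentiated in time, so it need be C¹ in space only. -/
theorem hasDerivAt_energyD {f : M → ℝ} (hf : ContMDiff (𝓡 n) 𝓘(ℝ, ℝ) 1 f) {p : ℝ} (hp : 1 < p)
    (hJ : IsOpen J) (hu : ∀ k, SmoothFamily n (fun x t => u x t k) J) {t : ℝ} (ht : t ∈ J)
    (hX : ∀ k, IsC1Field (pFlux (n := n) p (fun y => u y t) k)) :
    HasDerivAt (energyD n f p u) (p * ∫ x, inner ℝ (deriv (u x) t)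
      (pLaplacian n f p (fun y => u y t) x) ∂(weightedVolume n f)) t := by
  have := isFiniteMeasure_weightedVolume (n := n) hf.continuous
  have hu' := smoothFamily_deriv_component hJ hu
  have hc := continuousOn_gradNorm hJ.uniqueDiffOn hu
  have hc' := continuousOn_gradNorm hJ.uniqueDiffOn hu'
  have hgrad : ∀ x, ∀ s ∈ J, ∀ k, HasDerivAt (fun s => grad (n := n) (fun y => u y s k) x)
      (grad (n := n) (fun y => (deriv (u y) s) k) x) s := by
    intro x s hs k
    have h := (hu k).hasDerivAt_grad hJ hs x
    have h2 : (fun y => (deriv (u y) s) k) = fun y => deriv (fun r => u y r k) s :=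
      funext fun y => (hasDerivAt_of_components hJ hu hs y).2 k
    rw [h2]
    exact h
  have h := hasDerivAt_integral_of_continuousOn (μ := weightedVolume n f)
    (F := fun x t => gradNorm n (fun y => u y t) x ^ p)
    (F' := fun x t => p * gradNorm n (fun y => u y t) x ^ (p - 2) *
      ∑ k, inner ℝ (grad (n := n) (fun y => u y t k) x)
        (grad (n := n) (fun y => (deriv (u y) t) k) x))
    (B := fun x t => p * gradNorm n (fun y => u y t) x ^ (p - 1) *
      gradNorm n (fun y => deriv (u y) t) x) hJ
    (hc.rpow_const fun _ _ => Or.inr (by linarith))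
    (fun x s hs => hasDerivAt_sqrt_rpow hp (hgrad x s hs))
    ((continuousOn_const.mul (hc.rpow_const fun _ _ => Or.inr (by linarith))).mul hc')
    (fun x s _ => abs_sqrt_rpow_deriv_le hp _ _) ht (by
      have h1 : Continuous fun x => gradNorm n (fun y => u y t) x :=
        continuous_slice (F := fun x t => gradNorm n (fun y => u y t) x) hc ht
      have h2 : ∀ k, Continuous fun x => inner ℝ (grad (n := n) (fun y => u y t k) x)
          (grad (n := n) (fun y => (deriv (u y) t) k) x) := fun k =>
        continuous_inner_grad (((hu k).contMDiff ht).of_le two_le_infty)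
          (((hu' k).contMDiff ht).of_le two_le_infty)
      exact ((measurable_const.mul (h1.measurable.pow_const _)).mul
        (continuous_finsetSum _ fun k _ => h2 k).measurable).aestronglyMeasurable)
  have hg := integral_inner_pLaplacian hf hX
    (w := fun y => deriv (u y) t) fun k => ((hu' k).contMDiff ht).of_le (by simp)
  refine h.neg.congr_deriv ?_
  simp only [mul_assoc]
  rw [integral_const_mul, hg]
  ring

theorem continuousOn_massI {f : M → ℝ} (hf : Continuous f) {p : ℝ} (hp : 0 ≤ p)
    (hu : ∀ k, SmoothFamily n (fun x t => u x t k) J) : ContinuousOn (massI n f p u) J := by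
  have := isFiniteMeasure_weightedVolume (n := n) hf
  exact continuousOn_integral_of_continuousOn (F := fun x t => ‖u x t‖ ^ p)
    ((continuousOn_of_components hu).norm.rpow_const fun _ _ => Or.inr hp)

theorem continuousOn_energyD {f : M → ℝ} (hf : Continuous f) {p : ℝ} (hp : 0 ≤ p)
    (hJ : UniqueDiffOn ℝ J) (hu : ∀ k, SmoothFamily n (fun x t => u x t k) J) :
    ContinuousOn (energyD n f p u) J := by
  have := isFiniteMeasure_weightedVolume (n := n) hf
  exact (continuousOn_integral_of_continuousOn (F := fun x t => gradNorm n (fun y => u y t) x ^ p)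
    ((continuousOn_gradNorm hJ hu).rpow_const fun _ _ => Or.inr hp)).neg

end Evolution

end PFreq

namespace PFreq

/-! ### The pointwise square behind monotonicity. -/

section Pointwise

variable {F : Type*} [NormedAddCommGroup F] [InnerProductSpace ℝ F]

theorem inner_rpow_smul_sub {p η : ℝ} (hp : 0 < p) (y v : F) :
    inner ℝ y (‖y‖ ^ (p - 2) • (v - η • y)) = ‖y‖ ^ (p - 2) * inner ℝ y v - η * ‖y‖ ^ p := by
  rw [inner_smul_right, inner_sub_right, inner_smul_right, real_inner_self_eq_norm_sq,
    ← rpow_mul_norm_sq hp y]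
  ring

/-- After factoring out ‖y‖^{p-2}, the coefficient of ⟨y, v⟩ is -η - (η + 2l) = -2(η + l) and that
of ‖y‖² is η(η + 2l) + l² = (η + l)²: a complete square. It is used with y = u, v = u_t. -/
theorem quadratic_identity {p η l : ℝ} (hp : 0 < p) (y v : F) :
    inner ℝ v (‖y‖ ^ (p - 2) • (v - η • y)) - (η + 2 * l) *
      inner ℝ y (‖y‖ ^ (p - 2) • (v - η • y)) + l ^ 2 * ‖y‖ ^ p =
      ‖y‖ ^ (p - 2) * ‖v - (η + l) • y‖ ^ 2 := by
  rw [inner_rpow_smul_sub hp, inner_smul_right, inner_sub_right, inner_smul_right,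
    real_inner_self_eq_norm_sq, norm_sub_sq_real, inner_smul_right, norm_smul, mul_pow,
    Real.norm_eq_abs, sq_abs, real_inner_comm v y, ← rpow_mul_norm_sq hp y]
  ring

end Pointwise

end PFreq

/-! ### Monotonicity of the frequency, the equality case and log-convexity. -/

theorem theorem5 {n m : ℕ} {M : Type*} [TopologicalSpace M] [T2Space M] [CompactSpace M]
    [ChartedSpace (EuclideanSpace ℝ (Fin n)) M] [IsManifold (𝓡 n) ∞ M]
    [RiemannianBundle (fun x : M => TangentSpace (𝓡 n) x)]
    [IsContMDiffRiemannianBundle (𝓡 n) ∞ (EuclideanSpace ℝ (Fin n))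
      (fun x : M => TangentSpace (𝓡 n) x)]
    [MeasurableSpace M] [BorelSpace M]
    (f : M → ℝ) (hf : ContMDiff (𝓡 n) 𝓘(ℝ, ℝ) 2 f)
    (p : ℝ) (hp : 1 < p) (a b : ℝ) (hab : a < b)
    (η : ℝ → ℝ) (hη : ContDiffOn ℝ ∞ η (Icc a b))
    (u : M → ℝ → EuclideanSpace ℝ (Fin m))
    (hu : ContMDiffOn ((𝓡 n).prod 𝓘(ℝ, ℝ)) 𝓘(ℝ, EuclideanSpace ℝ (Fin m)) ∞
      (fun q : M × ℝ => u q.1 q.2) (univ ×ˢ Icc a b))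
    (hu_ne : ∃ t ∈ Icc a b, ∃ x, u x t ≠ 0)
    -- if `p < 2`, the field `|∇u|^{p-2} ∇u` is `C¹`, so that `Δ_{f,p} u` is defined
    -- (if `p ≥ 2`, this is automatic)
    (hflux : p < 2 → ∀ t ∈ Icc a b, ∀ k : Fin m,
      ContMDiff (𝓡 n) (𝓡 n).tangent 1
        (fun x => (⟨x, PFreq.pFlux p (fun y => u y t) k x⟩ : TangentBundle (𝓡 n) M)))
    -- the equation; if `p < 2`, only where `u ≠ 0`, since `|u|^{p-2}` is undefined at zeros of `u`
    (heq : ∀ t ∈ Icc a b, ∀ x, (2 ≤ p ∨ u x t ≠ 0) →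
      ‖u x t‖ ^ (p - 2) • derivWithin (fun s => u x s) (Icc a b) t
          - PFreq.pLaplacian n f p (fun y => u y t) x
        = η t • (‖u x t‖ ^ (p - 2) • u x t)) :
    (∀ t ∈ Icc a b, 0 < PFreq.massI n f p u t) ∧
    (∀ t ∈ Icc a b, PFreq.energyD n f p u t =
      ∫ x, inner ℝ (u x t) (PFreq.pLaplacian n f p (fun y => u y t) x)
        ∂(PFreq.weightedVolume n f)) ∧
    MonotoneOn (PFreq.freqU n f p u) (Icc a b) ∧
    ((∀ t ∈ Icc a b, PFreq.freqU n f p u t = PFreq.freqU n f p u a) →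
      (∀ t ∈ Icc a b, ∀ x, PFreq.pLaplacian n f p (fun y => u y t) x =
        PFreq.freqU n f p u t • (‖u x t‖ ^ (p - 2) • u x t)) ∧
      (∀ t ∈ Icc a b, ∀ x, ‖u x t‖ ^ (p - 2) • u x t =
        (Real.exp ((p - 1) * (PFreq.freqU n f p u t * t - PFreq.freqU n f p u a * a)) *
          Real.exp ((p - 1) * ∫ s in a..t, η s)) • (‖u x a‖ ^ (p - 2) • u x a))) ∧
    (MonotoneOn η (Icc a b) →
      ConvexOn ℝ (Icc a b) (fun t => Real.log (PFreq.massI n f p u t))) := by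
  open PFreq in
  have hp0 : 0 < p := by linarith
  have hf1 : ContMDiff (𝓡 n) 𝓘(ℝ, ℝ) 1 f := hf.of_le one_le_two
  have hfin := isFiniteMeasure_weightedVolume (n := n) hf.continuous
  have hopen := isOpenPosMeasure_weightedVolume (n := n) hf.continuous
  have hus : ∀ k, SmoothFamily n (fun x t => u x t k) (Icc a b) := smoothFamily_component hu
  have hus' : ∀ k, SmoothFamily n (fun x t => u x t k) (Ioo a b) := fun k =>
    (hus k).mono Ioo_subset_Icc_self
  have hcu := continuousOn_of_components hus
  have hut : ∀ t ∈ Icc a b, Continuous fun x => u x t := fun t ht =>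
    continuousOn_univ.1 (hcu.comp (f := fun x => (x, t)) (by fun_prop) fun _ _ => ⟨mem_univ _, ht⟩)
  have hcomp : ∀ t ∈ Icc a b, ∀ k, ContMDiff (𝓡 n) 𝓘(ℝ, ℝ) 2 (fun x => u x t k) := fun t ht k =>
    ((hus k).contMDiff ht).of_le two_le_infty
  have hX : ∀ t ∈ Icc a b, ∀ k, IsC1Field (pFlux (n := n) p (fun y => u y t) k) := by
    intro t ht k
    rcases lt_or_ge p 2 with h | h
    · exact isC1Field_of_contMDiff (hflux h t ht k)
    · exact isC1Field_pFlux h (hcomp t ht) k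
  have hlap : ∀ t ∈ Icc a b, Continuous (pLaplacian n f p (fun y => u y t)) := fun t ht =>
    continuous_pLaplacian hf1 (hX t ht)
  have hzero : ∀ t ∈ Icc a b, ∀ᵐ x ∂(weightedVolume n f), u x t = 0 →
      pLaplacian n f p (fun y => u y t) x = 0 := fun t ht =>
    ae_pLaplacian_eq_zero hf1 (fun k => (hcomp t ht k).of_le one_le_two) (hut t ht) (hX t ht)
  -- For every p the equation is used only where u ≠ 0; the zeros of u are covered by `hzero`.
  have hpde : ∀ t ∈ Icc a b, ∀ x, u x t ≠ 0 → pLaplacian n f p (fun y => u y t) x =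
      ‖u x t‖ ^ (p - 2) • (derivWithin (u x) (Icc a b) t - η t • u x t) := by
    intro t ht x hx
    rw [smul_sub, smul_comm _ (η t), ← heq t ht x (Or.inr hx), sub_sub_cancel]
  have hdw : ∀ t ∈ Ioo a b, ∀ x, derivWithin (u x) (Icc a b) t = deriv (u x) t := fun t ht x =>
    derivWithin_of_mem_nhds (Icc_mem_nhds ht.1 ht.2)
  have hv : ∀ t ∈ Ioo a b, Continuous fun x => deriv (u x) t := fun t ht =>
    continuousOn_univ.1 ((continuousOn_of_components
      (smoothFamily_deriv_component isOpen_Ioo hus')).comp (f := fun x => (x, t)) (by fun_prop)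
      fun _ _ => ⟨mem_univ _, ht⟩)
  have hint : ∀ {h : M → ℝ}, Continuous h → Integrable h (weightedVolume n f) := fun hh =>
    hh.integrable_of_hasCompactSupport (HasCompactSupport.of_compactSpace _)
  have hpow : ∀ t ∈ Icc a b, Continuous fun x => ‖u x t‖ ^ p := fun t ht =>
    (hut t ht).norm.rpow_const fun _ => Or.inr hp0.le
  have hD : ∀ t ∈ Icc a b, energyD n f p u t =
      ∫ x, inner ℝ (u x t) (pLaplacian n f p (fun y => u y t) x) ∂(weightedVolume n f) :=
    fun t ht => energyD_eq hf1 hp0 (hX t ht) fun k => (hcomp t ht k).of_le one_le_two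
  have hI' : ∀ t ∈ Ioo a b, HasDerivAt (massI n f p u)
      (p * (energyD n f p u t + η t * massI n f p u t)) t := by
    intro t ht
    have ht' := Ioo_subset_Icc_self ht
    refine (hasDerivAt_massI hf.continuous hp isOpen_Ioo hus' ht).congr_deriv ?_
    rw [hD t ht', massI, ← integral_const_mul, ← integral_add
      (hint ((hut t ht').inner (𝕜 := ℝ) (hlap t ht'))) ((hint (hpow t ht')).const_mul (η t)),
      ← integral_const_mul]
    refine integral_congr_ae (ae_of_all _ fun x => ?_)
    by_cases h0 : u x t = 0
    · simp [h0, Real.zero_rpow hp0.ne']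
    · simp only
      rw [hpde t ht' x h0, inner_rpow_smul_sub hp0, hdw t ht]
      ring
  set D' : ℝ → ℝ := fun t => p * ∫ x, inner ℝ (deriv (u x) t)
      (pLaplacian n f p (fun y => u y t) x) ∂(weightedVolume n f) with hD'def
  have hD' : ∀ t ∈ Ioo a b, HasDerivAt (energyD n f p u) (D' t) t := fun t ht =>
    hasDerivAt_energyD hf1 hp isOpen_Ioo hus' ht (hX t (Ioo_subset_Icc_self ht))
  -- Written with Δu instead of |u|^{p-2}u_t, the integrand is continuous on M even for p < 2. It is
  -- a square where u ≠ 0 and vanishes almost everywhere on {u = 0}.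
  set Q : ℝ → ℝ → M → ℝ := fun l t x =>
    inner ℝ (deriv (u x) t) (pLaplacian n f p (fun y => u y t) x) - (η t + 2 * l) *
      inner ℝ (u x t) (pLaplacian n f p (fun y => u y t) x) + l ^ 2 * ‖u x t‖ ^ p with hQ
  have hQc : ∀ l, ∀ t ∈ Ioo a b, Continuous (Q l t) := fun l t ht => by
    have ht' := Ioo_subset_Icc_self ht
    exact (((hv t ht).inner (hlap t ht')).sub (continuous_const.mul
      ((hut t ht').inner (hlap t ht')))).add (continuous_const.mul (hpow t ht'))
  have hQsq : ∀ l, ∀ t ∈ Ioo a b, ∀ x, u x t ≠ 0 →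
      Q l t x = ‖u x t‖ ^ (p - 2) * ‖deriv (u x) t - (η t + l) • u x t‖ ^ 2 := by
    intro l t ht x hx
    simp only [hQ]
    rw [hpde t (Ioo_subset_Icc_self ht) x hx, hdw t ht, quadratic_identity hp0]
  have hQ0 : ∀ l, ∀ t ∈ Ioo a b, 0 ≤ᵐ[weightedVolume n f] Q l t := by
    intro l t ht
    filter_upwards [hzero t (Ioo_subset_Icc_self ht)] with x hx
    by_cases h0 : u x t = 0
    · simp [hQ, hx h0, h0, Real.zero_rpow hp0.ne']
    · rw [hQsq l t ht x h0]
      exact mul_nonneg (Real.rpow_nonneg (norm_nonneg _) _) (sq_nonneg _)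
  have hQint : ∀ l, ∀ t ∈ Ioo a b, p * ∫ x, Q l t x ∂(weightedVolume n f) =
      D' t - p * (η t + 2 * l) * energyD n f p u t + p * l ^ 2 * massI n f p u t := by
    intro l t ht
    have ht' := Ioo_subset_Icc_self ht
    have i1 := hint ((hv t ht).inner (𝕜 := ℝ) (hlap t ht'))
    have i2 := (hint ((hut t ht').inner (𝕜 := ℝ) (hlap t ht'))).const_mul (η t + 2 * l)
    have i3 := (hint (hpow t ht')).const_mul (l ^ 2)
    have i12 : Integrable (fun x =>
        inner ℝ (deriv (u x) t) (pLaplacian n f p (fun y => u y t) x) - (η t + 2 * l) *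
          inner ℝ (u x t) (pLaplacian n f p (fun y => u y t) x)) (weightedVolume n f) := i1.sub i2
    simp only [hQ]
    rw [integral_add i12 i3, integral_sub i1 i2, integral_const_mul, integral_const_mul,
      ← hD t ht', hD'def, massI]
    ring
  -- With l = D/I, the terms -2lD and l²I in the integral of Q combine to -D²/I, which is what the
  -- numerator of U' requires.
  have hCSeq : ∀ t ∈ Ioo a b, 0 < massI n f p u t → D' t * massI n f p u t -
      energyD n f p u t * (p * (energyD n f p u t + η t * massI n f p u t)) =
      massI n f p u t * (p * ∫ x, Q (freqU n f p u t) t x ∂(weightedVolume n f)) := by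
    intro t ht hpos
    rw [hQint _ t ht, freqU]
    field_simp
    ring
  have hCS : ∀ t ∈ Ioo a b, 0 < massI n f p u t → 0 ≤ D' t * massI n f p u t -
      energyD n f p u t * (p * (energyD n f p u t + η t * massI n f p u t)) := by
    intro t ht hpos
    rw [hCSeq t ht hpos]
    exact mul_nonneg hpos.le (mul_nonneg hp0.le (integral_nonneg_of_ae (hQ0 _ t ht)))
  have hIc : ContinuousOn (massI n f p u) (Icc a b) := continuousOn_massI hf.continuous hp0.le hus
  have hDc : ContinuousOn (energyD n f p u) (Icc a b) :=
    continuousOn_energyD hf.continuous hp0.le (uniqueDiffOn_Icc hab) hus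
  have hIpos : ∀ t ∈ Icc a b, 0 < massI n f p u t := by
    refine mass_pos hp0 hIc hDc hη.continuousOn
      (fun t => integral_nonneg fun x => Real.rpow_nonneg (norm_nonneg _) _)
      (fun t => neg_nonpos.2 (integral_nonneg fun x => Real.rpow_nonneg (gradNorm_nonneg _ _) _))
      hI' hD' hCS ?_
    obtain ⟨t, ht, x, hx⟩ := hu_ne
    refine ⟨t, ht, ?_⟩
    exact (hpow t ht).integral_pos_of_hasCompactSupport_nonneg_nonzero
      (HasCompactSupport.of_compactSpace _) (fun x => Real.rpow_nonneg (norm_nonneg _) _)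
      (x := x) (Real.rpow_pos_of_pos (norm_pos_iff.2 hx) p).ne'
  have hmono : MonotoneOn (freqU n f p u) (Icc a b) :=
    monotoneOn_div_of_pos (convex_Icc a b) hIc hDc hIpos
      (fun t ht => hI' t (by rwa [interior_Icc] at ht))
      (fun t ht => hD' t (by rwa [interior_Icc] at ht))
      (fun t ht => hCS t (by rwa [interior_Icc] at ht))
  refine ⟨hIpos, hD, hmono, fun hconst => ?_,
    fun hηm => convexOn_log_mass hIc hp0.le hIpos hI' hmono hηm⟩
  set l := freqU n f p u a with hl
  have hode : ∀ t ∈ Ioo a b, ∀ x, u x t ≠ 0 → deriv (u x) t = (η t + l) • u x t := by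
    intro t ht x hx
    have ht' := Ioo_subset_Icc_self ht
    have hpos := hIpos t ht'
    have h1 := hasDerivAt_div_freq (hI' t ht) (hD' t ht) hpos
    have h2 : (fun s => energyD n f p u s / massI n f p u s) =ᶠ[nhds t] fun _ => l := by
      filter_upwards [Icc_mem_nhds ht.1 ht.2] with s hs using hconst s hs
    have h3 := h1.unique ((hasDerivAt_const t l).congr_of_eventuallyEq h2)
    rw [hCSeq t ht hpos, div_eq_zero_iff, or_iff_left (pow_pos hpos 2).ne', mul_eq_zero,
      or_iff_right hpos.ne', mul_eq_zero, or_iff_right hp0.ne', hconst t ht',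
      integral_eq_zero_iff_of_nonneg_ae (hQ0 l t ht) (hint (hQc l t ht))] at h3
    -- U' = 0 forces ∫Q = 0, so Q vanishes almost everywhere, hence everywhere by continuity, the
    -- measure charging open sets.
    have h4 : Q l t = fun _ => (0 : ℝ) :=
      (Continuous.ae_eq_iff_eq _ (hQc l t ht) continuous_const).1 h3
    have h5 : Q l t x = 0 := congrFun h4 x
    rw [hQsq l t ht x hx, mul_eq_zero, or_iff_right
      (Real.rpow_pos_of_pos (norm_pos_iff.2 hx) _).ne', sq_eq_zero_iff, norm_eq_zero,
      sub_eq_zero] at h5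
    exact h5
  have hux : ∀ x, ContDiffOn ℝ ∞ (u x) (Icc a b) := by
    intro x
    rw [← contMDiffOn_iff_contDiffOn]
    exact hu.comp (f := fun t : ℝ => (x, t)) (contMDiff_const.prodMk contMDiff_id).contMDiffOn
      fun t ht => ⟨mem_univ _, ht⟩
  -- The end times are reached as limits of interior times, at which u(x, ·) is still nonzero.
  have hode' : ∀ t ∈ Icc a b, ∀ x, u x t ≠ 0 →
      derivWithin (u x) (Icc a b) t = (η t + l) • u x t := by
    intro t ht x hx
    have hle : nhdsWithin t (Ioo a b) ≤ nhdsWithin t (Icc a b) :=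
      nhdsWithin_mono t Ioo_subset_Icc_self
    have : (nhdsWithin t (Ioo a b)).NeBot := by
      rw [← mem_closure_iff_nhdsWithin_neBot, closure_Ioo hab.ne]
      exact ht
    have c1 := (((hux x).continuousOn_derivWithin (uniqueDiffOn_Icc hab) (by simp)) t ht).mono_left hle
    have c0 := ((hux x).continuousOn t ht).mono_left hle
    have c2 := (((hη.continuousOn t ht).add continuousWithinAt_const).smul
      ((hux x).continuousOn t ht) (f := fun t => η t + l)).mono_left hle
    refine tendsto_nhds_unique_of_eventuallyEq c1 c2 ?_
    filter_upwards [c0.eventually_ne hx, self_mem_nhdsWithin] with s hs hsI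
    rw [hdw s hsI]
    exact hode s hsI x hs
  refine ⟨fun t ht => ?_, fun t ht x => ?_⟩
  · have h1 : (pLaplacian n f p (fun y => u y t)) =ᵐ[weightedVolume n f]
        fun x => freqU n f p u t • (‖u x t‖ ^ (p - 2) • u x t) := by
      filter_upwards [hzero t ht] with x hx
      by_cases h0 : u x t = 0
      · rw [hx h0, h0, smul_zero, smul_zero]
      · rw [hpde t ht x h0, hode' t ht x h0, hconst t ht, add_smul, add_sub_cancel_left, smul_comm]
    have hc0 : Continuous fun x => ‖u x t‖ ^ (p - 2) • u x t :=
      (continuous_rpow_smul hp).comp (hut t ht)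
    have hc : Continuous fun x => freqU n f p u t • (‖u x t‖ ^ (p - 2) • u x t) :=
      hc0.const_smul (freqU n f p u t)
    exact congrFun ((Continuous.ae_eq_iff_eq _ (hlap t ht) hc).1 h1)
  · have h1 := eq_exp_integral_smul (k := fun s => η s + l) (hux x).continuousOn
      (fun s hs => (hasDerivAt_of_components isOpen_Ioo hus' hs x).1)
      (hη.continuousOn.add continuousOn_const) (fun s hs hxs => hode s hs x hxs) t ht
    have hηi : IntervalIntegrable η volume a t :=
      (hη.continuousOn.mono (Icc_subset_Icc_right ht.2)).intervalIntegrable_of_Icc ht.1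
    have h2 : ∫ s in a..t, (η s + l) = (∫ s in a..t, η s) + l * (t - a) := by
      rw [intervalIntegral.integral_add hηi intervalIntegrable_const,
        intervalIntegral.integral_const, smul_eq_mul, mul_comm l]
    rw [h2] at h1
    rw [h1, rpow_smul_smul (Real.exp_pos _), ← Real.exp_mul, ← Real.exp_add, hconst t ht]
    congr 2
    ring
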